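/- **Setting.** Let $G$ be a finite connected graph embedded on the sphere (loops and parallel edges allowed), each edge being a pair of opposite darts $d,\mathrm{rev}(d)$; let $s\ne t$ be vertices, and choose a corner of a face $f_s$ at $s$ and a corner of a face $f_t$ at $t$. Take $f_\infty=f_t$. Capacities ${\bf c}\ge 0$ are real numbers on the darts; a flow assignment ${\bf f}$ is antisymmetric, and a dart $d$ is residual if ${\bf c}[d]-{\bf f}[d]>0$. A circulation is clockwise if it is given by a nonnegative face potential that vanishes on $f_\infty$ (flow on a dart = potential of its right face minus that of its left face); a simple cycle is clockwise if the unit circulation along it is. Capacities are clockwise-acyclic if no clockwise cycle is residual; a flow is leftmost if its residual capacities are clockwise-acyclic. A path $A$ is left of a path $B$ if $A\cup\mathrm{rev}(B)$ is a clockwise circulation. Let $\phi$ be the minimum number of faces that a curve from $s$ to $t$ meeting the graph only in vertices must pass through. Let ${\bf c}$ be clockwise-acyclic, suppose that there is a residual $s$-to-$t$ path, let $L$ be the leftmost simple one, and let ${\bf f}$ be the leftmost maximum $st$-flow, of value $|{\bf f}|$. The universal cover of the cylinder obtained from the sphere by removing the interiors of $f_s$ and $f_t$ carries a cover of $G$,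 which the lifts of $L$ divide into copies of $G$; let ${\cal G}_k$ consist of $k$ consecutive copies, bounded by a lift of $L$ on the left and by an extra lift of $L$ on the right (each other lift of $L$ belongs to the copy on its right). Its sources $s^0,\dots,s^k$ and sinks $t^0,\dots,t^k$ are the copies of $s$ and $t$. Let ${\cal G}_k^{ST}$ be ${\cal G}_k$ with a super-source $S$ below it, with arcs $Ss^i$, and a super-sink $T$ above it, with arcs $t^iT$; $f_\infty$ is now the outer face, which contains $S$ and $T$ on its boundary. Let ${\bf c}^{M}$ be the capacities inherited from $G$ together with capacity $M$ on the arcs at $S$ and $T$. Let ${\bf f}_0$ be the lift of ${\bf f}$ to ${\cal G}_k$, and let ${\bf f}_1$ be any flow in ${\cal G}_k$ from the sources to the sinks that is obtained from ${\bf f}_0$ by flow cancelling, that is, by repeatedly reducing the flow on flow paths from a source to an excess vertex, from a deficit vertex to a sink, or from a deficit to an excess vertex, by no more than the excess and deficit concerned. Let ${\bf f}_1^{ST}$ be its natural extension to ${\cal G}_k^{ST}$. **Claim.** Let $k\ge 4\phi+1$. 1. Such an ${\bf f}_1$ exists; every ${\bf f}_1^{ST}$ is an $ST$-flow that respects ${\bf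 c}^{|{\bf f}|}$; there is exactly one leftmost maximum $ST$-flow ${\bf f}^{|{\bf f}|}$ of ${\cal G}_k^{ST}$ for the capacities ${\bf c}^{|{\bf f}|}$; and every ${\bf f}_1^{ST}$ can be turned into ${\bf f}^{|{\bf f}|}$ by changing the flow, among the darts of ${\cal G}_k$, only on darts in the first $2\phi$ or the last $2\phi$ copies of $G$ or on the extra lift of $L$ at the right end. 2. ${\bf f}^{|{\bf f}|}$ coincides with ${\bf f}$ on every copy of $G$ that is not among the first $2\phi$ or the last $2\phi$; in particular on copy number $2\phi+1$. 3. Hence finding a maximum $st$-flow for arbitrary capacities ${\bf c}_0\ge 0$ on $G$ reduces to three dual shortest-path computations (capacities of darts are lengths of the dual arcs, which lead from the left to the right face of the dart; a distance function ${\bm\delta}$ gives the flow ${\bm\delta}[\text{right face of }d]-{\bm\delta}[\text{left face of }d]$ on $d$). (i) Let ${\bf h}$ be the flow given by the distances from $f_t$ in the dual of $G$ for ${\bf c}_0$. Then ${\bf c}={\bf c}_0-{\bf h}$ is nonnegative and clockwise-acyclic. Either there is a leftmost simple residual $s$-to-$t$ path $L$ for ${\bf c}$, or ${\bf h}$ itself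 is the leftmost maximum $st$-flow for ${\bf c}_0$ (when no residual $s$-to-$t$ path exists). If such a path $L$ exists, form ${\cal G}_k$ with it, let ${\bf f}$ be the leftmost maximum $st$-flow of $G$ for ${\bf c}$, and split the outer face of ${\cal G}_k^{ST}$ at $S$ and $T$ into its left and right part. (ii) If $M\ge\sum_d{\bf c}[d]$, then the flow on $Ss^{2\phi}$ given by the dual distances for ${\bf c}^M$ from the left part is $|{\bf f}|$. (iii) The flow given by the dual distances for ${\bf c}^{|{\bf f}|}$ from the left part is ${\bf f}^{|{\bf f}|}$; its restriction to copy number $2\phi+1$ is ${\bf f}$; and ${\bf h}+{\bf f}$ is the leftmost maximum $st$-flow of $G$ for ${\bf c}_0$. -/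

import Mathlib

noncomputable section

namespace PlanarFlow

/-! ### Graphs with darts, walks and flows -/

/-- A graph given by its darts: every edge is a pair `{d, rev d}` of oppositely directed darts.
Loops and parallel edges are allowed. -/
structure DartGraph (V D : Type*) where
  rev : D → D
  rev_rev : ∀ d, rev (rev d) = d
  rev_ne : ∀ d, rev d ≠ d
  tail : D → V

namespace DartGraph

variable {V D : Type*} (G : DartGraph V D)

def head (d : D) : V := G.tail (G.rev d)

/-- `l` is a walk from `u` to `v`. -/
def IsWalk : V → List D → V → Prop
  | u, [], v => u = v
  | u, d :: l, v => G.tail d = u ∧ IsWalk (G.head d) l v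

/-- A walk from `u` to `v` that visits no vertex twice. -/
def IsSimplePath (u : V) (l : List D) (v : V) : Prop :=
  G.IsWalk u l v ∧ (l.map G.tail ++ [v]).Nodup

/-- A nonempty closed walk that visits no vertex twice and contains no dart with its reverse. -/
def IsSimpleCycle (l : List D) : Prop :=
  l ≠ [] ∧ (∃ u, G.IsWalk u l u) ∧ (l.map G.tail).Nodup ∧ ∀ d ∈ l, G.rev d ∉ l

open Classical in
/-- The flow assignment that sends one unit along the darts of `l`. -/
def along (l : List D) (d : D) : ℝ := (l.count d : ℝ) - (l.count (G.rev d) : ℝ)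

open Classical in
/-- Net flow of a vertex: the sum of the flow of the darts whose head is `v`. -/
def net [Fintype D] (f : D → ℝ) (v : V) : ℝ := ∑ d with G.head d = v, f d

/-- An antisymmetric flow assignment that respects the capacities. -/
def IsPseudoflow (c f : D → ℝ) : Prop :=
  (∀ d, f (G.rev d) = - f d) ∧ ∀ d, f d ≤ c d

/-- An `ST`-flow: a pseudoflow whose deficit vertices are in `S` and excess vertices in `T`. -/
def IsFlow [Fintype D] (c : D → ℝ) (S T : Set V) (f : D → ℝ) : Prop :=
  G.IsPseudoflow c f ∧ (∀ v, G.net f v < 0 → v ∈ S) ∧ (∀ v, 0 < G.net f v → v ∈ T)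

/-- The value of a flow with the single source `s`: the net amount of flow that leaves `s`. -/
def value [Fintype D] (f : D → ℝ) (s : V) : ℝ := - G.net f s

/-- A maximum flow with source `s` and sink `t`. -/
def IsMaxFlow [Fintype D] (c : D → ℝ) (s t : V) (f : D → ℝ) : Prop :=
  G.IsFlow c {s} {t} f ∧ ∀ g, G.IsFlow c {s} {t} g → G.value g s ≤ G.value f s

/-- One step of flow cancelling (sources `S`, sinks `T`): the flow is reduced by `δ` on a simple
flow path that leads from a source to an excess vertex, from a deficit vertex to a sink, or from a
deficit vertex to an excess vertex; `δ` is at most the flow of each dart of the path, the excess of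
its last and the deficit of its first vertex (where these are not a source or a sink). -/
def CancelStep [Fintype D] (S T : Set V) (f f' : D → ℝ) : Prop :=
  ∃ (u v : V) (l : List D) (δ : ℝ), G.IsSimplePath u l v ∧ 0 < δ ∧ (∀ d ∈ l, δ ≤ f d) ∧
    (u ∈ S ∨ (u ∉ T ∧ G.net f u ≤ -δ)) ∧ (v ∈ T ∨ (v ∉ S ∧ δ ≤ G.net f v)) ∧
    ¬ (u ∈ S ∧ v ∈ T) ∧ f' = fun d => f d - δ * G.along l d

/-- `f₁` is an `ST`-flow that is obtained from `f₀` by flow cancelling. -/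
def IsCancelledFlow [Fintype D] (c : D → ℝ) (S T : Set V) (f₀ f₁ : D → ℝ) : Prop :=
  Relation.ReflTransGen (G.CancelStep S T) f₀ f₁ ∧ G.IsFlow c S T f₁

end DartGraph

/-! ### Faces, clockwise cycles, leftmost flows, dual distances -/

/-- A dart graph together with the face on the right of every dart. -/
structure FacedGraph (V D F : Type*) extends DartGraph V D where
  right : D → F

namespace FacedGraph

variable {V D F : Type*} (G : FacedGraph V D F)

def left (d : D) : F := G.right (G.rev d)

/-- `f` is a clockwise circulation (`o` is the infinite face): it is given by a nonnegative
potential that vanishes on `o`. -/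
def IsClockwise (o : F) (f : D → ℝ) : Prop :=
  ∃ p : F → ℝ, p o = 0 ∧ (∀ x, 0 ≤ p x) ∧ ∀ d, f d = p (G.right d) - p (G.left d)

def IsClockwiseCycle (o : F) (l : List D) : Prop :=
  G.IsSimpleCycle l ∧ G.IsClockwise o (G.along l)

/-- No clockwise cycle is residual with respect to the (residual) capacities `c`. -/
def CwAcyclic (o : F) (c : D → ℝ) : Prop :=
  ∀ l, G.IsClockwiseCycle o l → ∃ d ∈ l, ¬ 0 < c d

/-- A leftmost maximum flow: no clockwise cycle is residual with respect to `c - f`. -/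
def IsLeftmostMaxFlow [Fintype D] (o : F) (c : D → ℝ) (s t : V) (f : D → ℝ) : Prop :=
  G.IsMaxFlow c s t f ∧ G.CwAcyclic o (fun d => c d - f d)

/-- `l` is a simple residual path from `s` to `t`. -/
def IsResidualPath (c : D → ℝ) (s t : V) (l : List D) : Prop :=
  G.IsSimplePath s l t ∧ ∀ d ∈ l, 0 < c d

/-- `L` is a leftmost residual path from `s` to `t`: no other residual path is left of it, where
`A` is left of `B` if `A` together with the reverse of `B` is a clockwise circulation. -/
def IsLeftmostPath (o : F) (c : D → ℝ) (s t : V) (L : List D) : Prop :=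
  G.IsResidualPath c s t L ∧
    ∀ A, G.IsResidualPath c s t A → G.IsClockwise o (fun d => G.along A d - G.along L d) → A = L

/-- A walk in the dual graph: the dual of a dart leads from its left to its right face. -/
def IsDualWalk : F → List D → F → Prop
  | x, [], y => x = y
  | x, d :: l, y => G.left d = x ∧ IsDualWalk (G.right d) l y

/-- Shortest-path distance in the dual graph, with the capacities as (nonnegative) lengths. -/
def dualDist (c : D → ℝ) (x y : F) : ℝ :=
  sInf {r | ∃ l, G.IsDualWalk x l y ∧ r = (l.map c).sum}

/-- The flow assignment given by the dual shortest-path distances from the root face. -/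
def dualFlow (c : D → ℝ) (root : F) (d : D) : ℝ :=
  G.dualDist c root (G.right d) - G.dualDist c root (G.left d)

/-- There is a sequence of `n` faces leading from `u` to `v`, consecutive ones sharing a vertex. -/
inductive FaceCurve : ℕ → V → V → Prop
  | refl (u : V) : FaceCurve 0 u u
  | step (n : ℕ) (d e : D) (v : V) (h : G.right d = G.right e) (hv : FaceCurve n (G.tail e) v) :
      FaceCurve (n + 1) (G.tail d) v

/-- The minimum number of faces that a curve from `s` to `t` must pass through. -/
def facesBetween (s t : V) : ℕ := sInf {n | G.FaceCurve n s t}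

end FacedGraph

/-! ### Plane graphs -/

/-- A connected graph embedded on the sphere, given by its rotation system: `rot d` is the next
dart, in clockwise order, among the darts whose tail is the tail of `d`. The face on the right of
`d` is the one at the corner between `d` and `rot d`; following its boundary, `d` is succeeded by
`rot⁻¹ (rev d)`. Vertices and faces are the orbits of these two permutations. -/
structure PlaneGraph (V D F : Type*) extends FacedGraph V D F where
  rot : Equiv.Perm D
  tail_eq_iff : ∀ d e, tail d = tail e ↔ rot.SameCycle d e
  right_eq_iff : ∀ d e, right d = right e ↔
    (rot⁻¹ * Function.Involutive.toPerm rev rev_rev).SameCycle d e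
  tail_surj : Function.Surjective tail
  right_surj : Function.Surjective right
  connected : ∀ u v, ∃ l, toDartGraph.IsWalk u l v
  euler : 2 * Nat.card V + 2 * Nat.card F = Nat.card D + 4

namespace PlaneGraph

variable {V D F : Type*} (G : PlaneGraph V D F)

/-- Going clockwise around the tail of `x`, the dart `d` is strictly after `x` and before `y`. -/
def Between (x y d : D) : Prop :=
  ∃ m : ℕ, d = (G.rot ^ (m + 1)) x ∧ ∀ j ≤ m, (G.rot ^ (j + 1)) x ≠ y

/-! In the rest of this file `a` and `b` stand for the corners (between `a` and `rot a`, and between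
`b` and `rot b`) at which the faces `f_s = right a` and `f_t = right b` are chosen at the source
`s = tail a` and at the sink `t = tail b`, and `L` is a simple path from `s` to `t`. -/

/-- The dart `d`, with its tail on `L`, leaves `L` on its left side. At the ends of `L` the sides
are separated by the chosen corners. -/
def LeavesLeft (a b : D) (L : List D) (d : D) : Prop :=
  (∃ x ∈ L.head?, G.Between a x d) ∨
  (∃ x y, [x, y] <:+: L ∧ G.Between (G.rev x) y d) ∨
  (∃ x ∈ L.getLast?, G.Between (G.rev x) (G.rot b) d)

/-- `v` is a vertex of `L`. -/
def OnPath (a b : D) (L : List D) (v : V) : Prop :=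
  v = G.tail a ∨ v = G.tail b ∨ ∃ d ∈ L, v = G.tail d ∨ v = G.head d

/-- `d` or its reverse is a dart of `L`. -/
def OnPathDart (L : List D) (d : D) : Prop := d ∈ L ∨ G.rev d ∈ L

/-! ### The finite cover

Cutting the universal cover of the cylinder (the sphere minus the interiors of `f_s` and `f_t`)
open along the lifts of `L` yields copies of `G` cut open along `L`, each glued to the next. The
finite cover consists of the copies number `0, …, k - 1`, from left to right; copy `i` lies between
the lifts `i` and `i + 1` of `L`, and the lift `i` of `L` is counted as a part of copy `i`. The
lift `k` of `L` is the extra one at the right end. -/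

def CoverVertex (a b : D) (L : List D) (k : ℕ) : Type _ :=
  {x : V × ℕ // x.2 < k ∨ (x.2 = k ∧ G.OnPath a b L x.1)}

def CoverDart (L : List D) (k : ℕ) : Type _ :=
  {x : D × Fin (k + 1) // x.2.val < k ∨ G.OnPathDart L x.1}

instance instFiniteCoverDart [Finite D] (L : List D) (k : ℕ) : Finite (G.CoverDart L k) :=
  inferInstanceAs (Finite {x : D × Fin (k + 1) // x.2.val < k ∨ G.OnPathDart L x.1})

instance instFintypeCoverDart [Fintype D] (L : List D) (k : ℕ) : Fintype (G.CoverDart L k) :=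
  Fintype.ofFinite _

theorem OnPathDart.onPath {G : PlaneGraph V D F} {L : List D} {d : D} (h : G.OnPathDart L d)
    (a b : D) : G.OnPath a b L (G.tail d) := by
  rcases h with h | h
  · exact Or.inr (Or.inr ⟨d, h, Or.inl rfl⟩)
  · refine Or.inr (Or.inr ⟨_, h, Or.inr ?_⟩)
    simp [DartGraph.head, G.rev_rev]

theorem OnPathDart.rev {G : PlaneGraph V D F} {L : List D} {d : D} (h : G.OnPathDart L d) :
    G.OnPathDart L (G.rev d) := by
  rcases h with h | h
  · exact Or.inr (by rwa [G.rev_rev])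
  · exact Or.inl h

/-- The dart lies off `L` and leaves `L` on its left side. In copy `i` it is attached to the lift
`i + 1` of `L`. -/
def Shifted (a b : D) (L : List D) (d : D) : Prop :=
  ¬ G.OnPathDart L d ∧ G.OnPath a b L (G.tail d) ∧ G.LeavesLeft a b L d

open Classical in
def coverTail (a b : D) (L : List D) (k : ℕ) (x : G.CoverDart L k) : G.CoverVertex a b L k :=
  if h : G.Shifted a b L x.1.1 then
    ⟨(G.tail x.1.1, x.1.2.val + 1), by
      have h1 : x.1.2.val < k := x.2.resolve_right h.1
      rcases Nat.lt_or_ge (x.1.2.val + 1) k with h2 | h2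
      · exact Or.inl h2
      · exact Or.inr ⟨by simp only; omega, h.2.1⟩⟩
  else
    ⟨(G.tail x.1.1, x.1.2.val), by
      rcases Nat.lt_or_ge x.1.2.val k with h2 | h2
      · exact Or.inl h2
      · have h3 : x.1.2.val = k := le_antisymm (Nat.le_of_lt_succ x.1.2.isLt) h2
        exact Or.inr ⟨h3, (x.2.resolve_left (by omega)).onPath a b⟩⟩

/-- The finite cover, made of `k` copies of `G` and an extra copy of `L`. -/
def cover (a b : D) (L : List D) (k : ℕ) :
    DartGraph (G.CoverVertex a b L k) (G.CoverDart L k) where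
  rev x := ⟨(G.rev x.1.1, x.1.2), x.2.imp id OnPathDart.rev⟩
  rev_rev x := Subtype.ext (Prod.ext (G.rev_rev _) rfl)
  rev_ne x h := G.rev_ne x.1.1 (congrArg (fun y => y.1.1) h)
  tail := G.coverTail a b L k

/-- The source `s^i` of the cover. -/
def coverSource (a b : D) (L : List D) {k : ℕ} (i : Fin (k + 1)) : G.CoverVertex a b L k :=
  ⟨(G.tail a, i.val), by
    rcases Nat.lt_or_ge i.val k with h | h
    · exact Or.inl h
    · exact Or.inr ⟨le_antisymm (Nat.le_of_lt_succ i.isLt) h, Or.inl rfl⟩⟩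

/-- The sink `t^i` of the cover. -/
def coverSink (a b : D) (L : List D) {k : ℕ} (i : Fin (k + 1)) : G.CoverVertex a b L k :=
  ⟨(G.tail b, i.val), by
    rcases Nat.lt_or_ge i.val k with h | h
    · exact Or.inl h
    · exact Or.inr ⟨le_antisymm (Nat.le_of_lt_succ i.isLt) h, Or.inr (Or.inl rfl)⟩⟩

/-! ### The finite cover with a super-source below and a super-sink above it -/

inductive STVertex (a b : D) (L : List D) (k : ℕ)
  | S : STVertex a b L k
  | T : STVertex a b L k
  | vertex (v : G.CoverVertex a b L k) : STVertex a b L k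

/-- The darts: those of the cover, the arcs `S → s^i` and `t^i → T`, and the reverses of these. -/
inductive STDart (L : List D) (k : ℕ)
  | dart (x : G.CoverDart L k) : STDart L k
  | source (i : Fin (k + 1)) : STDart L k
  | sourceRev (i : Fin (k + 1)) : STDart L k
  | sink (i : Fin (k + 1)) : STDart L k
  | sinkRev (i : Fin (k + 1)) : STDart L k

instance instFiniteSTDart [Finite D] (L : List D) (k : ℕ) : Finite (G.STDart L k) := by
  let φ : G.CoverDart L k ⊕ (Fin (k + 1) ⊕ Fin (k + 1)) ⊕ (Fin (k + 1) ⊕ Fin (k + 1)) →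
      G.STDart L k := fun x => match x with
    | .inl x => .dart x
    | .inr (.inl (.inl i)) => .source i
    | .inr (.inl (.inr i)) => .sourceRev i
    | .inr (.inr (.inl i)) => .sink i
    | .inr (.inr (.inr i)) => .sinkRev i
  refine Finite.of_surjective φ ?_
  rintro (x | i | i | i | i)
  · exact ⟨.inl x, rfl⟩
  · exact ⟨.inr (.inl (.inl i)), rfl⟩
  · exact ⟨.inr (.inl (.inr i)), rfl⟩
  · exact ⟨.inr (.inr (.inl i)), rfl⟩
  · exact ⟨.inr (.inr (.inr i)), rfl⟩

instance instFintypeSTDart [Fintype D] (L : List D) (k : ℕ) : Fintype (G.STDart L k) :=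
  Fintype.ofFinite _

/-- The face `g` in the `j`-th copy of `G`, where the copies are numbered `1, …, k` here. Number `0`
stands for the part of the outer face on the left of the cover, and every number above `k` for the
part on the right of it. The arcs at `S` and `T` cut the region below (above) the cover into pieces
between consecutive sources (sinks), which serve as the copies of `f_s` (of `f_t`). -/
def copyFace (k : ℕ) (g : F) (j : ℕ) : F × Fin k ⊕ Bool :=
  if j = 0 then Sum.inr false
  else if h : j - 1 < k then Sum.inl (g, ⟨j - 1, h⟩)
  else Sum.inr true

open Classical in
/-- The cover with `S` and `T` attached. Its outer face, which is the common face of `S` and `T`, is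
split here into a left part `inr false` and a right part `inr true`, as is done to compute a leftmost
maximum flow by dual shortest paths. -/
def coverSTSplit (a b : D) (L : List D) (k : ℕ) :
    FacedGraph (G.STVertex a b L k) (G.STDart L k) (F × Fin k ⊕ Bool) where
  rev
    | .dart x => .dart ((G.cover a b L k).rev x)
    | .source i => .sourceRev i
    | .sourceRev i => .source i
    | .sink i => .sinkRev i
    | .sinkRev i => .sink i
  rev_rev
    | .dart x => congrArg STDart.dart ((G.cover a b L k).rev_rev x)
    | .source _ => rfl
    | .sourceRev _ => rfl
    | .sink _ => rfl
    | .sinkRev _ => rfl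
  rev_ne
    | .dart x => fun h => (G.cover a b L k).rev_ne x (STDart.dart.inj h)
    | .source _ => fun h => by cases h
    | .sourceRev _ => fun h => by cases h
    | .sink _ => fun h => by cases h
    | .sinkRev _ => fun h => by cases h
  tail
    | .dart x => .vertex ((G.cover a b L k).tail x)
    | .source _ => .S
    | .sourceRev i => .vertex (G.coverSource a b L i)
    | .sink i => .vertex (G.coverSink a b L i)
    | .sinkRev _ => .T
  right
    | .dart x => copyFace k (G.right x.1.1)
        (if G.rev x.1.1 ∈ L then x.1.2.val else x.1.2.val + 1)
    | .source i => copyFace k (G.right a) (i.val + 1)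
    | .sourceRev i => copyFace k (G.right a) i.val
    | .sink i => copyFace k (G.right b) (i.val + 1)
    | .sinkRev i => copyFace k (G.right b) i.val

/-- The cover with `S` and `T` attached, with the outer face `none`. -/
def coverST (a b : D) (L : List D) (k : ℕ) :
    FacedGraph (G.STVertex a b L k) (G.STDart L k) (Option (F × Fin k)) where
  toDartGraph := (G.coverSTSplit a b L k).toDartGraph
  right d := ((G.coverSTSplit a b L k).right d).getLeft?

/-- The capacities of the cover, inherited from `G`. -/
def coverCap {L : List D} {k : ℕ} (c : D → ℝ) (x : G.CoverDart L k) : ℝ := c x.1.1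

/-- The capacities with the arcs out of `S` and into `T` capped at `M`. -/
def stCap {L : List D} {k : ℕ} (c : D → ℝ) (M : ℝ) : G.STDart L k → ℝ
  | .dart x => c x.1.1
  | .source _ => M
  | .sourceRev _ => 0
  | .sink _ => M
  | .sinkRev _ => 0

/-- The natural extension of a flow in the cover to an `ST`-flow. -/
def extendST [Fintype D] (a b : D) (L : List D) (k : ℕ) (f : G.CoverDart L k → ℝ) :
    G.STDart L k → ℝ
  | .dart x => f x
  | .source i => - (G.cover a b L k).net f (G.coverSource a b L i)
  | .sourceRev i => (G.cover a b L k).net f (G.coverSource a b L i)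
  | .sink i => (G.cover a b L k).net f (G.coverSink a b L i)
  | .sinkRev i => - (G.cover a b L k).net f (G.coverSink a b L i)

/-- `f₁` is obtained from the lift `f₀` of the flow `f` to the cover by flow cancelling. -/
def IsCoverFlow [Fintype D] (a b : D) (L : List D) (k : ℕ) (c f : D → ℝ)
    (f₁ : G.CoverDart L k → ℝ) : Prop :=
  (G.cover a b L k).IsCancelledFlow (G.coverCap c)
    (Set.range (G.coverSource a b L)) (Set.range (G.coverSink a b L)) (fun x => f x.1.1) f₁

/-- The leftmost maximum flow from `S` to `T` in the cover, with the arcs at `S` and `T` capped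
at `M`. -/
def IsLeftmostCoverFlow [Fintype D] (a b : D) (L : List D) (k : ℕ) (c : D → ℝ) (M : ℝ)
    (g : G.STDart L k → ℝ) : Prop :=
  (G.coverST a b L k).IsLeftmostMaxFlow none (G.stCap c M) STVertex.S STVertex.T g

end PlaneGraph

end PlanarFlow

end

/-!
The proof rests on the duality of circulations and potentials of the faces. On the sphere, an
antisymmetric flow assignment without deficits and excesses is the difference of a potential across
the darts (`IsSphere.exists_potential`), a simple cycle has a potential with two consecutive values
(`IsSphere.jordan`), and a clockwise circulation contains a clockwise simple cycle
(`IsSphere.exists_clockwiseCycle`); hence every face can be reached from the infinite face across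
darts that are saturated by a leftmost flow, and a leftmost maximum flow is unique. All this is
shown for `IsSphere`, a list of properties that holds for the plane graph, for its dual, for the
radial graph, and for the finite cover with `S` and `T` attached (`coverST_isSphere`; the faces
around a vertex of the cover are controlled by the cocycle `leftShift_rot`).

Let `n` be the number of faces between `s` and `t`, let `r` be the value of the leftmost maximum
flow `f`, and let `φ` be the potential of the difference between `f` and `r` units of flow along
`L`, with `φ = 0` on the infinite face (`Setting`). The flow `f` is acyclic. A curve from `s` to `t`
through `n` faces, drawn in the radial graph, turns two acyclic flows of value `r` into
circulations; each flow cycle crosses the curve, so their potentials differ by at most `2 n r`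
(`abs_potential_sub_le`). This gives `-2 n r ≤ φ ≤ 0`, and the corresponding bound for the
potentials of the other flow paths relative to `L`, and for the least numbers of times that a dual
walk across saturated darts has to cross `L`.

A flow from `S` to `T` is the difference of a potential on the faces of the cover, where the outer
face is split into a left and a right part whose potentials differ by the value of the flow. The
maximum flow is therefore given by the largest feasible potential, the dual distances from the left
part, and it is leftmost (`isLeftmostMaxFlow_dualFlow`). The lift of `f` would have the potential
`φ g + r j` at the `j`-th copy of the face `g`. Cut off below at `0` and above at `r (k + 1 - 2 n)` it
is feasible, which bounds the distances from below (`Setting.le_dist`); lifts of saturated dual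
walks from the infinite face bound them from above (`Setting.dist_le`). Both bounds agree at a
distance of `2 n` copies from the ends, so that the flow is `f` there (`Setting.dualFlow_dart`). For
larger capacities at `S` and `T` the upper bound still holds at the sources, because the minimum cut
contains a saturated dual cycle that winds around once and can be used to adjust the number of
crossings (`Setting.dualFlow_source`).

Flow cancelling changes the flow on a path that starts or ends where the cover is cut off from the
universal cover. The projection of this path continues to a path from `s` to `t` along `f`. On its
right side the sum of the number of the copy and of the potential of the path relative to `L` is
constant, and the potential is between `-2 n` and `0`, so that the path stays within `2 n` copies
from that end of the cover (`Setting.cancelled_path`).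
-/

/-! ### Walks, unit flows and net flow in a dart graph -/

noncomputable section

namespace PlanarFlow

open scoped Classical

namespace DartGraph

variable {V D : Type*} (G : DartGraph V D)

@[simp] lemma head_rev (d : D) : G.head (G.rev d) = G.tail d := by
  simp [head, G.rev_rev]

@[simp] lemma tail_rev (d : D) : G.tail (G.rev d) = G.head d := rfl

lemma rev_injective : Function.Injective G.rev := fun x y h => by
  rw [← G.rev_rev x, h, G.rev_rev]

lemma rev_eq_iff {x y : D} : G.rev x = y ↔ x = G.rev y :=
  ⟨fun h => by rw [← h, G.rev_rev], fun h => by rw [h, G.rev_rev]⟩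

lemma isWalk_append {u v : V} {l m : List D} :
    G.IsWalk u (l ++ m) v ↔ ∃ w, G.IsWalk u l w ∧ G.IsWalk w m v := by
  induction l generalizing u with
  | nil => simp [IsWalk]
  | cons d l ih =>
    simp only [List.cons_append, IsWalk, ih]
    constructor
    · rintro ⟨h, w, h1, h2⟩; exact ⟨w, ⟨h, h1⟩, h2⟩
    · rintro ⟨w, ⟨h, h1⟩, h2⟩; exact ⟨h, w, h1, h2⟩

lemma isWalk_concat {u v : V} {l : List D} {d : D} :
    G.IsWalk u (l ++ [d]) v ↔ G.IsWalk u l (G.tail d) ∧ G.head d = v := by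
  rw [isWalk_append]
  simp only [IsWalk]
  constructor
  · rintro ⟨w, h, rfl, h2⟩; exact ⟨h, h2⟩
  · rintro ⟨h, h2⟩; exact ⟨_, h, rfl, h2⟩

lemma IsWalk.append {G : DartGraph V D} {u v w : V} {l m : List D} (h : G.IsWalk u l v)
    (h' : G.IsWalk v m w) : G.IsWalk u (l ++ m) w := G.isWalk_append.2 ⟨v, h, h'⟩

lemma IsWalk.reverse {G : DartGraph V D} {u v : V} {l : List D} (h : G.IsWalk u l v) :
    G.IsWalk v (l.map G.rev).reverse u := by
  induction l generalizing u with
  | nil => exact h.symm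
  | cons d l ih =>
    simp only [List.map_cons, List.reverse_cons, isWalk_concat]
    exact ⟨ih h.2, by simpa using h.1⟩

/-- The vertices of a walk are the end vertex and the tails of its darts. -/
lemma IsWalk.head_mem {G : DartGraph V D} {u v : V} {l : List D} (h : G.IsWalk u l v) {d : D}
    (hd : d ∈ l) : G.head d ∈ l.tail.map G.tail ++ [v] := by
  induction l generalizing u with
  | nil => simp at hd
  | cons e l ih =>
    rcases List.mem_cons.1 hd with rfl | hd
    · cases l with
      | nil => simpa [IsWalk] using h.2
      | cons e' l => simp [h.2.1]
    · have := ih h.2 hd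
      cases l with
      | nil => simp at hd
      | cons e' l => simp at this ⊢; exact Or.inr this

@[simp] lemma along_nil (d : D) : G.along [] d = 0 := by simp [along]

lemma along_append (l m : List D) (d : D) : G.along (l ++ m) d = G.along l d + G.along m d := by
  simp [along]; ring

lemma along_cons (e : D) (l : List D) (d : D) :
    G.along (e :: l) d = G.along [e] d + G.along l d := by
  rw [← along_append]; rfl

lemma along_singleton (e d : D) :
    G.along [e] d = (if d = e then 1 else 0) - (if d = G.rev e then 1 else 0) := by
  have : (G.rev d = e) ↔ d = G.rev e := G.rev_eq_iff
  simp only [along, List.count_singleton, beq_iff_eq]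
  congr 1
  · by_cases h : d = e
    · simp [h]
    · simp [h, Ne.symm h]
  · by_cases h : d = G.rev e
    · simp [h, G.rev_rev]
    · have h' : ¬ (e = G.rev d) := fun h2 => h (this.1 h2.symm)
      simp [h, h']

lemma along_rev (l : List D) (d : D) : G.along l (G.rev d) = - G.along l d := by
  simp [along, G.rev_rev]

lemma mem_of_along_pos {l : List D} {d : D} (h : 0 < G.along l d) : d ∈ l := by
  by_contra hd
  have : (0 : ℝ) ≤ l.count (G.rev d) := Nat.cast_nonneg _
  simp only [along, List.count_eq_zero_of_not_mem hd] at h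
  simp at h; linarith

lemma along_eq_zero {l : List D} {d : D} (h : d ∉ l) (h' : G.rev d ∉ l) : G.along l d = 0 := by
  simp [along, List.count_eq_zero_of_not_mem h, List.count_eq_zero_of_not_mem h']

lemma along_nonpos {l : List D} {d : D} (h : d ∉ l) : G.along l d ≤ 0 := by
  by_contra h'; exact h (G.mem_of_along_pos (not_le.1 h'))

section Net

variable [Fintype D]

lemma net_add (f g : D → ℝ) (v : V) : G.net (fun d => f d + g d) v = G.net f v + G.net g v := by
  simp [net, Finset.sum_add_distrib]

lemma net_sub (f g : D → ℝ) (v : V) : G.net (fun d => f d - g d) v = G.net f v - G.net g v := by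
  simp [net, Finset.sum_sub_distrib]

lemma net_smul (r : ℝ) (f : D → ℝ) (v : V) : G.net (fun d => r * f d) v = r * G.net f v := by
  simp [net, Finset.mul_sum]

lemma net_zero (v : V) : G.net (fun _ => 0) v = 0 := by simp [net]

lemma net_eq_neg_sum_tail {f : D → ℝ} (hf : ∀ d, f (G.rev d) = - f d) (v : V) :
    G.net f v = - ∑ d with G.tail d = v, f d := by
  rw [net, ← Finset.sum_neg_distrib]
  refine Finset.sum_bij (fun d _ => G.rev d) ?_ ?_ ?_ ?_
  · intro d hd; simpa using hd
  · intro d _ e _ h; exact G.rev_injective h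
  · intro d hd; exact ⟨G.rev d, by simpa using hd, G.rev_rev d⟩
  · intro d _; simp [hf]

lemma net_along_singleton (e : D) (x : V) :
    G.net (G.along [e]) x = (if x = G.head e then 1 else 0) - (if x = G.tail e then 1 else 0) := by
  simp only [net, along_singleton, Finset.sum_sub_distrib, Finset.sum_ite_eq', Finset.mem_filter,
    Finset.mem_univ, true_and, head_rev]
  simp only [eq_comm]

lemma net_along {u v : V} {l : List D} (h : G.IsWalk u l v) (x : V) :
    G.net (G.along l) x = (if x = v then 1 else 0) - (if x = u then 1 else 0) := by
  induction l generalizing u with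
  | nil => cases h; simp [net]
  | cons d l ih =>
    have : G.along (d :: l) = fun e => G.along [d] e + G.along l e :=
      funext fun e => G.along_cons d l e
    rw [this, net_add, net_along_singleton, ih h.2, h.1]; ring

/-- The net flow into a set of vertices is the flow on the darts that enter it. -/
lemma sum_net {f : D → ℝ} (hf : ∀ d, f (G.rev d) = - f d) [Fintype V] (Y : Set V) :
    ∑ v with v ∈ Y, G.net f v = ∑ d with (G.head d ∈ Y ∧ G.tail d ∉ Y), f d := by
  have h1 : ∑ v with v ∈ Y, G.net f v = ∑ d with G.head d ∈ Y, f d := by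
    rw [← Finset.sum_fiberwise_of_maps_to (s := Finset.univ.filter fun d => G.head d ∈ Y)
      (t := Finset.univ.filter fun v => v ∈ Y) (g := G.head) (by simp)]
    refine Finset.sum_congr rfl fun v hv => ?_
    simp only [Finset.mem_filter, Finset.mem_univ, true_and] at hv
    rw [net, Finset.filter_filter]
    refine Finset.sum_congr ?_ fun _ _ => rfl
    ext d; simp only [Finset.mem_filter, Finset.mem_univ, true_and]
    constructor
    · rintro rfl; exact ⟨hv, rfl⟩
    · exact fun h => h.2
  have h2 : ∑ d with (G.head d ∈ Y ∧ G.tail d ∈ Y), f d = 0 := by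
    have : ∑ d with (G.head d ∈ Y ∧ G.tail d ∈ Y), f d
        = ∑ d with (G.head d ∈ Y ∧ G.tail d ∈ Y), - f d := by
      refine Finset.sum_bij (fun d _ => G.rev d) ?_ ?_ ?_ ?_
      · intro d hd; simp at hd ⊢; tauto
      · intro d _ e _ h; exact G.rev_injective h
      · intro d hd; exact ⟨G.rev d, by simp at hd ⊢; tauto, G.rev_rev d⟩
      · intro d _; simp [hf]
    rw [Finset.sum_neg_distrib] at this; linarith
  rw [h1, ← Finset.sum_filter_add_sum_filter_not _ (fun d => G.tail d ∈ Y), Finset.filter_filter,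
    Finset.filter_filter, h2, zero_add]

end Net

lemma isWalk_suffix_of_mem {u v x : V} {l : List D} (h : G.IsWalk u l v)
    (hx : x ∈ l.map G.tail ++ [v]) : ∃ l1 l2, l = l1 ++ l2 ∧ G.IsWalk u l1 x ∧ G.IsWalk x l2 v := by
  induction l generalizing u with
  | nil => simp at hx; subst hx; exact ⟨[], [], rfl, h, rfl⟩
  | cons d l ih =>
    simp only [List.map_cons, List.cons_append, List.mem_cons] at hx
    rcases hx with hx | hx
    · exact ⟨[], d :: l, rfl, by rw [hx, h.1]; rfl, by rw [hx]; exact ⟨rfl, h.2⟩⟩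
    · obtain ⟨l1, l2, rfl, h1, h2⟩ := ih h.2 hx
      exact ⟨d :: l1, l2, rfl, ⟨h.1, h1⟩, h2⟩

/-- Every walk contains a simple path with the same ends. -/
lemma IsWalk.exists_simplePath {G : DartGraph V D} {u v : V} {l : List D} (h : G.IsWalk u l v) :
    ∃ m, G.IsSimplePath u m v ∧ m ⊆ l := by
  induction l generalizing u with
  | nil => exact ⟨[], ⟨h, by simp⟩, by simp⟩
  | cons d l ih =>
    obtain ⟨m, hm, hml⟩ := ih h.2
    by_cases hu : u ∈ m.map G.tail ++ [v]
    · obtain ⟨m1, m2, rfl, h1, h2⟩ := G.isWalk_suffix_of_mem hm.1 hu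
      refine ⟨m2, ⟨h2, ?_⟩, fun x hx => List.mem_cons_of_mem _ (hml (List.mem_append_right _ hx))⟩
      have := hm.2
      rw [List.map_append, List.append_assoc] at this
      exact (List.nodup_append.1 this).2.1
    · refine ⟨d :: m, ⟨⟨h.1, hm.1⟩, ?_⟩, ?_⟩
      · simp only [List.map_cons, List.cons_append, List.nodup_cons]
        exact ⟨by rw [h.1]; exact hu, hm.2⟩
      · intro x hx
        rcases List.mem_cons.1 hx with rfl | hx
        · exact List.mem_cons_self
        · exact List.mem_cons_of_mem _ (hml hx)

/-- A nonempty closed walk in a set of darts that contains no dart with its reverse contains a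
simple cycle. -/
lemma IsWalk.exists_simpleCycle {G : DartGraph V D} {u : V} {l : List D} (h : G.IsWalk u l u)
    (hne : l ≠ []) (hrev : ∀ d ∈ l, G.rev d ∉ l) : ∃ m, G.IsSimpleCycle m ∧ m ⊆ l := by
  induction hn : l.length using Nat.strong_induction_on generalizing u l with
  | _ n ih =>
    by_cases hnd : (l.map G.tail).Nodup
    · exact ⟨l, ⟨hne, ⟨u, h⟩, hnd, hrev⟩, fun _ h => h⟩
    · cases l with
      | nil => simp at hne
      | cons d l =>
        -- A vertex that is repeated splits off a shorter closed walk.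
        have key : ∃ x l1 l2 l3, d :: l = l1 ++ l2 ++ l3 ∧ G.IsWalk x l2 x ∧ l2 ≠ [] ∧
            l2.length < (d :: l).length := by
          clear ih hn hrev hne
          generalize d :: l = l at *
          clear d
          suffices H : ∀ v, G.IsWalk u l v → ∃ x l1 l2 l3, l = l1 ++ l2 ++ l3 ∧ G.IsWalk x l2 x ∧
              l2 ≠ [] ∧ l2.length < l.length from H u h
          clear h
          induction l generalizing u with
          | nil => simp at hnd
          | cons d l ih =>
            intro v h
            by_cases hd : G.tail d ∈ l.map G.tail
            · obtain ⟨e, he, hed⟩ := List.mem_map.1 hd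
              obtain ⟨l1, l2, rfl⟩ := List.append_of_mem he
              refine ⟨G.tail d, [], d :: l1, e :: l2, rfl, ?_, by simp, by simp⟩
              obtain ⟨w, h1, h2⟩ := G.isWalk_append.1 h.2
              refine ⟨rfl, ?_⟩
              rw [← hed, h2.1]; exact h1
            · have hl : ¬ (l.map G.tail).Nodup := by
                intro h'; exact hnd (by simpa using ⟨by simpa using hd, h'⟩)
              obtain ⟨x, l1, l2, l3, rfl, h1, h2, h3⟩ := ih hl v h.2
              exact ⟨x, d :: l1, l2, l3, rfl, h1, h2, by simp at h3 ⊢; omega⟩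
        obtain ⟨x, l1, l2, l3, he, h1, h2, h3⟩ := key
        have hsub : l2 ⊆ d :: l := by
          rw [he]; intro y hy; simp [hy]
        obtain ⟨m, hm, hm2⟩ := ih l2.length (by omega) h1 h2
          (fun y hy hy' => hrev y (hsub hy) (hsub hy')) rfl
        exact ⟨m, hm, fun y hy => hsub (hm2 hy)⟩

lemma IsSimplePath.nodup {G : DartGraph V D} {u v : V} {l : List D} (h : G.IsSimplePath u l v) :
    l.Nodup := (List.nodup_append.1 h.2).1.of_map _

lemma IsSimplePath.tail_inj {G : DartGraph V D} {u v : V} {l : List D}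
    (h : G.IsSimplePath u l v) {d e : D} (hd : d ∈ l) (he : e ∈ l) (hde : G.tail d = G.tail e) :
    d = e := List.inj_on_of_nodup_map (List.nodup_append.1 h.2).1 hd he hde

lemma IsSimplePath.cons {G : DartGraph V D} {u v : V} {d : D} {l : List D} :
    G.IsSimplePath u (d :: l) v ↔
      G.tail d = u ∧ u ∉ l.map G.tail ++ [v] ∧ G.IsSimplePath (G.head d) l v := by
  simp only [IsSimplePath, IsWalk, List.map_cons, List.cons_append, List.nodup_cons]
  constructor
  · rintro ⟨⟨rfl, h⟩, h1, h2⟩; exact ⟨rfl, h1, h, h2⟩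
  · rintro ⟨rfl, h1, h, h2⟩; exact ⟨⟨rfl, h⟩, h1, h2⟩

lemma IsSimplePath.head_ne_start {G : DartGraph V D} {u v : V} {l : List D}
    (h : G.IsSimplePath u l v) {d : D} (hd : d ∈ l) : G.head d ≠ u := by
  cases l with
  | nil => simp at hd
  | cons e l =>
    have h1 := h.1.head_mem hd
    rw [IsSimplePath.cons] at h
    intro h2; rw [h2] at h1; exact h.2.1 h1

lemma IsSimplePath.tail_ne_end {G : DartGraph V D} {u v : V} {l : List D}
    (h : G.IsSimplePath u l v) {d : D} (hd : d ∈ l) : G.tail d ≠ v := by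
  have := h.2
  rw [List.nodup_append] at this
  exact this.2.2 _ (List.mem_map_of_mem hd) _ (by simp)

lemma IsSimplePath.rev_notMem {G : DartGraph V D} {u v : V} {l : List D}
    (h : G.IsSimplePath u l v) {d : D} (hd : d ∈ l) : G.rev d ∉ l := by
  induction l generalizing u with
  | nil => simp at hd
  | cons e l ih =>
    have h0 := h
    rw [IsSimplePath.cons] at h
    intro h2
    rcases List.mem_cons.1 hd with rfl | hd'
    · exact h0.head_ne_start h2 (by simpa using h.1)
    · rcases List.mem_cons.1 h2 with h3 | h3
      · refine h0.head_ne_start hd ?_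
        rw [← h.1, ← h3]; simp
      · exact ih h.2.2 hd' h3

lemma IsSimplePath.along_eq_one {G : DartGraph V D} {u v : V} {l : List D}
    (h : G.IsSimplePath u l v) {d : D} (hd : d ∈ l) : G.along l d = 1 := by
  simp [along, List.count_eq_one_of_mem h.nodup hd,
    List.count_eq_zero_of_not_mem (h.rev_notMem hd)]

lemma IsSimplePath.along_eq {G : DartGraph V D} {u v : V} {l : List D}
    (h : G.IsSimplePath u l v) (d : D) :
    G.along l d = (if d ∈ l then 1 else 0) - (if G.rev d ∈ l then 1 else 0) := by
  by_cases h1 : d ∈ l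
  · simp [h.along_eq_one h1, h1, h.rev_notMem h1]
  · by_cases h2 : G.rev d ∈ l
    · have := h.along_eq_one h2
      rw [along_rev] at this
      simp [h1, h2]; linarith
    · simp [h1, h2, G.along_eq_zero h1 h2]

lemma IsSimpleCycle.along_eq_one {G : DartGraph V D} {l : List D}
    (h : G.IsSimpleCycle l) {d : D} (hd : d ∈ l) : G.along l d = 1 := by
  simp [along, List.count_eq_one_of_mem (h.2.2.1.of_map _) hd,
    List.count_eq_zero_of_not_mem (h.2.2.2 d hd)]

lemma IsSimpleCycle.net [Fintype D] {G : DartGraph V D} {l : List D} (h : G.IsSimpleCycle l)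
    (v : V) : G.net (G.along l) v = 0 := by
  obtain ⟨u, hu⟩ := h.2.1
  rw [G.net_along hu]; simp

/-- The successor of a dart on a simple cycle. -/
lemma IsSimpleCycle.exists_next {G : DartGraph V D} {l : List D} (h : G.IsSimpleCycle l) {d : D}
    (hd : d ∈ l) : ∃ e ∈ l, G.tail e = G.head d := by
  obtain ⟨u, hu⟩ := h.2.1
  have := hu.head_mem hd
  rw [List.mem_append] at this
  rcases this with h1 | h1
  · obtain ⟨e, he, he'⟩ := List.mem_map.1 h1
    exact ⟨e, List.mem_of_mem_tail he, he'⟩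
  · cases l with
    | nil => exact absurd rfl h.1
    | cons e l =>
      exact ⟨e, List.mem_cons_self, by rw [hu.1]; simpa using (List.mem_singleton.1 h1).symm⟩

lemma IsSimpleCycle.exists_prev {G : DartGraph V D} {l : List D} (h : G.IsSimpleCycle l) {d : D}
    (hd : d ∈ l) : ∃ e ∈ l, G.head e = G.tail d := by
  obtain ⟨u, hu⟩ := h.2.1
  obtain ⟨l1, l2, rfl⟩ := List.append_of_mem hd
  rw [isWalk_append] at hu
  obtain ⟨w, h1, h2⟩ := hu
  rcases List.eq_nil_or_concat l1 with rfl | ⟨l3, e, rfl⟩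
  · have hw : u = w := h1
    rcases List.eq_nil_or_concat (d :: l2) with h3 | ⟨l4, e, h3⟩
    · simp at h3
    · rw [List.concat_eq_append] at h3
      rw [h3, isWalk_concat] at h2
      refine ⟨e, by simp [h3], ?_⟩
      rw [h2.2, hw]
      have h5 : G.IsWalk u (d :: l2) u := by
        rw [h3, isWalk_concat, hw]; exact ⟨h2.1, by rw [h2.2, hw]⟩
      rw [h5.1, hw]
  · rw [List.concat_eq_append, isWalk_concat] at h1
    exact ⟨e, by simp, by rw [h1.2, h2.1]⟩

/-- A simple path contains no simple cycle. -/
lemma IsSimplePath.not_cycle {G : DartGraph V D} {u v : V} {l : List D}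
    (h : G.IsSimplePath u l v) {m : List D} (hm : G.IsSimpleCycle m) : ¬ m ⊆ l := by
  induction l generalizing u with
  | nil =>
    intro hs
    exact hm.1 (List.eq_nil_iff_forall_not_mem.2 fun x hx => by simpa using hs hx)
  | cons e l ih =>
    intro hs
    have h0 := h
    rw [IsSimplePath.cons] at h
    refine ih h.2.2 fun x hx => ?_
    rcases List.mem_cons.1 (hs hx) with rfl | h1
    · obtain ⟨y, hy, hy'⟩ := hm.exists_prev hx
      exact absurd (hy'.trans h.1) (h0.head_ne_start (hs hy))
    · exact h1

/-- A simple path is determined by its first vertex and its set of darts. -/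
lemma IsSimplePath.ext {G : DartGraph V D} {u v : V} {l m : List D}
    (h : G.IsSimplePath u l v) (h' : G.IsSimplePath u m v) (hs : ∀ d, d ∈ l ↔ d ∈ m) : l = m := by
  induction l generalizing u m with
  | nil =>
    cases m with
    | nil => rfl
    | cons e m => simpa using (hs e)
  | cons d l ih =>
    cases m with
    | nil => simpa using (hs d)
    | cons e m =>
      have h1 := IsSimplePath.cons.1 h
      have h2 := IsSimplePath.cons.1 h'
      have hde : d = e := h'.tail_inj ((hs d).1 List.mem_cons_self) List.mem_cons_self
        (h1.1.trans h2.1.symm)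
      subst hde
      congr 1
      refine ih h1.2.2 h2.2.2 fun x => ?_
      have h3 := hs x
      have h4 := (List.nodup_cons.1 h.nodup).1
      have h5 := (List.nodup_cons.1 h'.nodup).1
      simp only [List.mem_cons] at h3
      constructor
      · intro hx
        rcases h3.1 (Or.inr hx) with rfl | h6
        · exact absurd hx h4
        · exact h6
      · intro hx
        rcases h3.2 (Or.inr hx) with rfl | h6
        · exact absurd hx h5
        · exact h6

lemma IsSimplePath.eq_of_along {G : DartGraph V D} {u v : V} {l m : List D}
    (h : G.IsSimplePath u l v) (h' : G.IsSimplePath u m v)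
    (hs : ∀ d, G.along l d = G.along m d) : l = m :=
  h.ext h' fun d => ⟨fun hd => G.mem_of_along_pos (by rw [← hs, h.along_eq_one hd]; norm_num),
    fun hd => G.mem_of_along_pos (by rw [hs, h'.along_eq_one hd]; norm_num)⟩

/-- If every dart of a nonempty finite set has a successor in the set, the set contains a simple
cycle. -/
lemma exists_simpleCycle [Finite D] {P : Set D} (hne : P.Nonempty) (hrev : ∀ d ∈ P, G.rev d ∉ P)
    (hnext : ∀ d ∈ P, ∃ e ∈ P, G.tail e = G.head d) :
    ∃ m, G.IsSimpleCycle m ∧ ∀ d ∈ m, d ∈ P := by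
  choose! nx hnx using hnext
  obtain ⟨d0, hd0⟩ := hne
  have hP : ∀ n, nx^[n] d0 ∈ P := by
    intro n; induction n with
    | zero => exact hd0
    | succ n ih => rw [Function.iterate_succ_apply']; exact (hnx _ ih).1
  have hwalk : ∀ j i, G.IsWalk (G.tail (nx^[i] d0)) ((List.range j).map fun r => nx^[i + r] d0)
      (G.tail (nx^[i + j] d0)) := by
    intro j i; induction j with
    | zero => exact rfl
    | succ j ih =>
      rw [List.range_succ, List.map_append]
      refine G.isWalk_concat.2 ⟨ih, ?_⟩
      rw [← add_assoc, Function.iterate_succ_apply']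
      exact (hnx _ (hP _)).2.symm
  obtain ⟨i, j, hij, heq⟩ := Finite.exists_ne_map_eq_of_infinite (fun n : ℕ => nx^[n] d0)
  wlog hlt : i < j generalizing i j
  · exact this j i hij.symm heq.symm (by omega)
  have hw := hwalk (j - i) i
  rw [show i + (j - i) = j by omega, show nx^[j] d0 = nx^[i] d0 from heq.symm] at hw
  have hmem : ∀ d ∈ (List.range (j - i)).map fun r => nx^[i + r] d0, d ∈ P := by
    intro d hd; obtain ⟨r, _, rfl⟩ := List.mem_map.1 hd; exact hP _
  obtain ⟨m, hm, hms⟩ := hw.exists_simpleCycle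
    (by simp; omega) (fun d hd hd' => hrev d (hmem d hd) (hmem _ hd'))
  exact ⟨m, hm, fun d hd => hmem d (hms hd)⟩

/-- If a set of darts contains no path from `s` to `t`, some set of vertices that contains `s` but
not `t` is left by none of these darts. -/
lemma exists_path_or_cut (P : Set D) (s t : V) :
    (∃ l, G.IsSimplePath s l t ∧ ∀ d ∈ l, d ∈ P) ∨
    ∃ Y : Set V, s ∈ Y ∧ t ∉ Y ∧ ∀ d ∈ P, G.tail d ∈ Y → G.head d ∈ Y := by
  by_cases h : ∃ l, G.IsWalk s l t ∧ ∀ d ∈ l, d ∈ P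
  · obtain ⟨l, hl, hP⟩ := h
    obtain ⟨m, hm, hml⟩ := hl.exists_simplePath
    exact Or.inl ⟨m, hm, fun d hd => hP d (hml hd)⟩
  · refine Or.inr ⟨{v | ∃ l, G.IsWalk s l v ∧ ∀ d ∈ l, d ∈ P}, ⟨[], rfl, by simp⟩, h, ?_⟩
    rintro d hd ⟨l, hl, hP⟩
    refine ⟨l ++ [d], G.isWalk_concat.2 ⟨hl, rfl⟩, ?_⟩
    intro e he
    rcases List.mem_append.1 he with he | he
    · exact hP e he
    · rw [List.mem_singleton.1 he]; exact hd

section Flow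

variable [Fintype D]

lemma exists_pos_out {w : D → ℝ} (hw : ∀ d, w (G.rev d) = - w d) {d : D} (hd : 0 < w d)
    (hn : G.net w (G.head d) ≤ 0) : ∃ e, 0 < w e ∧ G.tail e = G.head d := by
  by_contra hcon
  push Not at hcon
  have h1 : 0 < G.net w (G.head d) := by
    refine Finset.sum_pos' ?_ ⟨d, by simp, hd⟩
    intro e he
    simp only [Finset.mem_filter, Finset.mem_univ, true_and] at he
    by_contra h2
    exact hcon (G.rev e) (by rw [hw]; linarith) (by rw [tail_rev, he])
  linarith

/-- Conformal decomposition of a circulation into simple cycles. -/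
lemma exists_cycle_decomposition {w : D → ℝ} (hw : ∀ d, w (G.rev d) = - w d)
    (hnet : ∀ v, G.net w v = 0) :
    ∃ Cs : List (ℝ × List D), (∀ C ∈ Cs, 0 < C.1 ∧ G.IsSimpleCycle C.2 ∧ ∀ d ∈ C.2, 0 < w d) ∧
      ∀ d, w d = (Cs.map fun C => C.1 * G.along C.2 d).sum := by
  induction hn : (Finset.univ.filter fun d => 0 < w d).card using Nat.strong_induction_on
    generalizing w with
  | _ n ih =>
    by_cases hpos : ∃ d, 0 < w d
    · obtain ⟨m, hm, hmP⟩ := G.exists_simpleCycle (P := {d | 0 < w d}) hpos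
        (fun d hd hd' => by simp only [Set.mem_ofPred_eq, hw] at hd hd'; linarith)
        (fun d hd => G.exists_pos_out hw hd (hnet _).le)
      obtain ⟨e, he, hmin⟩ := Finset.exists_min_image m.toFinset w
        (by simpa [List.toFinset_nonempty_iff] using hm.1)
      simp only [List.mem_toFinset] at he hmin
      have hδ : 0 < w e := hmP e he
      set w' : D → ℝ := fun d => w d - w e * G.along m d with hw'
      have hsup : ∀ d, 0 < w' d → 0 < w d := by
        intro d hd
        by_cases h1 : d ∈ m
        · exact hmP d h1
        · by_cases h2 : G.rev d ∈ m
          · have h3 := hm.along_eq_one h2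
            rw [along_rev] at h3
            have h4 := hmin _ h2
            rw [hw] at h4
            simp only [hw'] at hd
            rw [show G.along m d = -1 by linarith] at hd; linarith
          · simpa [hw', G.along_eq_zero h1 h2] using hd
      have hcard : (Finset.univ.filter fun d => 0 < w' d).card < n := by
        rw [← hn]
        refine Finset.card_lt_card (Finset.ssubset_iff_subset_ne.2 ⟨?_, ?_⟩)
        · intro d hd; simp at hd ⊢; exact hsup d hd
        · intro heq
          have : e ∈ Finset.univ.filter fun d => 0 < w' d := by rw [heq]; simpa using hδ
          simp [hw', hm.along_eq_one he] at this
      obtain ⟨Cs, h1, h2⟩ := ih _ hcard (w := w')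
        (fun d => by simp only [hw', hw, along_rev]; ring)
        (fun v => by simp only [hw']; rw [net_sub, net_smul, hnet, hm.net]; ring) rfl
      refine ⟨(w e, m) :: Cs, ?_, ?_⟩
      · intro C hC
        rcases List.mem_cons.1 hC with rfl | hC
        · exact ⟨hδ, hm, hmP⟩
        · exact ⟨(h1 C hC).1, (h1 C hC).2.1, fun d hd => hsup d ((h1 C hC).2.2 d hd)⟩
      · intro d
        rw [List.map_cons, List.sum_cons, ← h2]; simp [hw']
    · refine ⟨[], by simp, fun d => ?_⟩
      push Not at hpos
      have h1 := hpos d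
      have h2 := hpos (G.rev d)
      rw [hw] at h2
      simp; linarith

/-- The flow that leaves a set which contains `s` but no sink is at least the flow out of `s`. -/
lemma sum_leaving {f : D → ℝ} (hf : ∀ d, f (G.rev d) = - f d) [Finite V] {s : V} {Y : Set V}
    (hs : s ∈ Y) (hY : ∀ v ∈ Y, v ≠ s → G.net f v = 0) :
    - G.net f s = ∑ d with (G.tail d ∈ Y ∧ G.head d ∉ Y), f d := by
  have := Fintype.ofFinite V
  have h1 := G.sum_net hf Y
  have h2 : ∑ v with v ∈ Y, G.net f v = G.net f s := by
    refine Finset.sum_eq_single_of_mem s (by simpa using hs) fun v hv hvs => ?_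
    exact hY v (by simpa using hv) hvs
  have h3 : ∑ d with (G.head d ∈ Y ∧ G.tail d ∉ Y), f d
      = - ∑ d with (G.tail d ∈ Y ∧ G.head d ∉ Y), f d := by
    rw [← Finset.sum_neg_distrib]
    refine Finset.sum_bij (fun d _ => G.rev d) ?_ ?_ ?_ ?_
    · intro d hd; simpa using hd
    · intro d _ e _ h; exact G.rev_injective h
    · intro d hd; exact ⟨G.rev d, by simpa using hd, G.rev_rev d⟩
    · intro d _; simp [hf]
  linarith

end Flow

end DartGraph

end PlanarFlow

end

/-! ### Circulations on the sphere and potentials of the faces -/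

noncomputable section

namespace PlanarFlow

open scoped Classical

namespace FacedGraph

variable {V D F : Type*} (G : FacedGraph V D F)

@[simp] lemma left_rev (d : D) : G.left (G.rev d) = G.right d := by simp [left, G.rev_rev]

@[simp] lemma right_rev (d : D) : G.right (G.rev d) = G.left d := rfl

/-- The flow assignment that is given by a potential of the faces. -/
def potFlow (p : F → ℝ) (d : D) : ℝ := p (G.right d) - p (G.left d)

lemma potFlow_rev (p : F → ℝ) (d : D) : G.potFlow p (G.rev d) = - G.potFlow p d := by
  simp [potFlow]

lemma potFlow_sub (p q : F → ℝ) (d : D) :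
    G.potFlow (fun x => p x - q x) d = G.potFlow p d - G.potFlow q d := by
  simp only [potFlow]; ring

lemma potFlow_add (p q : F → ℝ) (d : D) :
    G.potFlow (fun x => p x + q x) d = G.potFlow p d + G.potFlow q d := by
  simp only [potFlow]; ring

lemma potFlow_smul (r : ℝ) (q : F → ℝ) (d : D) :
    G.potFlow (fun x => r * q x) d = r * G.potFlow q d := by
  simp only [potFlow]; ring

lemma sum_potFlow {ι : Type*} (l : List ι) (δ : ι → ℝ) (q : ι → F → ℝ) (d : D) :
    (l.map fun i => δ i * G.potFlow (q i) d).sum =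
      G.potFlow (fun x => (l.map fun i => δ i * q i x).sum) d := by
  induction l with
  | nil => simp [potFlow]
  | cons i l ih =>
    simp only [potFlow, List.map_cons, List.sum_cons] at ih ⊢
    rw [ih]; ring

/-- The combinatorial properties of a connected graph on the sphere that the duality of circulations
and potentials rests on. Instead of a rotation system, `fan` records its effect: a potential that
changes across no dart at a vertex other than `d` and `e` is the same on the right of `d` and on the
left of `e`, since the faces in between form a fan. -/
structure IsSphere [Fintype D] : Prop where
  net_potFlow : ∀ (p : F → ℝ) (v : V), G.net (G.potFlow p) v = 0
  fan : ∀ d e, d ≠ e → G.tail d = G.tail e → ∀ q : F → ℝ,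
    (∀ x, G.tail x = G.tail d → x ≠ d → x ≠ e → q (G.right x) = q (G.left x)) →
      q (G.right d) = q (G.left e)
  dual_connected : ∀ q : F → ℝ, (∀ d, q (G.right d) = q (G.left d)) → ∀ x y, q x = q y
  connected : ∀ u v, ∃ l, G.IsWalk u l v
  euler : 2 * Nat.card V + 2 * Nat.card F = Nat.card D + 4

/-- A potential that changes across no dart is constant if the graph is connected and the faces around
each vertex form fans. -/
lemma dual_connected_of_fan
    (fan : ∀ d e, d ≠ e → G.tail d = G.tail e → ∀ q : F → ℝ,
      (∀ x, G.tail x = G.tail d → x ≠ d → x ≠ e → q (G.right x) = q (G.left x)) →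
        q (G.right d) = q (G.left e))
    (conn : ∀ u v, ∃ l, G.IsWalk u l v) (surj : Function.Surjective G.right)
    (q : F → ℝ) (hq : ∀ d, q (G.right d) = q (G.left d)) (x y : F) : q x = q y := by
  obtain ⟨d, rfl⟩ := surj x
  obtain ⟨e, rfl⟩ := surj y
  have same : ∀ d e, G.tail d = G.tail e → q (G.right d) = q (G.right e) := by
    intro d e hde
    by_cases h : d = e
    · rw [h]
    · rw [hq e]; exact fan d e h hde q fun x _ _ _ => hq x
  obtain ⟨l, hl⟩ := conn (G.tail d) (G.tail e)
  generalize hu : G.tail d = u at hl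
  induction l generalizing d u with
  | nil => cases hl; exact same d e hu
  | cons c l ih =>
    rw [same d c (hu.trans hl.1.symm), hq c]
    exact ih (G.rev c) _ rfl hl.2

section Rotation

/-- Along an orbit of a permutation, from `d` to `e`: if the value on the left of each next element
is the value on the right of its predecessor, and only `d` and `e` may have different values on
their two sides, then the value on the right of `d` is the one on the left of `e`. -/
lemma orbit_fan {α : Type*} [Finite D] (rot : Equiv.Perm D) (R L : D → α) {d e : D}
    (hde : rot.SameCycle d e)
    (hc : ∀ z, rot.SameCycle d z → L (rot z) = R z)
    (hs : ∀ z, rot.SameCycle d z → z ≠ d → z ≠ e → R z = L z) : R d = L e := by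
  have hex : ∃ j : ℕ, (rot ^ (j + 1)) d = e := by
    obtain ⟨j, hj, -, h⟩ := hde.exists_pow_eq''
    exact ⟨j - 1, by rw [Nat.sub_add_cancel (by omega)]; exact h⟩
  classical
  set j := Nat.find hex with hj
  have hje : (rot ^ (j + 1)) d = e := Nat.find_spec hex
  have hmin : ∀ i < j, (rot ^ (i + 1)) d ≠ e := fun i hi => Nat.find_min hex hi
  have hd : ∀ i < j, (rot ^ (i + 1)) d ≠ d := by
    intro i hi h
    have h2 : (rot ^ (j - i - 1 + 1)) d = e := by
      have h3 : j + 1 = (j - i - 1 + 1) + (i + 1) := by omega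
      rw [h3, pow_add, Equiv.Perm.mul_apply, h] at hje
      exact hje
    exact hmin (j - i - 1) (by omega) h2
  have key : ∀ i ≤ j, L ((rot ^ (i + 1)) d) = R d := by
    intro i
    induction i with
    | zero => intro _; simpa using hc d (Equiv.Perm.SameCycle.refl _ _)
    | succ i ih =>
      intro hi
      have hcyc : rot.SameCycle d ((rot ^ (i + 1)) d) := ⟨(i + 1 : ℕ), by rw [zpow_natCast]⟩
      rw [pow_succ', Equiv.Perm.mul_apply, hc _ hcyc,
        hs _ hcyc (hd i (by omega)) (hmin i (by omega)), ih (by omega)]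
  rw [← key j le_rfl, hje]

lemma IsSphere.of_rot [Fintype D] {G : FacedGraph V D F} (rot : Equiv.Perm D)
    (htail : ∀ d, G.tail (rot d) = G.tail d)
    (hcyc : ∀ d e, G.tail d = G.tail e → rot.SameCycle d e)
    (hright : ∀ d, G.left (rot d) = G.right d)
    (hconn : ∀ u v, ∃ l, G.IsWalk u l v)
    (hsurj : Function.Surjective G.right)
    (heuler : 2 * Nat.card V + 2 * Nat.card F = Nat.card D + 4) : G.IsSphere := by
  have hpow : ∀ d e, rot.SameCycle d e → G.tail d = G.tail e := by
    rintro d e hde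
    obtain ⟨j, -, rfl⟩ := hde.exists_pow_eq'
    induction j with
    | zero => rfl
    | succ j ih => rw [pow_succ', Equiv.Perm.mul_apply, htail]; exact ih ⟨j, by simp⟩
  have hfan : ∀ d e, d ≠ e → G.tail d = G.tail e → ∀ q : F → ℝ,
      (∀ x, G.tail x = G.tail d → x ≠ d → x ≠ e → q (G.right x) = q (G.left x)) →
        q (G.right d) = q (G.left e) := by
    intro d e _ ht q hq
    refine orbit_fan rot (fun z => q (G.right z)) (fun z => q (G.left z)) (hcyc d e ht) ?_ ?_
    · intro z _; simp only [hright]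
    · intro z hz h1 h2; exact hq z (hpow _ _ hz).symm h1 h2
  refine ⟨?_, hfan, G.dual_connected_of_fan hfan hconn hsurj, hconn, heuler⟩
  intro p v
  rw [G.net_eq_neg_sum_tail (G.potFlow_rev p), neg_eq_zero]
  simp only [potFlow, Finset.sum_sub_distrib, sub_eq_zero]
  refine Finset.sum_bij (fun d _ => rot d) ?_ ?_ ?_ ?_
  · intro d hd; simpa [htail] using hd
  · intro d _ e _ h; exact rot.injective h
  · intro d hd
    refine ⟨rot⁻¹ d, ?_, rot.apply_symm_apply d⟩
    have h1 := htail (rot⁻¹ d)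
    rw [show rot (rot⁻¹ d) = d from rot.apply_symm_apply d] at h1
    simpa only [Finset.mem_filter, Finset.mem_univ, true_and, ← h1] using hd
  · intro d _; rw [hright]

end Rotation

section Duality

variable [Fintype D]

/-- A chain complex argument: the dimensions of the spaces of potentials and of circulations agree
by Euler's formula. -/
theorem IsSphere.exists_potential [Finite V] [Finite F] {G : FacedGraph V D F} (hG : G.IsSphere)
    {w : D → ℝ} (hw : ∀ d, w (G.rev d) = - w d) (hnet : ∀ v, G.net w v = 0) :
    ∃ p : F → ℝ, ∀ d, w d = G.potFlow p d := by
  have := Fintype.ofFinite V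
  have := Fintype.ofFinite F
  let A : Submodule ℝ (D → ℝ) :=
    { carrier := {f | ∀ d, f (G.rev d) = - f d}
      add_mem' := by
        intro f g hf hg d
        simp only [Pi.add_apply]; rw [hf d, hg d]; ring
      zero_mem' := by intro d; simp
      smul_mem' := by
        intro r f hf d
        simp only [Pi.smul_apply, smul_eq_mul]; rw [hf d]; ring }
  let N : A →ₗ[ℝ] (V → ℝ) :=
    { toFun := fun f v => G.net f.1 v
      map_add' := fun f g => funext fun v => G.net_add f.1 g.1 v
      map_smul' := fun r f => funext fun v => G.net_smul r f.1 v }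
  let B : (F → ℝ) →ₗ[ℝ] A :=
    { toFun := fun p => ⟨G.potFlow p, G.potFlow_rev p⟩
      map_add' := fun p q => Subtype.ext (funext fun d => G.potFlow_add p q d)
      map_smul' := fun r p => Subtype.ext (funext fun d => G.potFlow_smul r p d) }
  have hBN : LinearMap.range B ≤ LinearMap.ker N := by
    rintro _ ⟨p, rfl⟩
    exact LinearMap.mem_ker.2 (funext fun v => hG.net_potFlow p v)
  have hF : Fintype.card F ≤ Module.finrank ℝ (LinearMap.range B) + 1 := by
    have h1 := LinearMap.finrank_range_add_finrank_ker B
    rw [Module.finrank_fintype_fun_eq_card] at h1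
    have h2 : LinearMap.ker B ≤ Submodule.span ℝ {fun _ => (1 : ℝ)} := by
      intro p hp
      have h3 : ∀ d, p (G.right d) = p (G.left d) := by
        intro d
        have := congrArg (fun f : A => f.1 d) (LinearMap.mem_ker.1 hp)
        exact sub_eq_zero.1 this
      rw [Submodule.mem_span_singleton]
      rcases isEmpty_or_nonempty F with hemp | ⟨⟨x⟩⟩
      · exact ⟨0, funext fun y => hemp.elim y⟩
      · exact ⟨p x, funext fun y => by simpa using hG.dual_connected p h3 x y⟩
    have h4 : Module.finrank ℝ (LinearMap.ker B) ≤ 1 :=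
      (Submodule.finrank_mono h2).trans ((finrank_span_le_card _).trans (by simp))
    omega
  have hV : Fintype.card V ≤ Module.finrank ℝ (LinearMap.range N) + 1 := by
    rcases isEmpty_or_nonempty V with hemp | ⟨⟨r⟩⟩
    · simp
    · have h1 : (⊤ : Submodule ℝ (V → ℝ)) ≤
          LinearMap.range N ⊔ Submodule.span ℝ {Pi.single r (1 : ℝ)} := by
        intro g _
        rw [← LinearMap.sum_single_apply (fun _ => ℝ) g]
        refine Submodule.sum_mem _ fun v _ => ?_
        obtain ⟨l, hl⟩ := hG.connected r v
        have h2 : Pi.single v (1 : ℝ) = N ⟨G.along l, G.along_rev l⟩ + Pi.single r (1 : ℝ) := by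
          funext x
          have := G.net_along hl x
          simp only [Pi.add_apply, N, LinearMap.coe_mk, AddHom.coe_mk, this, Pi.single_apply]
          ring
        have h3 : Pi.single v (g v) = g v • Pi.single v (1 : ℝ) := by
          rw [← Pi.single_smul]; simp
        have h4 : Pi.single v (1 : ℝ) ∈
            LinearMap.range N ⊔ Submodule.span ℝ {Pi.single r (1 : ℝ)} := by
          rw [h2]
          exact Submodule.add_mem_sup (LinearMap.mem_range_self _ _)
            (Submodule.mem_span_singleton_self _)
        have := Submodule.smul_mem _ (g v) h4
        rw [← h3] at this
        exact this
      have h2 := Submodule.finrank_mono h1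
      rw [finrank_top, Module.finrank_fintype_fun_eq_card] at h2
      have h3 := Submodule.finrank_add_le_finrank_add_finrank (LinearMap.range N)
        (Submodule.span ℝ {Pi.single r (1 : ℝ)})
      have h4 : Module.finrank ℝ (Submodule.span ℝ {(Pi.single r (1 : ℝ) : V → ℝ)}) ≤ 1 :=
        (finrank_span_le_card _).trans (by simp)
      omega
  have hA : 2 * Module.finrank ℝ A ≤ Fintype.card D := by
    -- An antisymmetric function is determined by its values on one dart of each edge.
    let en := Fintype.equivFin D
    let H := Finset.univ.filter fun d => en d < en (G.rev d)
    have h1 : 2 * H.card = Fintype.card D := by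
      have h2 : (Finset.univ.filter fun d => ¬ en d < en (G.rev d)).card = H.card := by
        refine Finset.card_bij (fun d _ => G.rev d) ?_ ?_ ?_
        · intro d hd
          simp only [H, Finset.mem_filter, Finset.mem_univ, true_and, G.rev_rev] at hd ⊢
          exact lt_of_le_of_ne (not_lt.1 hd) fun h => G.rev_ne d (en.injective h)
        · intro d _ e _ h; exact G.rev_injective h
        · intro d hd
          simp only [H, Finset.mem_filter, Finset.mem_univ, true_and] at hd
          exact ⟨G.rev d, by simpa [G.rev_rev] using hd.le, G.rev_rev d⟩
      have h3 := Finset.card_filter_add_card_filter_not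
        (s := (Finset.univ : Finset D)) (fun d => en d < en (G.rev d))
      rw [h2, Finset.card_univ] at h3
      change H.card + H.card = _ at h3
      omega
    let res : A →ₗ[ℝ] (H → ℝ) :=
      { toFun := fun f d => f.1 d.1
        map_add' := fun _ _ => rfl
        map_smul' := fun _ _ => rfl }
    have h2 : Function.Injective res := by
      rw [injective_iff_map_eq_zero]
      intro f hf
      refine Subtype.ext (funext fun d => ?_)
      have hz : ∀ d, en d < en (G.rev d) → f.1 d = 0 := fun d hd =>
        congrFun hf ⟨d, by simpa [H] using hd⟩
      rcases lt_or_ge (en d) (en (G.rev d)) with h | h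
      · exact hz d h
      · have h3 : f.1 (G.rev d) = 0 := hz _ (by
          rw [G.rev_rev]; exact lt_of_le_of_ne h fun h => G.rev_ne d (en.injective h))
        rw [f.2 d] at h3
        exact neg_eq_zero.1 h3
    have h3 := LinearMap.finrank_le_finrank_of_injective h2
    rw [Module.finrank_fintype_fun_eq_card, Fintype.card_coe] at h3
    omega
  have hN := LinearMap.finrank_range_add_finrank_ker N
  have heul := hG.euler
  rw [Nat.card_eq_fintype_card, Nat.card_eq_fintype_card, Nat.card_eq_fintype_card] at heul
  have heq := Submodule.eq_of_le_of_finrank_le hBN (by omega)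
  have hmem : (⟨w, hw⟩ : A) ∈ LinearMap.range B := by
    rw [heq]; exact LinearMap.mem_ker.2 (funext hnet)
  obtain ⟨p, hp⟩ := hmem
  exact ⟨p, fun d => (congrFun (congrArg Subtype.val hp) d).symm⟩

lemma IsSphere.exists_potential_zero [Finite V] [Finite F] {G : FacedGraph V D F}
    (hG : G.IsSphere) (o : F) {w : D → ℝ} (hw : ∀ d, w (G.rev d) = - w d)
    (hnet : ∀ v, G.net w v = 0) : ∃ p : F → ℝ, p o = 0 ∧ ∀ d, w d = G.potFlow p d := by
  obtain ⟨p, hp⟩ := hG.exists_potential hw hnet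
  exact ⟨fun x => p x - p o, by simp, fun d => by rw [hp]; simp [potFlow]⟩

lemma IsSphere.eq_zero_of_potFlow {G : FacedGraph V D F} (hG : G.IsSphere) {o : F} {p : F → ℝ}
    (ho : p o = 0) (hp : ∀ d, G.potFlow p d = 0) (x : F) : p x = 0 := by
  rw [← ho]; exact hG.dual_connected p (fun d => sub_eq_zero.1 (hp d)) x o

/-- Jordan curve theorem: the potential of a simple cycle takes two values, which differ by one. -/
theorem IsSphere.jordan {G : FacedGraph V D F} (hG : G.IsSphere) {C : List D}
    (hC : G.IsSimpleCycle C) {q : F → ℝ} (hq : ∀ d, G.along C d = G.potFlow q d) :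
    ∃ α, ∀ x, q x = α ∨ q x = α + 1 := by
  obtain ⟨d0, hd0⟩ := List.exists_mem_of_ne_nil _ hC.1
  have hstep : ∀ d ∈ C, q (G.right d) = q (G.left d) + 1 := by
    intro d hd
    have := hq d
    rw [hC.along_eq_one hd, potFlow] at this; linarith
  -- All faces on the right of the cycle have the same potential.
  have hnext : ∀ d ∈ C, ∀ e ∈ C, G.tail e = G.head d → q (G.right e) = q (G.right d) := by
    intro d hd e he hde
    have h1 := hG.fan e (G.rev d) (fun h => hC.2.2.2 d hd (h ▸ he)) hde q ?_
    · rw [h1, left_rev]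
    · intro x hx h1 h2
      have h3 : G.along C x = 0 := by
        refine G.along_eq_zero (fun h => h1 (List.inj_on_of_nodup_map hC.2.2.1 h he hx)) ?_
        intro h
        obtain ⟨y, hy, hy'⟩ := hC.exists_next h
        rw [G.head_rev] at hy'
        have h4 : y = e := List.inj_on_of_nodup_map hC.2.2.1 hy he (hy'.trans hx)
        obtain ⟨z, hz, hz'⟩ := hC.exists_next hd
        -- `rev x` and `d` both precede `e` on the cycle.
        obtain ⟨u, hu⟩ := hC.2.1
        have h5 : G.rev x = d := by
          have hnet := hC.net (G.tail e)
          by_contra hne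
          have h6 : (1 : ℝ) + 1 ≤ ∑ y ∈ (Finset.univ.filter fun y => G.head y = G.tail e).filter
              (fun y => y ∈ C), G.along C y := by
            have hsub : ({G.rev x, d} : Finset D) ⊆ (Finset.univ.filter fun y =>
                G.head y = G.tail e).filter (fun y => y ∈ C) := by
              intro y hy
              simp only [Finset.mem_insert, Finset.mem_singleton] at hy
              rcases hy with rfl | rfl
              · simp [h, hx]
              · simp [hd, hde]
            refine le_trans ?_ (Finset.sum_le_sum_of_subset_of_nonneg hsub ?_)
            · rw [Finset.sum_pair hne, hC.along_eq_one h, hC.along_eq_one hd]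
            · intro y hy _
              rw [hC.along_eq_one (Finset.mem_filter.1 hy).2]; norm_num
          have h7 : (-1 : ℝ) ≤ ∑ y ∈ (Finset.univ.filter fun y => G.head y = G.tail e).filter
              (fun y => ¬ y ∈ C), G.along C y := by
            have h8 : ∀ y ∈ (Finset.univ.filter fun y => G.head y = G.tail e).filter
                (fun y => ¬ y ∈ C), (if y = G.rev e then (-1 : ℝ) else 0) ≤ G.along C y := by
              intro y hy
              simp only [Finset.mem_filter, Finset.mem_univ, true_and] at hy
              by_cases h9 : G.rev y ∈ C
              · have h10 : G.rev y = e :=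
                  List.inj_on_of_nodup_map hC.2.2.1 h9 he (by simpa using hy.1)
                have h11 : y = G.rev e := G.rev_eq_iff.1 h10
                rw [if_pos h11, h11, G.along_rev, hC.along_eq_one he]
              · rw [G.along_eq_zero hy.2 h9]; split_ifs <;> norm_num
            refine le_trans ?_ (Finset.sum_le_sum h8)
            rw [Finset.sum_ite_eq']; split_ifs <;> norm_num
          have h12 := Finset.sum_filter_add_sum_filter_not
            (Finset.univ.filter fun y => G.head y = G.tail e) (fun y => y ∈ C) (G.along C)
          rw [DartGraph.net] at hnet
          linarith
        exact h2 (G.rev_eq_iff.1 h5)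
      have h4 := hq x
      rw [h3, potFlow] at h4; linarith
  obtain ⟨u, hu⟩ := hC.2.1
  have hall : ∀ d ∈ C, ∀ e ∈ C, q (G.right d) = q (G.right e) := by
    have h1 : ∀ (l : List D) (u v : V), G.IsWalk u l v → l ⊆ C → ∀ e ∈ l, ∀ c ∈ l.head?,
        q (G.right e) = q (G.right c) := by
      intro l
      induction l with
      | nil => simp
      | cons c l ih =>
        intro u v hl hs e he c' hc'
        simp only [List.head?_cons, Option.mem_def, Option.some.injEq] at hc'
        subst hc'
        rcases List.mem_cons.1 he with rfl | he
        · rfl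
        · cases l with
          | nil => simp at he
          | cons c2 l =>
            rw [ih _ _ hl.2 (fun x hx => hs (List.mem_cons_of_mem _ hx)) e he c2 (by simp)]
            exact hnext c (hs (by simp)) c2 (hs (by simp)) hl.2.1
    intro d hd e he
    cases hCe : C with
    | nil => rw [hCe] at hd; simp at hd
    | cons c l =>
      rw [h1 C u u hu (fun _ h => h) d hd c (by simp [hCe]),
        h1 C u u hu (fun _ h => h) e he c (by simp [hCe])]
  refine ⟨q (G.left d0), fun x => ?_⟩
  -- The set of faces with these two values is closed under crossing darts.
  have h2 : ∀ d, (q (G.right d) = q (G.left d0) ∨ q (G.right d) = q (G.left d0) + 1) ↔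
      (q (G.left d) = q (G.left d0) ∨ q (G.left d) = q (G.left d0) + 1) := by
    have h3 : ∀ d ∈ C, q (G.right d) = q (G.left d0) + 1 ∧ q (G.left d) = q (G.left d0) := by
      intro d hd
      have h4 := hall d hd d0 hd0
      have h5 := hstep d hd
      have h6 := hstep d0 hd0
      constructor <;> linarith
    intro d
    by_cases h4 : d ∈ C
    · simp [h3 d h4]
    · by_cases h5 : G.rev d ∈ C
      · have := h3 _ h5
        rw [right_rev, left_rev] at this
        simp [this]
      · have h6 := hq d
        rw [G.along_eq_zero h4 h5, potFlow] at h6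
        rw [show q (G.right d) = q (G.left d) by linarith]
  have h3 := hG.dual_connected
    (fun x => if q x = q (G.left d0) ∨ q x = q (G.left d0) + 1 then 1 else 0)
    (fun d => by simp only [h2 d]) x (G.left d0)
  simp only [true_or, if_true] at h3
  by_contra h4
  rw [if_neg h4] at h3
  norm_num at h3

/-- A clockwise circulation that does not vanish contains a clockwise simple cycle. -/
theorem IsSphere.exists_clockwiseCycle [Finite V] [Finite F] {G : FacedGraph V D F}
    (hG : G.IsSphere) {o : F} {p : F → ℝ} (ho : p o = 0) (hp : ∀ x, 0 ≤ p x) (hne : ∃ x, p x ≠ 0) :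
    ∃ C, G.IsClockwiseCycle o C ∧ ∀ d ∈ C, 0 < G.potFlow p d := by
  by_contra hcon
  push Not at hcon
  obtain ⟨Cs, h1, h2⟩ := G.exists_cycle_decomposition (G.potFlow_rev p) (hG.net_potFlow p)
  have h3 : ∀ C ∈ Cs, ∃ q : F → ℝ, q o = 0 ∧ (∀ x, q x ≤ 0) ∧
      ∀ d, G.along C.2 d = G.potFlow q d := by
    intro C hC
    obtain ⟨hpos, hcyc, hd⟩ := h1 C hC
    obtain ⟨q, hqo, hq⟩ := hG.exists_potential_zero o (G.along_rev C.2) hcyc.net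
    refine ⟨q, hqo, ?_, hq⟩
    obtain ⟨α, hα⟩ := hG.jordan hcyc hq
    by_contra hneg
    push Not at hneg
    obtain ⟨x, hx⟩ := hneg
    have h4 : ∀ y, 0 ≤ q y := by
      intro y
      rcases hα o with h | h <;> rcases hα x with h' | h' <;> rcases hα y with h'' | h'' <;>
        linarith
    obtain ⟨d, hdC, hd'⟩ := hcon C.2 ⟨hcyc, q, hqo, h4, hq⟩
    have := hd d hdC
    linarith
  choose! q hqo hq hqd using h3
  -- The potential is a positive combination of nonpositive ones.
  have h4 : ∀ x, p x = (Cs.map fun C => C.1 * q C x).sum := by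
    intro x
    have h5 := hG.eq_zero_of_potFlow (o := o)
      (p := fun x => p x - (Cs.map fun C => C.1 * q C x).sum)
      ?_ ?_ x
    · linarith
    · rw [ho]
      have : (Cs.map fun C => C.1 * q C o) = Cs.map fun _ => 0 :=
        List.map_congr_left fun C hC => by rw [hqo C hC, mul_zero]
      simp [this]
    · intro d
      rw [potFlow_sub, h2 d, sub_eq_zero]
      rw [← G.sum_potFlow Cs (fun C => C.1) q d]
      exact congrArg List.sum (List.map_congr_left fun C hC => by rw [hqd C hC])
  obtain ⟨x, hx⟩ := hne
  have h5 : (Cs.map fun C => C.1 * q C x).sum ≤ 0 := by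
    have : ∀ r ∈ Cs.map fun C => C.1 * q C x, r ≤ 0 := by
      intro r hr
      obtain ⟨C, hC, rfl⟩ := List.mem_map.1 hr
      exact mul_nonpos_of_nonneg_of_nonpos (h1 C hC).1.le (hq C hC x)
    refine (List.sum_le_card_nsmul _ 0 this).trans (by simp)
  rw [← h4] at h5
  exact hx (le_antisymm h5 (hp x))

/-- If every positive simple cycle of a circulation meets the set `Q`, the oscillation of its
potential is at most the amount of flow on the darts in `Q`. -/
theorem IsSphere.abs_sub_le [Finite V] [Finite F] {G : FacedGraph V D F}
    (hG : G.IsSphere) {w : D → ℝ} {χ : F → ℝ} (hχ : ∀ d, w d = G.potFlow χ d) (Q : Finset D)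
    (hQ : ∀ C, G.IsSimpleCycle C → (∀ d ∈ C, 0 < w d) → ∃ d ∈ C, d ∈ Q) (x y : F) :
    |χ x - χ y| ≤ ∑ d ∈ Q, max (w d) 0 := by
  have hw : ∀ d, w (G.rev d) = - w d := fun d => by rw [hχ, hχ, G.potFlow_rev]
  obtain ⟨Cs, h1, h2⟩ := G.exists_cycle_decomposition hw
    (fun v => by rw [show w = G.potFlow χ from funext hχ]; exact hG.net_potFlow χ v)
  have h3 : ∀ C ∈ Cs, ∃ q : F → ℝ, (∀ x y, |q x - q y| ≤ 1) ∧
      ∀ d, G.along C.2 d = G.potFlow q d := by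
    intro C hC
    obtain ⟨hpos, hcyc, hd⟩ := h1 C hC
    obtain ⟨q, hq⟩ := hG.exists_potential (G.along_rev C.2) hcyc.net
    refine ⟨q, fun x y => ?_, hq⟩
    obtain ⟨α, hα⟩ := hG.jordan hcyc hq
    rcases hα x with h | h <;> rcases hα y with h' | h' <;> rw [h, h', abs_le] <;>
      constructor <;> linarith
  choose! q hq hqd using h3
  have h4 : ∀ x, χ x - χ y = (Cs.map fun C => C.1 * (q C x - q C y)).sum := by
    intro x
    have h5 := hG.eq_zero_of_potFlow (o := y)
      (p := fun x => (χ x - χ y) - (Cs.map fun C => C.1 * (q C x - q C y)).sum) (by simp) ?_ x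
    · linarith
    · intro d
      rw [potFlow_sub, sub_eq_zero]
      rw [← G.sum_potFlow Cs (fun C => C.1) (fun C x => q C x - q C y) d]
      have h6 : G.potFlow (fun x => χ x - χ y) d = w d := by rw [hχ]; simp [potFlow]
      rw [h6, h2]
      refine congrArg List.sum (List.map_congr_left fun C hC => ?_)
      rw [hqd C hC]; simp [potFlow]
  have h5 : |χ x - χ y| ≤ (Cs.map fun C => C.1).sum := by
    rw [h4 x]
    have : ∀ Cs' : List (ℝ × List D), Cs' ⊆ Cs →
        |(Cs'.map fun C => C.1 * (q C x - q C y)).sum| ≤ (Cs'.map fun C => C.1).sum := by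
      intro Cs'
      induction Cs' with
      | nil => simp
      | cons C Cs' ih =>
        intro hs
        have h7 := ih (fun x hx => hs (List.mem_cons_of_mem _ hx))
        have h8 := hq C (hs List.mem_cons_self) x y
        have h9 := (h1 C (hs List.mem_cons_self)).1
        simp only [List.map_cons, List.sum_cons]
        refine (abs_add_le _ _).trans (add_le_add ?_ h7)
        rw [abs_mul, abs_of_pos h9]
        nlinarith
    exact this Cs fun _ h => h
  refine h5.trans ?_
  have h6 : ∀ d ∈ Q, (Cs.map fun C => C.1 * (if d ∈ C.2 then 1 else 0)).sum ≤ max (w d) 0 := by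
    intro d _
    by_cases hd : 0 < w d
    · refine le_trans ?_ (le_max_left _ _)
      rw [h2 d]
      refine List.sum_le_sum fun C hC => ?_
      obtain ⟨hpos, hcyc, hdC⟩ := h1 C hC
      refine mul_le_mul_of_nonneg_left ?_ hpos.le
      split_ifs with h
      · rw [hcyc.along_eq_one h]
      · by_cases h' : G.rev d ∈ C.2
        · have := hdC _ h'
          rw [hw] at this; linarith
        · rw [G.along_eq_zero h h']
    · refine le_trans (le_of_eq ?_) (le_max_right _ _)
      have : (Cs.map fun C => C.1 * (if d ∈ C.2 then (1 : ℝ) else 0)) = Cs.map fun _ => 0 :=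
        List.map_congr_left fun C hC => by
          rw [if_neg fun h => hd ((h1 C hC).2.2 d h), mul_zero]
      rw [this]; simp
  refine le_trans ?_ (Finset.sum_le_sum h6)
  have : ∀ Cs' : List (ℝ × List D), Cs' ⊆ Cs → (Cs'.map fun C => C.1).sum ≤
      ∑ d ∈ Q, (Cs'.map fun C => C.1 * (if d ∈ C.2 then (1 : ℝ) else 0)).sum := by
    intro Cs'
    induction Cs' with
    | nil => simp
    | cons C Cs' ih =>
      intro hs
      have h7 := ih (fun x hx => hs (List.mem_cons_of_mem _ hx))
      obtain ⟨hpos, hcyc, hdC⟩ := h1 C (hs List.mem_cons_self)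
      simp only [List.map_cons, List.sum_cons, Finset.sum_add_distrib]
      refine add_le_add ?_ h7
      obtain ⟨d, hd, hdQ⟩ := hQ C.2 hcyc hdC
      refine le_trans ?_ (Finset.single_le_sum
        (f := fun d => C.1 * (if d ∈ C.2 then (1 : ℝ) else 0))
        (fun e _ => ?_) hdQ)
      · simp [hd]
      · split_ifs <;> simp [hpos.le]
  exact this Cs fun _ h => h

end Duality

end FacedGraph

end PlanarFlow

end

/-! ### Plane graphs, their duals and their radial graphs -/

noncomputable section

namespace PlanarFlow

open scoped Classical

namespace PlaneGraph

variable {V D F : Type*} (G : PlaneGraph V D F)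

/-- The permutation that maps a dart to the next one on the boundary of its right face. -/
def faceNext : Equiv.Perm D := G.rot⁻¹ * Function.Involutive.toPerm G.rev G.rev_rev

lemma rot_faceNext (d : D) : G.rot (G.faceNext d) = G.rev d := G.rot.apply_symm_apply _

lemma faceNext_rev_rot (d : D) : G.faceNext (G.rev (G.rot d)) = d :=
  G.rot.injective (by rw [rot_faceNext, G.rev_rev])

lemma tail_rot (d : D) : G.tail (G.rot d) = G.tail d :=
  (G.tail_eq_iff _ _).2 (Equiv.Perm.sameCycle_apply_left.2 (Equiv.Perm.SameCycle.refl _ _))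

lemma right_faceNext (d : D) : G.right (G.faceNext d) = G.right d :=
  (G.right_eq_iff _ _).2 (Equiv.Perm.sameCycle_apply_left.2 (Equiv.Perm.SameCycle.refl _ _))

lemma tail_faceNext (d : D) : G.tail (G.faceNext d) = G.head d := by
  rw [← G.tail_rot, rot_faceNext, G.tail_rev]

lemma left_rot (d : D) : G.left (G.rot d) = G.right d := by
  rw [← G.right_rev, ← G.right_faceNext, faceNext_rev_rot]

lemma finite_vertex {V D F : Type*} (G : PlaneGraph V D F) [Finite D] : Finite V :=
  Finite.of_surjective _ G.tail_surj

lemma finite_face {V D F : Type*} (G : PlaneGraph V D F) [Finite D] : Finite F :=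
  Finite.of_surjective _ G.right_surj

lemma isSphere [Fintype D] : G.IsSphere :=
  FacedGraph.IsSphere.of_rot G.rot G.tail_rot (fun d e h => (G.tail_eq_iff d e).1 h) G.left_rot
    G.connected G.right_surj G.euler

/-- The dual graph: the dual of a dart leads from its left to its right face, and has the tail of
the dart on its right. -/
def dual : FacedGraph F D V where
  rev := G.rev
  rev_rev := G.rev_rev
  rev_ne := G.rev_ne
  tail := G.left
  right := G.tail

lemma dual_isWalk (x y : F) (l : List D) : G.dual.IsWalk x l y ↔ G.IsDualWalk x l y := by
  induction l generalizing x with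
  | nil => rfl
  | cons d l ih =>
    have h : G.dual.head d = G.right d := by
      change G.left (G.rev d) = _; exact G.left_rev d
    simp only [DartGraph.IsWalk, FacedGraph.IsDualWalk, h, ih]; rfl

lemma dual_isSphere [Fintype D] : G.dual.IsSphere := by
  have hinv : ∀ d, G.tail (G.rot⁻¹ d) = G.tail d := fun d => by
    rw [← G.tail_rot, show G.rot (G.rot⁻¹ d) = d from G.rot.apply_symm_apply d]
  let σ : Equiv.Perm D := Function.Involutive.toPerm G.rev G.rev_rev
  have hconj : σ * G.faceNext * σ⁻¹ = σ * G.rot⁻¹ := by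
    ext d
    change G.rev (G.rot⁻¹ (G.rev (G.rev d))) = G.rev (G.rot⁻¹ d)
    rw [G.rev_rev]
  have hleft : ∀ d, G.left (G.rev (G.rot⁻¹ d)) = G.left d := fun d => by
    rw [G.left_rev, ← G.left_rot, show G.rot (G.rot⁻¹ d) = d from G.rot.apply_symm_apply d]
  refine FacedGraph.IsSphere.of_rot (G := G.dual) (σ * G.rot⁻¹) hleft ?_ ?_ ?_ G.tail_surj ?_
  · intro d e hde
    rw [← hconj, Equiv.Perm.sameCycle_conj]
    exact (G.right_eq_iff _ _).1 hde
  · intro d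
    change G.tail (G.rev (G.rev (G.rot⁻¹ d))) = G.tail d
    rw [G.rev_rev, hinv]
  · intro x y
    by_contra hcon
    have h1 := G.isSphere.dual_connected
      (fun z => if ∃ l, G.dual.IsWalk x l z then 1 else 0) ?_ x y
    · rw [if_pos ⟨[], rfl⟩, if_neg hcon] at h1
      norm_num at h1
    · intro d
      have h2 : ∀ d, (∃ l, G.dual.IsWalk x l (G.left d)) → ∃ l, G.dual.IsWalk x l (G.right d) := by
        rintro d ⟨l, hl⟩
        exact ⟨l ++ [d], G.dual.isWalk_concat.2 ⟨hl, G.left_rev d⟩⟩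
      have h3 : (∃ l, G.dual.IsWalk x l (G.left d)) ↔ ∃ l, G.dual.IsWalk x l (G.right d) :=
        ⟨h2 d, fun h => by have := h2 (G.rev d) (by rwa [G.left_rev]); rwa [G.right_rev] at this⟩
      simp only [h3]
  · have := G.euler; omega

/-- The radial extension of the graph: every face gets a vertex inside, which is joined to every
corner of the face. The faces are triangles, one at the right of every dart of the graph. The dart
`inr (d, true)` leads from the vertex at the corner between `d` and `rot d` to the face. -/
def radial : FacedGraph (V ⊕ F) (D ⊕ D × Bool) D where
  rev
    | .inl d => .inl (G.rev d)
    | .inr (d, b) => .inr (d, !b)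
  rev_rev
    | .inl d => congrArg Sum.inl (G.rev_rev d)
    | .inr (d, b) => by simp
  rev_ne
    | .inl d => fun h => G.rev_ne d (Sum.inl.inj h)
    | .inr (d, b) => by simp
  tail
    | .inl d => .inl (G.tail d)
    | .inr (d, true) => .inl (G.tail d)
    | .inr (d, false) => .inr (G.right d)
  right
    | .inl d => d
    | .inr (d, true) => G.rev (G.rot d)
    | .inr (d, false) => d

/-- The clockwise rotation of the radial extension. -/
def radialRot : Equiv.Perm (D ⊕ D × Bool) where
  toFun
    | .inl d => .inr (d, true)
    | .inr (d, true) => .inl (G.rot d)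
    | .inr (d, false) => .inr (G.faceNext d, false)
  invFun
    | .inl d => .inr (G.rot.symm d, true)
    | .inr (d, true) => .inl d
    | .inr (d, false) => .inr (G.faceNext.symm d, false)
  left_inv := by rintro (d | ⟨d, _ | _⟩) <;> simp
  right_inv := by rintro (d | ⟨d, _ | _⟩) <;> simp

lemma radial_isSphere [Fintype D] : G.radial.IsSphere := by
  have hV := G.finite_vertex
  have hF := G.finite_face
  have hpow : ∀ (n : ℕ) (d : D), (G.radialRot ^ (2 * n)) (Sum.inl d) = Sum.inl ((G.rot ^ n) d) := by
    intro n d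
    induction n with
    | zero => rfl
    | succ n ih =>
      rw [show 2 * (n + 1) = (2 * n + 1) + 1 by ring, pow_succ', pow_succ', Equiv.Perm.mul_apply,
        Equiv.Perm.mul_apply, ih, pow_succ', Equiv.Perm.mul_apply]
      rfl
  have hpowf : ∀ (n : ℕ) (d : D),
      (G.radialRot ^ n) (Sum.inr (d, false)) = Sum.inr ((G.faceNext ^ n) d, false) := by
    intro n d
    induction n with
    | zero => rfl
    | succ n ih =>
      rw [pow_succ', Equiv.Perm.mul_apply, ih, pow_succ', Equiv.Perm.mul_apply]
      rfl
  have hll : ∀ d e : D, G.tail d = G.tail e → G.radialRot.SameCycle (.inl d) (.inl e) := by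
    intro d e h
    obtain ⟨n, -, hn⟩ := ((G.tail_eq_iff d e).1 h).exists_pow_eq'
    exact ⟨(2 * n : ℕ), by rw [zpow_natCast, hpow, hn]⟩
  have hlr : ∀ d : D, G.radialRot.SameCycle (.inl d) (.inr (d, true)) := fun d =>
    ⟨1, by rw [zpow_one]; rfl⟩
  refine FacedGraph.IsSphere.of_rot (G := G.radial) G.radialRot ?_ ?_ ?_ ?_
    (fun d => ⟨.inl d, rfl⟩) ?_
  · rintro (d | ⟨d, _ | _⟩)
    · rfl
    · exact congrArg Sum.inr (G.right_faceNext d)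
    · exact congrArg Sum.inl (G.tail_rot d)
  · rintro (d | ⟨d, _ | _⟩) (e | ⟨e, _ | _⟩) h
    · exact hll d e (Sum.inl.inj h)
    · cases h
    · exact (hll d e (Sum.inl.inj h)).trans (hlr e)
    · cases h
    · obtain ⟨n, -, hn⟩ := ((G.right_eq_iff d e).1 (Sum.inr.inj h)).exists_pow_eq'
      refine ⟨(n : ℕ), ?_⟩
      rw [zpow_natCast, hpowf]; rw [show (G.faceNext ^ n) d = e from hn]
    · cases h
    · exact (hlr d).symm.trans (hll d e (Sum.inl.inj h))
    · cases h
    · exact ((hlr d).symm.trans (hll d e (Sum.inl.inj h))).trans (hlr e)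
  · rintro (d | ⟨d, _ | _⟩)
    · rfl
    · change G.rev (G.rot (G.faceNext d)) = d
      rw [rot_faceNext, G.rev_rev]
    · rfl
  · have hvv : ∀ u v : V, ∃ l, G.radial.IsWalk (.inl u) l (.inl v) := by
      intro u v
      obtain ⟨l, hl⟩ := G.connected u v
      refine ⟨l.map Sum.inl, ?_⟩
      induction l generalizing u with
      | nil => exact congrArg Sum.inl hl
      | cons d l ih => exact ⟨congrArg Sum.inl hl.1, ih _ hl.2⟩
    have hvx : ∀ (u : V) (y : V ⊕ F), ∃ l, G.radial.IsWalk (.inl u) l y := by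
      rintro u (v | x)
      · exact hvv u v
      · obtain ⟨d, rfl⟩ := G.right_surj x
        obtain ⟨l, hl⟩ := hvv u (G.tail d)
        exact ⟨l ++ [.inr (d, true)], (G.radial.isWalk_concat (d := .inr (d, true))).2 ⟨hl, rfl⟩⟩
    rintro (u | x) y
    · exact hvx u y
    · obtain ⟨d, rfl⟩ := G.right_surj x
      obtain ⟨l, hl⟩ := hvx (G.tail d) y
      exact ⟨.inr (d, false) :: l, rfl, hl⟩
  · have := G.euler
    rw [Nat.card_sum, Nat.card_sum, Nat.card_prod, Nat.card_eq_fintype_card (α := Bool),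
      Fintype.card_bool]
    omega

/-- The net flow of the radial extension, at the vertices of the graph. -/
lemma radial_net_inl [Fintype D] {w : D ⊕ D × Bool → ℝ} (hw : ∀ d, w (G.radial.rev d) = - w d)
    (v : V) : G.radial.net w (.inl v) =
      G.net (fun d => w (.inl d)) v - ∑ d with G.tail d = v, w (.inr (d, true)) := by
  have h1 : ∀ d, (fun d => w (.inl d)) (G.rev d) = - (fun d => w (.inl d)) d := fun d =>
    hw (.inl d)
  rw [G.radial.net_eq_neg_sum_tail hw, G.net_eq_neg_sum_tail h1, Finset.sum_filter,
    Fintype.sum_sum_type, Fintype.sum_prod_type, Finset.sum_filter, Finset.sum_filter]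
  have h3 : ∀ d, (G.radial.tail (.inl d) = (.inl v : V ⊕ F)) ↔ G.tail d = v := fun d =>
    Sum.inl_injective.eq_iff
  have h4 : ∀ d, (G.radial.tail (.inr (d, true)) = (.inl v : V ⊕ F)) ↔ G.tail d = v := fun d =>
    Sum.inl_injective.eq_iff
  have h5 : ∀ d, (G.radial.tail (.inr (d, false)) = (.inl v : V ⊕ F)) ↔ False := fun d =>
    ⟨fun h => (by cases h), False.elim⟩
  simp only [Fintype.sum_bool, h3, h4, h5, if_false, add_zero]
  ring

lemma radial_net_inr [Fintype D] {w : D ⊕ D × Bool → ℝ} (hw : ∀ d, w (G.radial.rev d) = - w d)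
    (x : F) : G.radial.net w (.inr x) = ∑ d with G.right d = x, w (.inr (d, true)) := by
  rw [G.radial.net_eq_neg_sum_tail hw, Finset.sum_filter,
    Fintype.sum_sum_type, Fintype.sum_prod_type, Finset.sum_filter]
  have h3 : ∀ d, (G.radial.tail (.inl d) = (.inr x : V ⊕ F)) ↔ False := fun d =>
    ⟨fun h => (by cases h), False.elim⟩
  have h4 : ∀ d, (G.radial.tail (.inr (d, true)) = (.inr x : V ⊕ F)) ↔ False := fun d =>
    ⟨fun h => (by cases h), False.elim⟩
  have h5 : ∀ d, (G.radial.tail (.inr (d, false)) = (.inr x : V ⊕ F)) ↔ G.right d = x := fun d =>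
    Sum.inr_injective.eq_iff
  have h6 : ∀ d, w (.inr (d, false)) = - w (.inr (d, true)) := fun d => hw (.inr (d, true))
  simp only [Fintype.sum_bool, h3, h4, h5, h6, if_false, zero_add, Finset.sum_const_zero]
  rw [← Finset.sum_neg_distrib]
  refine Finset.sum_congr rfl fun d _ => ?_
  split_ifs <;> simp

/-- A curve through `n` faces, as a flow in the radial extension. -/
lemma exists_curveFlow [Fintype D] {n : ℕ} {u v : V} (h : G.FaceCurve n u v) :
    ∃ γ : D → ℝ, (∀ x, ∑ d with G.tail d = x, γ d =
        (if x = u then 1 else 0) - (if x = v then 1 else 0)) ∧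
      (∀ y, ∑ d with G.right d = y, γ d = 0) ∧
      ∑ d, max (γ d) 0 ≤ n ∧ ∑ d, max (- γ d) 0 ≤ n := by
  induction h with
  | refl u => exact ⟨fun _ => 0, by simp, by simp, by simp, by simp⟩
  | step n d e v h hv ih =>
    obtain ⟨γ, h1, h2, h3, h4⟩ := ih
    have hs : ∀ (P : D → Prop) (c : D), ∑ x with P x, (if x = c then (1 : ℝ) else 0)
        = if P c then 1 else 0 := by
      intro P c
      rw [Finset.sum_ite_eq']; simp
    refine ⟨fun x => γ x + ((if x = d then 1 else 0) - (if x = e then 1 else 0)), ?_, ?_, ?_, ?_⟩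
    · intro x
      rw [Finset.sum_add_distrib, Finset.sum_sub_distrib, h1, hs, hs]
      simp only [eq_comm]; ring
    · intro y
      rw [Finset.sum_add_distrib, Finset.sum_sub_distrib, h2, hs, hs, h]; ring
    · have : ∀ x ∈ Finset.univ, max (γ x + ((if x = d then 1 else 0) - (if x = e then 1 else 0))) 0
          ≤ max (γ x) 0 + if x = d then 1 else 0 := by
        intro x _
        refine max_le ?_ (by positivity)
        have := le_max_left (γ x) 0
        have h6 : (0 : ℝ) ≤ if x = e then 1 else 0 := by positivity
        linarith
      refine (Finset.sum_le_sum this).trans ?_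
      rw [Finset.sum_add_distrib, Finset.sum_ite_eq']
      push_cast; simp; linarith
    · have : ∀ x ∈ Finset.univ,
          max (-(γ x + ((if x = d then 1 else 0) - (if x = e then 1 else 0)))) 0
          ≤ max (- γ x) 0 + if x = e then 1 else 0 := by
        intro x _
        refine max_le ?_ (by positivity)
        have := le_max_left (- γ x) 0
        have h6 : (0 : ℝ) ≤ if x = d then 1 else 0 := by positivity
        linarith
      refine (Finset.sum_le_sum this).trans ?_
      rw [Finset.sum_add_distrib, Finset.sum_ite_eq']
      push_cast; simp; linarith

/-- The potential, in the radial extension, of an acyclic flow of value `r` from `u` to `v` closed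
up along a curve through `n` faces oscillates by at most `n |r|`: each cycle of the difference uses
the curve. -/
lemma exists_radial_potential [Fintype D] {n : ℕ} {u v : V} {γ : D → ℝ}
    (hγ1 : ∀ x, ∑ d with G.tail d = x, γ d = (if x = u then 1 else 0) - (if x = v then 1 else 0))
    (hγ2 : ∀ y, ∑ d with G.right d = y, γ d = 0)
    (hγ3 : ∑ d, max (γ d) 0 ≤ n) (hγ4 : ∑ d, max (- γ d) 0 ≤ n)
    {x : D → ℝ} {r : ℝ} (hx : ∀ d, x (G.rev d) = - x d)
    (hnet : ∀ y, G.net x y = r * ((if y = v then 1 else 0) - (if y = u then 1 else 0)))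
    (hac : ∀ C, G.IsSimpleCycle C → ¬ ∀ d ∈ C, 0 < x d) :
    ∃ χ : D → ℝ, (∀ d, x d = χ d - χ (G.rev d)) ∧
      (∀ d, - (r * γ d) = χ (G.rev (G.rot d)) - χ d) ∧ ∀ d e, |χ d - χ e| ≤ n * |r| := by
  have hV := G.finite_vertex
  have hF := G.finite_face
  let w : D ⊕ D × Bool → ℝ
    | .inl d => x d
    | .inr (d, true) => - (r * γ d)
    | .inr (d, false) => r * γ d
  have hw : ∀ d, w (G.radial.rev d) = - w d := by
    rintro (d | ⟨d, _ | _⟩)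
    · exact hx d
    · exact rfl
    · change r * γ d = - - (r * γ d); ring
  have hwnet : ∀ y, G.radial.net w y = 0 := by
    rintro (y | y)
    · rw [G.radial_net_inl hw]
      change G.net x y - ∑ d with G.tail d = y, - (r * γ d) = 0
      rw [Finset.sum_neg_distrib, ← Finset.mul_sum, hγ1, hnet]; ring
    · rw [G.radial_net_inr hw]
      change ∑ d with G.right d = y, - (r * γ d) = 0
      rw [Finset.sum_neg_distrib, ← Finset.mul_sum, hγ2]; ring
  obtain ⟨χ, hχ⟩ := G.radial_isSphere.exists_potential hw hwnet
  refine ⟨χ, fun d => hχ (.inl d), fun d => hχ (.inr (d, true)), fun d e => ?_⟩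
  refine (G.radial_isSphere.abs_sub_le hχ
    (Finset.univ.image fun d => Sum.inr (d, true)) ?_ d e).trans ?_
  · -- A cycle that uses no dart into a vertex inside a face lies in the graph.
    intro C hC hpos
    by_contra hcon
    push Not at hcon
    have h1 : ∀ d ∈ C, ∃ e, d = Sum.inl e := by
      rintro (d | ⟨d, _ | _⟩) hd
      · exact ⟨d, rfl⟩
      · obtain ⟨e, he, he'⟩ := hC.exists_prev hd
        rcases e with e | ⟨e, _ | _⟩
        · cases he'
        · cases he'
        · exact absurd (by simp) (hcon _ he)
      · exact absurd (by simp) (hcon _ hd)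
    have h2 : ∃ C' : List D, C = C'.map Sum.inl := by
      clear hC hpos hcon
      induction C with
      | nil => exact ⟨[], rfl⟩
      | cons d C ih =>
        obtain ⟨e, rfl⟩ := h1 d List.mem_cons_self
        obtain ⟨C', rfl⟩ := ih fun d hd => h1 d (List.mem_cons_of_mem _ hd)
        exact ⟨e :: C', rfl⟩
    obtain ⟨C', rfl⟩ := h2
    refine hac C' ⟨by simpa using hC.1, ?_, ?_, ?_⟩ fun d hd =>
      hpos (.inl d) (List.mem_map_of_mem hd)
    · obtain ⟨y, hy⟩ := hC.2.1
      have hlift : ∀ (l : List D) (y : V ⊕ F) (z : V), l ≠ [] →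
          G.radial.IsWalk y (l.map Sum.inl) (.inl z) →
          ∃ y', y = .inl y' ∧ G.IsWalk y' l z := by
        intro l
        induction l with
        | nil => intro y z h; exact absurd rfl h
        | cons c l ih =>
          intro y z _ h
          refine ⟨G.tail c, h.1.symm, rfl, ?_⟩
          rcases eq_or_ne l [] with rfl | hl
          · exact Sum.inl.inj h.2
          · obtain ⟨y', hy', h'⟩ := ih _ z hl h.2
            rwa [← (Sum.inl.inj hy' : G.head c = y')] at h'
      have hne : C' ≠ [] := by simpa using hC.1
      cases y with
      | inl y =>
        obtain ⟨y', hy', h'⟩ := hlift C' _ y hne hy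
        rw [← Sum.inl.inj hy'] at h'
        exact ⟨y, h'⟩
      | inr y =>
        cases C' with
        | nil => exact absurd rfl hne
        | cons c l => cases hy.1
    · have := hC.2.2.1
      rw [List.map_map] at this
      have h3 : (C'.map G.tail).map Sum.inl = C'.map (G.radial.tail ∘ Sum.inl) := by
        rw [List.map_map]; rfl
      rw [← h3] at this
      exact this.of_map _
    · intro d hd hd'
      exact hC.2.2.2 (.inl d) (List.mem_map_of_mem hd) (List.mem_map_of_mem (f := Sum.inl) hd')
  · rw [Finset.sum_image (by intro d _ e _ h; simpa using h)]
    change ∑ d, max (- (r * γ d)) 0 ≤ n * |r|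
    rcases le_total 0 r with hr | hr
    · rw [abs_of_nonneg hr]
      have : ∀ d ∈ Finset.univ, max (- (r * γ d)) 0 ≤ max (- γ d) 0 * r := by
        intro d _
        rw [max_mul_of_nonneg _ _ hr]; simp [mul_comm]
      refine (Finset.sum_le_sum this).trans ?_
      rw [← Finset.sum_mul]
      exact mul_le_mul_of_nonneg_right hγ4 hr
    · rw [abs_of_nonpos hr]
      have : ∀ d ∈ Finset.univ, max (- (r * γ d)) 0 ≤ max (γ d) 0 * (- r) := by
        intro d _
        rw [max_mul_of_nonneg _ _ (neg_nonneg.2 hr)]; simp [mul_comm]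
      refine (Finset.sum_le_sum this).trans ?_
      rw [← Finset.sum_mul]
      exact mul_le_mul_of_nonneg_right hγ3 (neg_nonneg.2 hr)

/-- Some curve leads from one vertex to another. -/
lemma faceCurve_facesBetween (u v : V) : G.FaceCurve (G.facesBetween u v) u v := by
  refine Nat.sInf_mem (s := {n | G.FaceCurve n u v}) ?_
  obtain ⟨l, hl⟩ := G.connected u v
  refine ⟨l.length, ?_⟩
  induction l generalizing u with
  | nil => cases hl; exact FacedGraph.FaceCurve.refl _
  | cons d l ih =>
    obtain ⟨rfl, h2⟩ := hl
    refine FacedGraph.FaceCurve.step _ d (G.faceNext d) v (G.right_faceNext d).symm ?_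
    rw [tail_faceNext]; exact ih _ h2

/-- The potential of the difference of two acyclic flows of the same value is bounded: both are
compared with a curve through as few faces as possible. -/
theorem abs_potential_sub_le [Fintype D] {u v : V} {x₁ x₂ : D → ℝ} {r : ℝ}
    (hx₁ : ∀ d, x₁ (G.rev d) = - x₁ d) (hx₂ : ∀ d, x₂ (G.rev d) = - x₂ d)
    (hnet₁ : ∀ y, G.net x₁ y = r * ((if y = v then 1 else 0) - (if y = u then 1 else 0)))
    (hnet₂ : ∀ y, G.net x₂ y = r * ((if y = v then 1 else 0) - (if y = u then 1 else 0)))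
    (hac₁ : ∀ C, G.IsSimpleCycle C → ¬ ∀ d ∈ C, 0 < x₁ d)
    (hac₂ : ∀ C, G.IsSimpleCycle C → ¬ ∀ d ∈ C, 0 < x₂ d)
    {ψ : F → ℝ} (hψ : ∀ d, x₁ d - x₂ d = G.potFlow ψ d) (y z : F) :
    |ψ y - ψ z| ≤ 2 * G.facesBetween u v * |r| := by
  obtain ⟨γ, h1, h2, h3, h4⟩ := G.exists_curveFlow (G.faceCurve_facesBetween u v)
  obtain ⟨χ₁, ha, hb, hc⟩ := G.exists_radial_potential h1 h2 h3 h4 hx₁ hnet₁ hac₁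
  obtain ⟨χ₂, ha', hb', hc'⟩ := G.exists_radial_potential h1 h2 h3 h4 hx₂ hnet₂ hac₂
  -- The two potentials of the triangles differ by a potential of the faces of the graph.
  have hd := G.radial_isSphere.dual_connected (fun d => χ₁ d - χ₂ d - ψ (G.right d)) ?_
  · obtain ⟨d, rfl⟩ := G.right_surj y
    obtain ⟨e, rfl⟩ := G.right_surj z
    have h5 : χ₁ d - χ₂ d - ψ (G.right d) = χ₁ e - χ₂ e - ψ (G.right e) := hd d e
    have h6 : ψ (G.right d) - ψ (G.right e) = (χ₁ d - χ₁ e) - (χ₂ d - χ₂ e) := by linarith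
    rw [h6]
    refine (abs_sub _ _).trans ?_
    have := hc d e
    have := hc' d e
    linarith
  · have hcorner : ∀ d,
        (χ₁ (G.rev (G.rot d)) - χ₂ (G.rev (G.rot d)) - ψ (G.right (G.rev (G.rot d))))
        = χ₁ d - χ₂ d - ψ (G.right d) := by
      intro d
      rw [G.right_rev, G.left_rot]
      have := hb d
      have := hb' d
      linarith
    rintro (d | ⟨d, _ | _⟩)
    · change χ₁ d - χ₂ d - ψ (G.right d) = χ₁ (G.rev d) - χ₂ (G.rev d) - ψ (G.left d)
      have := ha d
      have := ha' d
      have := hψ d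
      simp only [FacedGraph.potFlow] at this
      linarith
    · exact (hcorner d).symm
    · exact hcorner d

end PlaneGraph

end PlanarFlow

end

/-! ### Dual distances and leftmost flows -/

noncomputable section

namespace PlanarFlow

open scoped Classical

namespace DartGraph

variable {V D : Type*} (G : DartGraph V D)

lemma IsWalk.reverse_vertices {G : DartGraph V D} {u v : V} {l : List D} (h : G.IsWalk u l v) :
    (l.map G.rev).reverse.map G.tail ++ [u] = (l.map G.tail ++ [v]).reverse := by
  induction l generalizing u with
  | nil => cases h; rfl
  | cons d l ih =>
    have h1 := ih h.2
    simp only [List.map_cons, List.reverse_cons, List.map_append, List.cons_append,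
      tail_rev, List.map_nil]
    rw [h1, h.1]

lemma IsSimplePath.reverse {G : DartGraph V D} {u v : V} {l : List D} (h : G.IsSimplePath u l v) :
    G.IsSimplePath v (l.map G.rev).reverse u :=
  ⟨h.1.reverse, by rw [h.1.reverse_vertices, List.nodup_reverse]; exact h.2⟩

lemma along_singleton_comm (d e : D) : G.along [e] d = G.along [d] e := by
  rw [along_singleton, along_singleton]
  have h : (d = G.rev e) ↔ (e = G.rev d) :=
    ⟨fun h => by rw [h, G.rev_rev], fun h => by rw [h, G.rev_rev]⟩
  simp only [h, eq_comm]

/-- The intersection number of two lists of darts is symmetric. -/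
lemma sum_along_comm (l m : List D) : (l.map (G.along m)).sum = (m.map (G.along l)).sum := by
  have h1 : ∀ (m : List D) (e : D), G.along m e = (m.map (G.along [e])).sum := by
    intro m e
    induction m with
    | nil => simp
    | cons d m ih => rw [along_cons, ih, List.map_cons, List.sum_cons, along_singleton_comm]
  induction l with
  | nil =>
    have : m.map (G.along []) = m.map fun _ => 0 := List.map_congr_left fun d _ => by simp
    rw [this]; simp
  | cons e l ih =>
    rw [List.map_cons, List.sum_cons, ih, h1]
    have : m.map (G.along (e :: l)) = m.map fun d => G.along [e] d + G.along l d :=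
      List.map_congr_left fun d _ => G.along_cons e l d
    rw [this, List.sum_map_add]

lemma IsWalk.sum_sub {G : DartGraph V D} {u v : V} {l : List D} (h : G.IsWalk u l v) (y : V → ℝ) :
    (l.map fun d => y (G.tail d) - y (G.head d)).sum = y u - y v := by
  induction l generalizing u with
  | nil => cases h; simp
  | cons d l ih => rw [List.map_cons, List.sum_cons, ih h.2, h.1]; ring

section Flow

variable [Fintype D]

lemma sum_net_univ {f : D → ℝ} (hf : ∀ d, f (G.rev d) = - f d) [Fintype V] :
    ∑ v, G.net f v = 0 := by
  have := G.sum_net hf Set.univ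
  simpa using this

/-- The net flow of a flow with a single source and a single sink. -/
lemma IsFlow.net_eq {G : DartGraph V D} [Finite V] {c f : D → ℝ} {s t : V} (hst : s ≠ t)
    (h : G.IsFlow c {s} {t} f) (y : V) :
    G.net f y = G.value f s * ((if y = t then 1 else 0) - (if y = s then 1 else 0)) := by
  have := Fintype.ofFinite V
  have h0 : ∀ v, v ≠ s → v ≠ t → G.net f v = 0 := fun v hs ht =>
    le_antisymm (not_lt.1 fun h' => ht (h.2.2 v h')) (not_lt.1 fun h' => hs (h.2.1 v h'))
  have h1 := G.sum_net_univ h.1.1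
  rw [← Finset.sum_subset (Finset.subset_univ {s, t})
    (fun v _ hv => by simp only [Finset.mem_insert, Finset.mem_singleton, not_or] at hv
                      exact h0 v hv.1 hv.2), Finset.sum_pair hst] at h1
  by_cases hs : y = s
  · subst hs; simp [value, hst]
  · by_cases ht : y = t
    · subst ht; simp [value, hs]; linarith
    · simp [hs, ht, h0 y hs ht]

lemma IsFlow.value_nonneg {G : DartGraph V D} {c f : D → ℝ} {s t : V} (hst : s ≠ t)
    (h : G.IsFlow c {s} {t} f) : 0 ≤ G.value f s := by
  by_contra h'
  exact hst (h.2.2 s (by simp only [value] at h'; linarith))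

lemma isFlow_of_net {c f : D → ℝ} {s t : V} (hp : G.IsPseudoflow c f) {r : ℝ} (hr : 0 ≤ r)
    (hn : ∀ y, G.net f y = r * ((if y = t then 1 else 0) - (if y = s then 1 else 0))) :
    G.IsFlow c {s} {t} f := by
  refine ⟨hp, fun v hv => ?_, fun v hv => ?_⟩
  · by_contra hs
    rw [hn, if_neg (show v ≠ s from hs)] at hv
    split_ifs at hv <;> linarith
  · by_contra ht
    rw [hn, if_neg (show v ≠ t from ht)] at hv
    split_ifs at hv <;> linarith

lemma value_of_net {f : D → ℝ} {s t : V} (hst : s ≠ t) {r : ℝ}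
    (hn : ∀ y, G.net f y = r * ((if y = t then 1 else 0) - (if y = s then 1 else 0))) :
    G.value f s = r := by
  rw [value, hn]; simp [hst]

/-- A flow can be increased along a residual path. -/
lemma exists_augmented {G : DartGraph V D} [Finite V] {c f : D → ℝ} {s t : V} (hst : s ≠ t)
    (h : G.IsFlow c {s} {t} f) {l : List D} (hl : G.IsSimplePath s l t)
    (hres : ∀ d ∈ l, 0 < c d - f d) : ∃ g, G.IsFlow c {s} {t} g ∧ G.value f s < G.value g s := by
  have hne : l ≠ [] := by rintro rfl; exact hst hl.1
  obtain ⟨e, he, hmin⟩ := Finset.exists_min_image l.toFinset (fun d => c d - f d)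
    (by simpa [List.toFinset_nonempty_iff] using hne)
  simp only [List.mem_toFinset] at he hmin
  have hδ := hres e he
  have hnet : ∀ y, G.net (fun d => f d + (c e - f e) * G.along l d) y =
      (G.value f s + (c e - f e)) * ((if y = t then 1 else 0) - (if y = s then 1 else 0)) := by
    intro y
    rw [net_add, net_smul, h.net_eq hst, G.net_along hl.1]; ring
  refine ⟨fun d => f d + (c e - f e) * G.along l d, G.isFlow_of_net ⟨?_, ?_⟩
    (add_nonneg (h.value_nonneg hst) hδ.le) hnet, ?_⟩
  · intro d; simp only [along_rev, h.1.1 d]; ring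
  · intro d
    by_cases hd : d ∈ l
    · simp only [hl.along_eq_one hd]; linarith [hmin d hd]
    · have := mul_nonpos_of_nonneg_of_nonpos hδ.le (G.along_nonpos hd)
      simp only
      linarith [h.1.2 d]
  · rw [G.value_of_net hst hnet]; linarith

/-- The residual cut of a maximum flow. -/
lemma IsMaxFlow.exists_cut {G : DartGraph V D} [Finite V] {c f : D → ℝ} {s t : V} (hst : s ≠ t)
    (h : G.IsMaxFlow c s t f) : ∃ Y : Set V, s ∈ Y ∧ t ∉ Y ∧
      ∀ d, G.tail d ∈ Y → G.head d ∉ Y → f d = c d := by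
  rcases G.exists_path_or_cut {d | 0 < c d - f d} s t with ⟨l, hl, hres⟩ | ⟨Y, hs, ht, hY⟩
  · obtain ⟨g, hg, hlt⟩ := exists_augmented hst h.1 hl hres
    exact absurd (h.2 g hg) (not_le.2 hlt)
  · refine ⟨Y, hs, ht, fun d h1 h2 => ?_⟩
    by_contra hne
    refine h2 (hY d ?_ h1)
    have := lt_of_le_of_ne (h.1.1.2 d) hne
    simp only [Set.mem_ofPred_eq]; linarith

/-- Without a path in its positive darts, a flow has no positive value. -/
lemma exists_path_of_value_pos [Finite V] {f : D → ℝ} {s t : V} (hst : s ≠ t)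
    (hf : ∀ d, f (G.rev d) = - f d) {r : ℝ} (hr : 0 < r)
    (hn : ∀ y, G.net f y = r * ((if y = t then 1 else 0) - (if y = s then 1 else 0))) :
    ∃ l, G.IsSimplePath s l t ∧ ∀ d ∈ l, 0 < f d := by
  rcases G.exists_path_or_cut {d | 0 < f d} s t with h | ⟨Y, hs, ht, hY⟩
  · exact h
  · exfalso
    have h1 := G.sum_leaving hf hs (fun v hv hvs => by
      have : v ≠ t := fun h => ht (h ▸ hv)
      rw [hn]; simp [hvs, this])
    have h2 : ∑ d with (G.tail d ∈ Y ∧ G.head d ∉ Y), f d ≤ 0 := by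
      refine Finset.sum_nonpos fun d hd => ?_
      simp only [Finset.mem_filter, Finset.mem_univ, true_and] at hd
      by_contra h3
      exact hd.2 (hY d (not_le.1 h3) hd.1)
    rw [hn] at h1
    simp [hst] at h1
    linarith

/-- A maximum flow exists, by compactness of the set of flows. -/
lemma exists_maxFlow [Finite V] {c : D → ℝ} (hc : ∀ d, 0 ≤ c d) (s t : V) :
    ∃ f, G.IsMaxFlow c s t f := by
  let K : Set (D → ℝ) := {f | ((∀ d, f (G.rev d) = - f d) ∧ ∀ d, f d ≤ c d) ∧
    (∀ v, v ≠ s → 0 ≤ G.net f v) ∧ ∀ v, v ≠ t → G.net f v ≤ 0}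
  have hcn : ∀ v, Continuous fun f : D → ℝ => G.net f v := fun v => by
    unfold net; fun_prop
  have hK : IsCompact K := by
    refine IsCompact.of_isClosed_subset
      (isCompact_univ_pi (s := fun d => Set.Icc (- c (G.rev d)) (c d)) fun d => isCompact_Icc) ?_ ?_
    · have hKeq : K = ((⋂ d, {f | f (G.rev d) = - f d}) ∩ ⋂ d, {f | f d ≤ c d}) ∩
          ((⋂ v, ⋂ (_ : v ≠ s), {f | 0 ≤ G.net f v}) ∩
            ⋂ v, ⋂ (_ : v ≠ t), {f | G.net f v ≤ 0}) := by
        ext f; simp [K]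
      rw [hKeq]
      refine ((isClosed_iInter fun d => ?_).inter (isClosed_iInter fun d => ?_)).inter
        ((isClosed_iInter fun v => isClosed_iInter fun _ => ?_).inter
          (isClosed_iInter fun v => isClosed_iInter fun _ => ?_))
      · exact isClosed_eq (continuous_apply _) (continuous_apply d).neg
      · exact isClosed_le (continuous_apply d) continuous_const
      · exact isClosed_le continuous_const (hcn v)
      · exact isClosed_le (hcn v) continuous_const
    · intro f hf d _
      exact ⟨by have := hf.1.2 (G.rev d); rw [hf.1.1] at this; linarith, hf.1.2 d⟩
  obtain ⟨f, hf, hmax⟩ := hK.exists_isMaxOn ⟨0, by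
      refine ⟨⟨by simp, by simpa using hc⟩, ?_, ?_⟩ <;> intro v _ <;> simp [net]⟩
    (f := fun f => G.value f s) (by unfold value; exact (hcn s).neg.continuousOn)
  have hiff : ∀ f, G.IsFlow c {s} {t} f ↔ f ∈ K := by
    intro f
    constructor
    · exact fun h => ⟨h.1, fun v hv => not_lt.1 fun h' => hv (h.2.1 v h'),
        fun v hv => not_lt.1 fun h' => hv (h.2.2 v h')⟩
    · exact fun h => ⟨h.1, fun v h' => by_contra fun hv => not_lt.2 (h.2.1 v hv) h',
        fun v h' => by_contra fun hv => not_lt.2 (h.2.2 v hv) h'⟩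
  exact ⟨f, (hiff f).2 hf, fun g hg => hmax ((hiff g).1 hg)⟩

end Flow

end DartGraph

namespace FacedGraph

variable {V D F : Type*} (G : FacedGraph V D F)

lemma isDualWalk_append {x y : F} {l m : List D} :
    G.IsDualWalk x (l ++ m) y ↔ ∃ z, G.IsDualWalk x l z ∧ G.IsDualWalk z m y := by
  induction l generalizing x with
  | nil => simp [IsDualWalk]
  | cons d l ih =>
    simp only [List.cons_append, IsDualWalk, ih]
    constructor
    · rintro ⟨h, w, h1, h2⟩; exact ⟨w, ⟨h, h1⟩, h2⟩
    · rintro ⟨w, ⟨h, h1⟩, h2⟩; exact ⟨h, w, h1, h2⟩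

lemma isDualWalk_concat {x : F} {l : List D} {d : D} (h : G.IsDualWalk x l (G.left d)) :
    G.IsDualWalk x (l ++ [d]) (G.right d) := G.isDualWalk_append.2 ⟨_, h, rfl, rfl⟩

lemma IsDualWalk.sum_potFlow {G : FacedGraph V D F} {x y : F} {l : List D}
    (h : G.IsDualWalk x l y) (p : F → ℝ) : (l.map (G.potFlow p)).sum = p y - p x := by
  induction l generalizing x with
  | nil => cases h; simp
  | cons d l ih => rw [List.map_cons, List.sum_cons, ih h.2, potFlow, h.1]; ring

/-- A set of faces that contains `o` and is closed under crossing the darts in `P`, from left to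
right, contains every face that can be reached from `o`. Either all faces can be reached, or some
set of faces is separated from `o` by darts outside `P`. -/
lemma exists_dualWalk_or_cut (P : Set D) (o : F) :
    (∀ g, ∃ l, G.IsDualWalk o l g ∧ ∀ d ∈ l, d ∈ P) ∨
    ∃ X : Set F, o ∉ X ∧ X.Nonempty ∧ ∀ d ∈ P, G.right d ∈ X → G.left d ∈ X := by
  by_cases h : ∀ g, ∃ l, G.IsDualWalk o l g ∧ ∀ d ∈ l, d ∈ P
  · exact Or.inl h
  · push Not at h
    obtain ⟨g, hg⟩ := h
    refine Or.inr ⟨{g | ¬ ∃ l, G.IsDualWalk o l g ∧ ∀ d ∈ l, d ∈ P}, ?_, ⟨g, ?_⟩, ?_⟩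
    · exact fun h => h ⟨[], rfl, by simp⟩
    · rintro ⟨l, h1, h2⟩
      obtain ⟨d, hd, hd'⟩ := hg l h1
      exact hd' (h2 d hd)
    · rintro d hd h ⟨l, h1, h2⟩
      refine h ⟨l ++ [d], G.isDualWalk_concat h1, fun e he => ?_⟩
      rcases List.mem_append.1 he with he | he
      · exact h2 e he
      · rw [List.mem_singleton.1 he]; exact hd

lemma exists_dualWalk (hG : ∀ q : F → ℝ, (∀ d, q (G.right d) = q (G.left d)) → ∀ x y, q x = q y)
    (x y : F) : ∃ l, G.IsDualWalk x l y := by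
  rcases G.exists_dualWalk_or_cut Set.univ x with h | ⟨X, hx, ⟨z, hz⟩, h⟩
  · obtain ⟨l, hl, _⟩ := h y; exact ⟨l, hl⟩
  · exfalso
    have := hG (fun g => if g ∈ X then 1 else 0) (fun d => by
      have : G.right d ∈ X ↔ G.left d ∈ X :=
        ⟨h d trivial, fun h' => by simpa using h (G.rev d) trivial (by simpa using h')⟩
      simp only [this]) x z
    simp [hx, hz] at this

section Dist

variable {G} {c : D → ℝ} {o : F}

lemma dualDist_le (hc : ∀ d, 0 ≤ c d) {x y : F} {l : List D} (h : G.IsDualWalk x l y) :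
    G.dualDist c x y ≤ (l.map c).sum := by
  refine csInf_le ⟨0, ?_⟩ ⟨l, h, rfl⟩
  rintro r ⟨l, _, rfl⟩
  exact List.sum_nonneg fun r hr => by obtain ⟨d, _, rfl⟩ := List.mem_map.1 hr; exact hc d

lemma dualDist_self (hc : ∀ d, 0 ≤ c d) : G.dualDist c o o = 0 := by
  refine le_antisymm (by simpa using dualDist_le hc (show G.IsDualWalk o [] o from rfl)) ?_
  refine le_csInf ⟨_, [], rfl, rfl⟩ ?_
  rintro r ⟨l, _, rfl⟩
  exact List.sum_nonneg fun r hr => by obtain ⟨d, _, rfl⟩ := List.mem_map.1 hr; exact hc d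

lemma dualFlow_le (hc : ∀ d, 0 ≤ c d) (hr : ∀ y, ∃ l, G.IsDualWalk o l y) (d : D) :
    G.dualFlow c o d ≤ c d := by
  rw [dualFlow, sub_le_iff_le_add', ← sub_le_iff_le_add]
  obtain ⟨l, hl⟩ := hr (G.left d)
  refine le_csInf ⟨_, l, hl, rfl⟩ ?_
  rintro r ⟨l, hl, rfl⟩
  rw [sub_le_iff_le_add]
  simpa using dualDist_le hc (G.isDualWalk_concat hl)

/-- The distances are the largest potential that respects the capacities. -/
lemma le_dualDist (hr : ∀ y, ∃ l, G.IsDualWalk o l y) {p : F → ℝ} (ho : p o = 0)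
    (hp : ∀ d, G.potFlow p d ≤ c d) (y : F) : p y ≤ G.dualDist c o y := by
  obtain ⟨l, hl⟩ := hr y
  refine le_csInf ⟨_, l, hl, rfl⟩ ?_
  rintro r ⟨l, hl, rfl⟩
  have h1 := hl.sum_potFlow p
  rw [ho, sub_zero] at h1
  rw [← h1]
  exact List.sum_le_sum fun d _ => hp d

lemma dualFlow_eq_potFlow (d : D) : G.dualFlow c o d = G.potFlow (G.dualDist c o) d := rfl

/-- A cycle with a nonnegative potential cannot be residual for the flow given by the distances:
otherwise pushing flow along it would give a larger potential. -/
lemma exists_not_residual (hc : ∀ d, 0 ≤ c d) (hr : ∀ y, ∃ l, G.IsDualWalk o l y) {C : List D}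
    (hC : G.IsSimpleCycle C) {q : F → ℝ} (ho : q o = 0) (hq : ∀ x, 0 ≤ q x)
    (hqC : ∀ d, G.along C d = G.potFlow q d) : ∃ d ∈ C, ¬ 0 < c d - G.dualFlow c o d := by
  by_contra hcon
  push Not at hcon
  obtain ⟨e, he, hmin⟩ := Finset.exists_min_image C.toFinset (fun d => c d - G.dualFlow c o d)
    (by simpa [List.toFinset_nonempty_iff] using hC.1)
  simp only [List.mem_toFinset] at he hmin
  set ε := c e - G.dualFlow c o e with hε
  have hεpos : 0 < ε := hcon e he
  have h1 : ∀ x, q x = 0 := by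
    intro x
    have h2 := le_dualDist (c := c) hr (p := fun x => G.dualDist c o x + ε * q x)
      (by simp only [ho, dualDist_self hc]; ring) (fun d => by
        rw [potFlow_add, potFlow_smul, ← hqC]
        by_cases hd : d ∈ C
        · rw [hC.along_eq_one hd]
          have := hmin d hd
          rw [dualFlow_eq_potFlow] at this; linarith
        · have h3 := mul_nonpos_of_nonneg_of_nonpos hεpos.le (G.along_nonpos hd)
          have h4 := dualFlow_le hc hr d
          rw [dualFlow_eq_potFlow] at h4; linarith) x
    have h3 : ε * q x ≤ 0 := by linarith
    exact le_antisymm (by by_contra h; nlinarith [mul_pos hεpos (not_le.1 h)]) (hq x)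
  have h2 := hqC e
  rw [hC.along_eq_one he, potFlow, h1, h1] at h2
  norm_num at h2

lemma cwAcyclic_sub_dualFlow (hc : ∀ d, 0 ≤ c d) (hr : ∀ y, ∃ l, G.IsDualWalk o l y) :
    G.CwAcyclic o fun d => c d - G.dualFlow c o d := by
  rintro C ⟨hC, q, ho, hq, hqC⟩
  exact exists_not_residual hc hr hC ho hq hqC

end Dist

/-- For a leftmost flow every face can be reached from the infinite face across saturated darts. -/
lemma IsSphere.exists_saturated_walk [Fintype D] [Finite V] [Finite F] {G : FacedGraph V D F}
    (hG : G.IsSphere) {o : F} {c f : D → ℝ} (hfc : ∀ d, f d ≤ c d)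
    (hcw : G.CwAcyclic o fun d => c d - f d) (g : F) :
    ∃ l, G.IsDualWalk o l g ∧ ∀ d ∈ l, f d = c d := by
  rcases G.exists_dualWalk_or_cut {d | f d = c d} o with h | ⟨X, ho, ⟨x, hx⟩, hX⟩
  · exact h g
  · exfalso
    obtain ⟨C, hC, hpos⟩ := hG.exists_clockwiseCycle (o := o)
      (p := fun x => if x ∈ X then 1 else 0) (by simp [ho])
      (fun x => by positivity) ⟨x, by simp [hx]⟩
    obtain ⟨d, hd, hd'⟩ := hcw C hC
    have h1 := hpos d hd
    have h2 : f d = c d := le_antisymm (hfc d) (by linarith)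
    simp only [potFlow] at h1
    have h3 := hX d h2
    by_cases h4 : G.right d ∈ X
    · simp [h4, h3 h4] at h1
    · simp [h4] at h1
      split_ifs at h1 <;> norm_num at h1

/-- A leftmost maximum flow is unique. -/
lemma IsSphere.leftmostMaxFlow_unique [Fintype D] [Finite V] [Finite F] {G : FacedGraph V D F}
    (hG : G.IsSphere) {o : F} {c f g : D → ℝ} {s t : V} (hst : s ≠ t)
    (hf : G.IsLeftmostMaxFlow o c s t f) (hg : G.IsLeftmostMaxFlow o c s t g) : f = g := by
  have hval : G.value f s = G.value g s := le_antisymm (hg.1.2 f hf.1.1) (hf.1.2 g hg.1.1)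
  obtain ⟨p, hpo, hp⟩ := hG.exists_potential_zero o (w := fun d => f d - g d)
    (fun d => by rw [hf.1.1.1.1, hg.1.1.1.1]; ring)
    (fun v => by rw [G.net_sub, hf.1.1.net_eq hst, hg.1.1.net_eq hst, hval, sub_self])
  -- Saturated walks of one flow bound the potential on one side.
  have h1 : ∀ x, p x = 0 := by
    intro x
    obtain ⟨l, hl, hl'⟩ := hG.exists_saturated_walk hf.1.1.1.2 hf.2 x
    obtain ⟨m, hm, hm'⟩ := hG.exists_saturated_walk hg.1.1.1.2 hg.2 x
    have h2 := hl.sum_potFlow p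
    have h3 := hm.sum_potFlow p
    rw [hpo, sub_zero] at h2 h3
    refine le_antisymm ?_ ?_
    · rw [← h3]
      refine (List.sum_le_card_nsmul _ 0 fun r hr => ?_).trans (by simp)
      obtain ⟨d, hd, rfl⟩ := List.mem_map.1 hr
      rw [← hp, hm' d hd]
      linarith [hf.1.1.1.2 d]
    · rw [← h2]
      refine List.sum_nonneg fun r hr => ?_
      obtain ⟨d, hd, rfl⟩ := List.mem_map.1 hr
      rw [← hp, hl' d hd]
      linarith [hg.1.1.1.2 d]
  funext d
  have := hp d
  rw [potFlow, h1, h1] at this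
  linarith

end FacedGraph

end PlanarFlow

end

/-! ### The leftmost path and the leftmost maximum flow -/

noncomputable section

namespace PlanarFlow

open scoped Classical

namespace PlaneGraph

variable {V D F : Type*} {G : PlaneGraph V D F}

/-- Every face can be reached from the infinite face across darts without capacity off the leftmost
path. Otherwise the path can be changed along the boundary of the set of other faces, into a
residual path on its left. -/
lemma exists_zero_walk_off_path [Fintype D] {a b : D} (hst : G.tail a ≠ G.tail b) {c : D → ℝ}
    (hc : ∀ d, 0 ≤ c d) (hcw : G.CwAcyclic (G.right b) c) {L : List D}
    (hL : G.IsLeftmostPath (G.right b) c (G.tail a) (G.tail b) L) (g : F) :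
    ∃ l, G.IsDualWalk (G.right b) l g ∧ ∀ d ∈ l, c d = 0 ∧ d ∉ L ∧ G.rev d ∉ L := by
  have hV := G.finite_vertex
  have hF := G.finite_face
  have hG := G.isSphere
  rcases G.exists_dualWalk_or_cut {d | c d = 0 ∧ d ∉ L ∧ G.rev d ∉ L} (G.right b) with
    h | ⟨X, ho, ⟨y, hy⟩, hX⟩
  · exact h g
  exfalso
  obtain ⟨⟨hLs, hLc⟩, hLmin⟩ := hL
  set χ : F → ℝ := fun x => if x ∈ X then 1 else 0 with hχ
  set x : D → ℝ := fun d => G.along L d + G.potFlow χ d with hx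
  have hxrev : ∀ d, x (G.rev d) = - x d := fun d => by
    simp only [hx, G.along_rev, G.potFlow_rev]; ring
  have hnet : ∀ y, G.net x y =
      1 * ((if y = G.tail b then 1 else 0) - (if y = G.tail a then 1 else 0)) := fun y => by
    simp only [hx]; rw [G.net_add, hG.net_potFlow, G.net_along hLs.1]; ring
  have hstep : ∀ d, G.left d ∉ X → G.right d ∈ X → 0 < c d ∨ d ∈ L ∨ G.rev d ∈ L := by
    intro d h1 h2
    by_contra h3
    push Not at h3
    exact h1 (hX d ⟨le_antisymm h3.1 (hc d), h3.2⟩ h2)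
  have hpos : ∀ d, 0 < x d → 1 ≤ x d ∧ 0 < c d := by
    intro d hd
    simp only [hx, hχ, FacedGraph.potFlow, hLs.along_eq] at hd ⊢
    by_cases h1 : d ∈ L
    · refine ⟨?_, hLc d h1⟩
      have h2 := hLs.rev_notMem h1
      by_cases h3 : G.right d ∈ X <;> by_cases h4 : G.left d ∈ X <;>
        simp [h1, h2, h3, h4] at hd ⊢
    · by_cases h2 : G.rev d ∈ L
      · exfalso
        by_cases h3 : G.right d ∈ X <;> by_cases h4 : G.left d ∈ X <;>
          simp [h1, h2, h3, h4] at hd <;> linarith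
      · by_cases h3 : G.right d ∈ X <;> by_cases h4 : G.left d ∈ X <;>
          simp [h1, h2, h3, h4] at hd ⊢
        · rcases hstep d h4 h3 with h | h | h
          · exact h
          · exact absurd h h1
          · exact absurd h h2
        · linarith
  obtain ⟨A, hA, hApos⟩ := G.exists_path_of_value_pos hst hxrev one_pos hnet
  have hAres : G.IsResidualPath c (G.tail a) (G.tail b) A :=
    ⟨hA, fun d hd => (hpos d (hApos d hd)).2⟩
  -- The rest of the flow consists of residual cycles, none of which is clockwise.
  obtain ⟨p, hpo, hp⟩ := hG.exists_potential_zero (G.right b) (w := fun d => x d - G.along A d)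
    (fun d => by rw [hxrev, G.along_rev]; ring)
    (fun y => by rw [G.net_sub, hnet, G.net_along hA.1]; ring)
  have hple : ∀ z, p z ≤ 0 := by
    by_contra hcon
    push Not at hcon
    obtain ⟨z, hz⟩ := hcon
    -- The positive part of the potential would contain a clockwise cycle.
    obtain ⟨C, hC, hCpos⟩ := hG.exists_clockwiseCycle (o := G.right b)
      (p := fun z => max (p z) 0) (by simp [hpo]) (fun z => le_max_right _ _)
      ⟨z, by simp only [max_eq_left hz.le]; exact hz.ne'⟩
    obtain ⟨d, hd, hd'⟩ := hcw C hC
    have h1 := hCpos d hd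
    simp only [FacedGraph.potFlow] at h1
    have h2 : 0 < G.potFlow p d := by
      rw [FacedGraph.potFlow]
      rcases le_total (p (G.right d)) 0 with h | h
      · rw [max_eq_right h] at h1
        have := le_max_right (p (G.left d)) 0; linarith
      · rw [max_eq_left h] at h1
        have := le_max_left (p (G.left d)) 0; linarith
    rw [← hp] at h2
    refine hd' (hpos d ?_).2
    by_cases hdA : d ∈ A
    · exact hApos d hdA
    · by_cases hdA' : G.rev d ∈ A
      · have h3 := (hpos _ (hApos _ hdA')).1
        have h4 := hA.along_eq_one hdA'
        rw [G.along_rev] at h4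
        rw [hxrev] at h3
        linarith
      · rw [G.along_eq_zero hdA hdA'] at h2; linarith
  have hdiff : ∀ d, G.along A d - G.along L d = G.potFlow (fun z => χ z - p z) d := by
    intro d
    rw [FacedGraph.potFlow_sub, ← hp]; simp only [hx]; ring
  have hχ0 : ∀ z, 0 ≤ χ z := fun z => by simp only [hχ]; positivity
  have hAL : A = L := hLmin A hAres ⟨fun z => χ z - p z, by simp [hχ, ho, hpo],
    fun z => by linarith [hple z, hχ0 z], hdiff⟩
  have h1 := hG.eq_zero_of_potFlow (o := G.right b) (p := fun z => χ z - p z)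
    (by simp [hχ, ho, hpo]) (fun d => by rw [← hdiff, hAL, sub_self]) y
  have h2 : χ y = 1 := by simp [hχ, hy]
  have := hple y
  linarith

/-- The capacities are clockwise-acyclic, `L` is the leftmost residual path, `f` is the leftmost
maximum flow, and `φ` is the potential of the difference between `f` and the flow of the same value
along `L`. -/
structure Setting [Fintype D] (G : PlaneGraph V D F) (a b : D) (c : D → ℝ) (L : List D)
    (f : D → ℝ) (φ : F → ℝ) : Prop where
  ne : G.tail a ≠ G.tail b
  nonneg : ∀ d, 0 ≤ c d
  cwAcyclic : G.CwAcyclic (G.right b) c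
  path : G.IsLeftmostPath (G.right b) c (G.tail a) (G.tail b) L
  flow : G.IsLeftmostMaxFlow (G.right b) c (G.tail a) (G.tail b) f
  potential_zero : φ (G.right b) = 0
  flow_eq : ∀ d, f d = G.value f (G.tail a) * G.along L d + G.potFlow φ d

lemma exists_setting [Fintype D] {a b : D} (hst : G.tail a ≠ G.tail b) {c : D → ℝ}
    (hc : ∀ d, 0 ≤ c d) (hcw : G.CwAcyclic (G.right b) c) {L : List D}
    (hL : G.IsLeftmostPath (G.right b) c (G.tail a) (G.tail b) L) {f : D → ℝ}
    (hf : G.IsLeftmostMaxFlow (G.right b) c (G.tail a) (G.tail b) f) :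
    ∃ φ, Setting G a b c L f φ := by
  have hV := G.finite_vertex
  have hF := G.finite_face
  obtain ⟨φ, h0, hφ⟩ := G.isSphere.exists_potential_zero (G.right b)
    (w := fun d => f d - G.value f (G.tail a) * G.along L d)
    (fun d => by rw [hf.1.1.1.1, G.along_rev]; ring)
    (fun y => by rw [G.net_sub, G.net_smul, hf.1.1.net_eq hst, G.net_along hL.1.1.1]; ring)
  exact ⟨φ, hst, hc, hcw, hL, hf, h0, fun d => by rw [← hφ]; ring⟩

namespace Setting

variable [Fintype D] {a b : D} {c : D → ℝ} {L : List D} {f : D → ℝ} {φ : F → ℝ}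

lemma antisymm (S : Setting G a b c L f φ) (d : D) : f (G.rev d) = - f d := S.flow.1.1.1.1 d

lemma le (S : Setting G a b c L f φ) (d : D) : f d ≤ c d := S.flow.1.1.1.2 d

lemma net_eq (S : Setting G a b c L f φ) (y : V) : G.net f y = G.value f (G.tail a) *
    ((if y = G.tail b then 1 else 0) - (if y = G.tail a then 1 else 0)) := by
  have hV := G.finite_vertex
  exact S.flow.1.1.net_eq S.ne y

lemma simple (S : Setting G a b c L f φ) : G.IsSimplePath (G.tail a) L (G.tail b) := S.path.1.1

lemma value_pos (S : Setting G a b c L f φ) : 0 < G.value f (G.tail a) := by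
  have hV := G.finite_vertex
  have h0 : G.IsFlow c {G.tail a} {G.tail b} fun _ => 0 :=
    ⟨⟨by simp, S.nonneg⟩, by simp [G.net_zero], by simp [G.net_zero]⟩
  obtain ⟨g, hg, hlt⟩ := DartGraph.exists_augmented S.ne h0 S.simple
    (fun d hd => by simpa using S.path.1.2 d hd)
  refine lt_of_lt_of_le ?_ (S.flow.1.2 g hg)
  simpa [DartGraph.value, G.net_zero] using hlt

lemma value_le_sum (S : Setting G a b c L f φ) : G.value f (G.tail a) ≤ ∑ d, c d := by
  rw [DartGraph.value, G.net_eq_neg_sum_tail S.antisymm, neg_neg]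
  refine (Finset.sum_le_sum fun d _ => S.le d).trans ?_
  exact Finset.sum_le_sum_of_subset_of_nonneg (Finset.filter_subset _ _) fun d _ _ => S.nonneg d

lemma exists_saturated_walk (S : Setting G a b c L f φ) (g : F) :
    ∃ l, G.IsDualWalk (G.right b) l g ∧ ∀ d ∈ l, f d = c d := by
  have hV := G.finite_vertex
  have hF := G.finite_face
  exact G.isSphere.exists_saturated_walk S.le S.flow.2 g

lemma exists_zero_walk (S : Setting G a b c L f φ) (g : F) :
    ∃ l, G.IsDualWalk (G.right b) l g ∧ ∀ d ∈ l, c d = 0 ∧ d ∉ L ∧ G.rev d ∉ L :=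
  exists_zero_walk_off_path S.ne S.nonneg S.cwAcyclic S.path g

/-- The flow has no flow cycles: the potential of one would be nonnegative, by the saturated walks
from the infinite face, but clockwise cycles have no capacity. -/
lemma acyclic (S : Setting G a b c L f φ) (C : List D) (hC : G.IsSimpleCycle C) :
    ¬ ∀ d ∈ C, 0 < f d := by
  intro hpos
  have hV := G.finite_vertex
  have hF := G.finite_face
  obtain ⟨q, hqo, hq⟩ := G.isSphere.exists_potential_zero (G.right b) (G.along_rev C) hC.net
  have hq0 : ∀ x, 0 ≤ q x := by
    intro x
    obtain ⟨l, hl, hl'⟩ := S.exists_saturated_walk x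
    have h1 := hl.sum_potFlow q
    rw [hqo, sub_zero] at h1
    rw [← h1]
    refine List.sum_nonneg fun r hr => ?_
    obtain ⟨d, hd, rfl⟩ := List.mem_map.1 hr
    rw [← hq]
    have h2 : G.rev d ∉ C := fun h => by
      have h3 := hpos _ h
      rw [S.antisymm, hl' d hd] at h3
      linarith [S.nonneg d]
    have h3 := G.along_nonpos h2
    rw [G.along_rev] at h3; linarith
  obtain ⟨d, hd, hd'⟩ := S.cwAcyclic C ⟨hC, q, hqo, hq0, hq⟩
  exact hd' ((hpos d hd).trans_le (S.le d))

lemma potential_nonpos (S : Setting G a b c L f φ) (g : F) : φ g ≤ 0 := by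
  obtain ⟨l, hl, hl'⟩ := S.exists_zero_walk g
  have h1 := hl.sum_potFlow φ
  rw [S.potential_zero, sub_zero] at h1
  rw [← h1]
  refine (List.sum_le_card_nsmul _ 0 fun r hr => ?_).trans (by simp)
  obtain ⟨d, hd, rfl⟩ := List.mem_map.1 hr
  have h2 := S.flow_eq d
  have h3 := hl' d hd
  rw [G.along_eq_zero h3.2.1 h3.2.2] at h2
  have := S.le d
  linarith [h3.1]

lemma path_acyclic (S : Setting G a b c L f φ) {r : ℝ} (hr : 0 ≤ r) (C : List D)
    (hC : G.IsSimpleCycle C) : ¬ ∀ d ∈ C, 0 < r * G.along L d := fun h =>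
  S.simple.not_cycle hC fun d hd => G.mem_of_along_pos (pos_of_mul_pos_right (h d hd) hr)

lemma le_potential (S : Setting G a b c L f φ) (g : F) :
    - (2 * G.facesBetween (G.tail a) (G.tail b) * G.value f (G.tail a)) ≤ φ g := by
  have h1 := G.abs_potential_sub_le (u := G.tail a) (v := G.tail b) (x₁ := f)
    (x₂ := fun d => G.value f (G.tail a) * G.along L d) (r := G.value f (G.tail a))
    S.antisymm (fun d => by rw [G.along_rev]; ring) S.net_eq
    (fun y => by rw [G.net_smul, G.net_along S.simple.1]) S.acyclic
    (S.path_acyclic S.value_pos.le) (ψ := φ) (fun d => by rw [S.flow_eq d]; ring) g (G.right b)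
  rw [S.potential_zero, sub_zero, abs_of_pos S.value_pos] at h1
  exact (abs_le.1 h1).1

/-- The potential of the difference of a flow path and the leftmost path. -/
lemma path_potential (S : Setting G a b c L f φ) {P : List D}
    (hP : G.IsSimplePath (G.tail a) P (G.tail b)) (hpos : ∀ d ∈ P, 0 < f d) {ψ : F → ℝ}
    (h0 : ψ (G.right b) = 0) (hψ : ∀ d, G.along P d - G.along L d = G.potFlow ψ d) (g : F) :
    - (2 * G.facesBetween (G.tail a) (G.tail b)) ≤ ψ g ∧ ψ g ≤ 0 := by
  constructor
  · have h1 := G.abs_potential_sub_le (u := G.tail a) (v := G.tail b) (x₁ := G.along P)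
      (x₂ := G.along L) (r := 1) (G.along_rev P) (G.along_rev L)
      (fun y => by rw [G.net_along hP.1]; ring) (fun y => by rw [G.net_along S.simple.1]; ring)
      (fun C hC h => hP.not_cycle hC fun d hd => G.mem_of_along_pos (h d hd))
      (fun C hC h => S.simple.not_cycle hC fun d hd => G.mem_of_along_pos (h d hd))
      hψ g (G.right b)
    rw [h0, sub_zero, abs_one, mul_one] at h1
    exact (abs_le.1 h1).1
  · obtain ⟨l, hl, hl'⟩ := S.exists_zero_walk g
    have h1 := hl.sum_potFlow ψ
    rw [h0, sub_zero] at h1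
    rw [← h1]
    refine (List.sum_le_card_nsmul _ 0 fun r hr => ?_).trans (by simp)
    obtain ⟨d, hd, rfl⟩ := List.mem_map.1 hr
    have h3 := hl' d hd
    rw [← hψ, G.along_eq_zero h3.2.1 h3.2.2, sub_zero]
    refine G.along_nonpos fun h => ?_
    have := hpos d h
    have := S.le d
    linarith [h3.1]

end Setting

/-- The number of times that the dual of a dart crosses `L` from left to right. -/
def cross (G : PlaneGraph V D F) (L : List D) (d : D) : ℤ :=
  (if d ∈ L then 1 else 0) - (if G.rev d ∈ L then 1 else 0)

/-- The number of times that a dual walk crosses `L` from left to right. -/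
def winding (G : PlaneGraph V D F) (L l : List D) : ℤ := (l.map (G.cross L)).sum

lemma winding_append (L l m : List D) :
    G.winding L (l ++ m) = G.winding L l + G.winding L m := by
  simp [winding]

lemma cast_winding {u v : V} {L : List D} (hL : G.IsSimplePath u L v) (l : List D) :
    (G.winding L l : ℝ) = (l.map (G.along L)).sum := by
  induction l with
  | nil => simp [winding]
  | cons d l ih =>
    have : G.winding L (d :: l) = G.cross L d + G.winding L l := by simp [winding]
    rw [this, List.map_cons, List.sum_cons, ← ih, hL.along_eq, Int.cast_add, cross]
    push_cast; rfl

namespace Setting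

variable [Fintype D] {a b : D} {c : D → ℝ} {L : List D} {f : D → ℝ} {φ : F → ℝ}

/-- The flow across a dual walk. -/
lemma sum_flow (S : Setting G a b c L f φ) {x y : F} {l : List D} (hl : G.IsDualWalk x l y) :
    (l.map f).sum = G.value f (G.tail a) * G.winding L l + (φ y - φ x) := by
  rw [cast_winding S.simple, ← hl.sum_potFlow φ, ← List.sum_map_mul_left, ← List.sum_map_add]
  exact congrArg List.sum (List.map_congr_left fun d _ => S.flow_eq d)

lemma sum_flow_nonneg (S : Setting G a b c L f φ) {l : List D} (hl' : ∀ d ∈ l, f d = c d) :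
    0 ≤ (l.map f).sum := by
  refine List.sum_nonneg fun r hr => ?_
  obtain ⟨d, hd, rfl⟩ := List.mem_map.1 hr
  rw [hl' d hd]; exact S.nonneg d

lemma winding_nonneg (S : Setting G a b c L f φ) {g : F} {l : List D}
    (hl : G.IsDualWalk (G.right b) l g) (hl' : ∀ d ∈ l, f d = c d) : 0 ≤ G.winding L l := by
  have h1 := S.sum_flow hl
  have h2 := S.sum_flow_nonneg hl'
  rw [S.potential_zero, sub_zero] at h1
  have h3 := S.potential_nonpos g
  have h4 : (0 : ℝ) ≤ G.winding L l := by
    by_contra h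
    have := mul_neg_of_pos_of_neg S.value_pos (not_le.1 h)
    linarith
  exact_mod_cast h4

/-- Every face can be reached from the infinite face by a saturated walk of small winding number.
The least winding numbers form a potential; together with `L` it gives a unit flow along residual
darts, from the sink to the source, which is acyclic because the potential is the largest one. -/
lemma exists_saturated_walk_winding_le (S : Setting G a b c L f φ) (g : F) :
    ∃ l, G.IsDualWalk (G.right b) l g ∧ (∀ d ∈ l, f d = c d) ∧
      G.winding L l ≤ 2 * G.facesBetween (G.tail a) (G.tail b) := by
  have hV := G.finite_vertex
  have hF := G.finite_face
  have hex : ∀ g, ∃ n : ℕ, ∃ l, G.IsDualWalk (G.right b) l g ∧ (∀ d ∈ l, f d = c d) ∧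
      G.winding L l = n := by
    intro g
    obtain ⟨l, hl, hl'⟩ := S.exists_saturated_walk g
    exact ⟨(G.winding L l).toNat, l, hl, hl', (Int.toNat_of_nonneg (S.winding_nonneg hl hl')).symm⟩
  set θ : F → ℕ := fun g => Nat.find (hex g) with hθ
  have hθmem : ∀ g, ∃ l, G.IsDualWalk (G.right b) l g ∧ (∀ d ∈ l, f d = c d) ∧
      G.winding L l = θ g := fun g => Nat.find_spec (hex g)
  have hθle : ∀ g l, G.IsDualWalk (G.right b) l g → (∀ d ∈ l, f d = c d) →
      (θ g : ℤ) ≤ G.winding L l := by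
    intro g l hl hl'
    have h1 := S.winding_nonneg hl hl'
    have h2 : θ g ≤ (G.winding L l).toNat :=
      Nat.find_min' (hex g) ⟨l, hl, hl', (Int.toNat_of_nonneg h1).symm⟩
    omega
  have hθ0 : θ (G.right b) = 0 := by
    have := hθle (G.right b) [] rfl (by simp)
    simp only [winding, List.map_nil, List.sum_nil] at this
    omega
  have hθstep : ∀ d, f d = c d → (θ (G.right d) : ℤ) - θ (G.left d) ≤ G.cross L d := by
    intro d hd
    obtain ⟨l, hl, hl', hw⟩ := hθmem (G.left d)
    have h1 := hθle (G.right d) (l ++ [d]) (G.isDualWalk_concat hl) (by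
      intro e he
      rcases List.mem_append.1 he with he | he
      · exact hl' e he
      · rw [List.mem_singleton.1 he]; exact hd)
    rw [winding_append, hw] at h1
    simp only [winding, List.map_cons, List.map_nil, List.sum_cons, List.sum_nil] at h1
    omega
  have hcr : ∀ d, (G.cross L d : ℝ) = G.along L d := fun d => by
    rw [S.simple.along_eq, cross]; push_cast; rfl
  -- The unit flow from the sink to the source.
  set x : D → ℝ := fun d => G.potFlow (fun z => (θ z : ℝ)) d - G.along L d with hx
  have hxint : ∀ d, x d = (((θ (G.right d) : ℤ) - θ (G.left d) - G.cross L d : ℤ) : ℝ) := by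
    intro d; simp only [hx, FacedGraph.potFlow]; push_cast; rw [hcr]
  have hxrev : ∀ d, x (G.rev d) = - x d := fun d => by
    simp only [hx, G.along_rev, G.potFlow_rev]; ring
  have hac : ∀ C, G.IsSimpleCycle C → ¬ ∀ d ∈ C, 0 < x d := by
    intro C hC hpos
    obtain ⟨q, hqo, hq⟩ := G.isSphere.exists_potential_zero (G.right b) (G.along_rev C) hC.net
    have hsat : ∀ d ∈ C, f d ≠ c d := by
      intro d hd h
      have h1 := hθstep d h
      have h2 := hpos d hd
      rw [hxint] at h2
      have h3 : 0 < (θ (G.right d) : ℤ) - θ (G.left d) - G.cross L d := by exact_mod_cast h2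
      omega
    have hq0 : ∀ z, 0 ≤ q z := by
      intro z
      obtain ⟨l, hl, hl', hw⟩ := hθmem z
      have h1 := hl.sum_potFlow (fun z => (θ z : ℝ) - q z)
      have h2 : (l.map (G.potFlow fun z => (θ z : ℝ) - q z)).sum ≤ (l.map (G.along L)).sum := by
        refine List.sum_le_sum fun d hd => ?_
        rw [FacedGraph.potFlow_sub, ← hq]
        have h3 := hθstep d (hl' d hd)
        have h4 : G.potFlow (fun z => (θ z : ℝ)) d ≤ G.along L d := by
          rw [← hcr]; simp only [FacedGraph.potFlow]; exact_mod_cast h3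
        by_cases h5 : G.rev d ∈ C
        · have h6 := hC.along_eq_one h5
          rw [G.along_rev] at h6
          have h7 := hpos _ h5
          rw [hxrev, hxint, ← Int.cast_neg] at h7
          have h8 : (0 : ℤ) < -((θ (G.right d) : ℤ) - θ (G.left d) - G.cross L d) := by
            exact_mod_cast h7
          have h9 : (θ (G.right d) : ℤ) - θ (G.left d) + 1 ≤ G.cross L d := by omega
          have h10 : G.potFlow (fun z => (θ z : ℝ)) d + 1 ≤ G.along L d := by
            rw [← hcr]; simp only [FacedGraph.potFlow]; exact_mod_cast h9
          linarith
        · rw [G.along_eq_zero (fun h => hsat d h (hl' d hd)) h5]; linarith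
      rw [h1, ← cast_winding S.simple, hw, hqo, hθ0] at h2
      push_cast at h2
      linarith
    obtain ⟨d, hd, hd'⟩ := S.flow.2 C ⟨hC, q, hqo, hq0, hq⟩
    exact hsat d hd (le_antisymm (S.le d) (by linarith))
  have hrevL := S.simple.reverse
  have halong : ∀ d, G.along (L.map G.rev).reverse d = - G.along L d := by
    intro d
    rw [hrevL.along_eq, S.simple.along_eq]
    have h1 : ∀ d, d ∈ (L.map G.rev).reverse ↔ G.rev d ∈ L := fun d => by
      simp only [List.mem_reverse, List.mem_map]
      exact ⟨by rintro ⟨e, he, rfl⟩; rwa [G.rev_rev], fun h => ⟨_, h, G.rev_rev d⟩⟩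
    simp only [h1, G.rev_rev]; ring
  have hbound := G.abs_potential_sub_le (u := G.tail a) (v := G.tail b) (x₁ := x)
    (x₂ := G.along (L.map G.rev).reverse) (r := -1) hxrev (G.along_rev _)
    (fun y => by
      simp only [hx]; rw [G.net_sub, G.isSphere.net_potFlow, G.net_along S.simple.1]; ring)
    (fun y => by rw [G.net_along hrevL.1]; ring) hac
    (fun C hC h => hrevL.not_cycle hC fun d hd => G.mem_of_along_pos (h d hd))
    (ψ := fun z => (θ z : ℝ)) (fun d => by rw [halong]; simp only [hx]; ring) g (G.right b)
  obtain ⟨l, hl, hl', hw⟩ := hθmem g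
  refine ⟨l, hl, hl', ?_⟩
  rw [hθ0, abs_neg, abs_one, mul_one, Nat.cast_zero, sub_zero, abs_of_nonneg (Nat.cast_nonneg _)]
    at hbound
  rw [hw]
  exact_mod_cast hbound

/-- The minimum cut contains a saturated dual cycle of winding number one. Its intersection number
with paths defines a potential of the vertices. -/
lemma exists_saturated_cycle (S : Setting G a b c L f φ) :
    ∃ (Z : List D) (y : V → ℝ), (∃ x, G.IsDualWalk x Z x) ∧ (∀ d ∈ Z, f d = c d) ∧
      G.winding L Z = 1 ∧ (∀ d, G.along Z d = y (G.tail d) - y (G.head d)) ∧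
      y (G.tail a) - y (G.tail b) = 1 := by
  have hV := G.finite_vertex
  have hF := G.finite_face
  obtain ⟨Y, hs, ht, hY⟩ := DartGraph.IsMaxFlow.exists_cut S.ne S.flow.1
  have hD := G.dual_isSphere
  set χ : V → ℝ := fun v => if v ∈ Y then 1 else 0 with hχ
  obtain ⟨Cs, h1, h2⟩ := G.dual.exists_cycle_decomposition (G.dual.potFlow_rev χ)
    (hD.net_potFlow χ)
  have hdual : ∀ (p : V → ℝ) d, G.dual.potFlow p d = p (G.tail d) - p (G.head d) := fun p d => rfl
  have htotal : (L.map fun d => G.dual.potFlow χ d).sum = 1 := by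
    have := S.simple.1.sum_sub χ
    simp only [hdual]
    rw [this]; simp [hχ, hs, ht]
  have hswap : (L.map fun d => G.dual.potFlow χ d).sum =
      (Cs.map fun C => C.1 * (L.map (G.along C.2)).sum).sum := by
    have : (L.map fun d => G.dual.potFlow χ d) =
        L.map fun d => (Cs.map fun C => C.1 * G.along C.2 d).sum :=
      List.map_congr_left fun d _ => h2 d
    rw [this]
    clear h1 h2 this
    induction Cs with
    | nil => simp
    | cons C Cs ih =>
      simp only [List.map_cons, List.sum_cons]
      rw [← ih, List.sum_map_add, List.sum_map_mul_left]
  have hexZ : ∃ C ∈ Cs, 0 < (L.map (G.along C.2)).sum := by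
    by_contra hcon
    push Not at hcon
    have h3 : (Cs.map fun C => C.1 * (L.map (G.along C.2)).sum).sum ≤ 0 := by
      refine (List.sum_le_card_nsmul _ 0 fun r hr => ?_).trans (by simp)
      obtain ⟨C, hC, rfl⟩ := List.mem_map.1 hr
      exact mul_nonpos_of_nonneg_of_nonpos (h1 C hC).1.le (hcon C hC)
    linarith
  obtain ⟨⟨δ, Z⟩, hZ, hZpos⟩ := hexZ
  obtain ⟨-, hZc, hZY⟩ := h1 _ hZ
  simp only at hZpos hZc hZY
  obtain ⟨y, hy⟩ := hD.exists_potential (G.dual.along_rev Z) hZc.net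
  obtain ⟨α, hα⟩ := hD.jordan hZc hy
  have hy' : ∀ d, G.along Z d = y (G.tail d) - y (G.head d) := hy
  have h3 : (L.map (G.along Z)).sum = y (G.tail a) - y (G.tail b) := by
    rw [← S.simple.1.sum_sub y]
    exact congrArg List.sum (List.map_congr_left fun d _ => hy' d)
  have h4 : y (G.tail a) - y (G.tail b) = 1 := by
    rw [h3] at hZpos
    rcases hα (G.tail a) with h | h <;> rcases hα (G.tail b) with h' | h' <;> linarith
  obtain ⟨x, hx⟩ := hZc.2.1
  refine ⟨Z, y, ⟨x, (G.dual_isWalk _ _ _).1 hx⟩, ?_, ?_, hy', h4⟩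
  · intro d hd
    have h5 := hZY d hd
    rw [hdual] at h5
    simp only [hχ] at h5
    refine hY d ?_ ?_
    · by_contra h6
      simp only [h6, if_false] at h5
      split_ifs at h5 <;> norm_num at h5
    · intro h6
      simp only [h6, if_true] at h5
      split_ifs at h5 <;> norm_num at h5
  · have h5 := cast_winding S.simple Z
    rw [G.sum_along_comm, h3, h4] at h5
    exact_mod_cast h5

/-- The face at the source can be reached from the infinite face by saturated walks of every large
winding number: such a walk meets the cycle in the minimum cut, which can be traversed repeatedly.
-/
lemma exists_saturated_walk_winding_eq (S : Setting G a b c L f φ) {w : ℤ}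
    (hw : 2 * G.facesBetween (G.tail a) (G.tail b) ≤ w) :
    ∃ l, G.IsDualWalk (G.right b) l (G.right a) ∧ (∀ d ∈ l, f d = c d) ∧ G.winding L l = w := by
  obtain ⟨Z, y, ⟨x, hx⟩, hZ, hZw, hy, hst⟩ := S.exists_saturated_cycle
  obtain ⟨l, hl, hl', hlw⟩ := S.exists_saturated_walk_winding_le (G.right a)
  -- A face that is not on the cycle has one potential at all its vertices.
  have hright : ∀ d ∈ Z, ∃ e ∈ Z, G.left e = G.right d := by
    intro d hd
    obtain ⟨z1, z2, rfl⟩ := List.append_of_mem hd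
    rw [G.isDualWalk_append] at hx
    obtain ⟨z, h1, h2⟩ := hx
    cases z2 with
    | cons e z2 => exact ⟨e, by simp, h2.2.1⟩
    | nil =>
      have h3 : G.right d = x := h2.2
      cases z1 with
      | nil => exact ⟨d, by simp, by rw [h2.1, h3]; exact h1.symm⟩
      | cons e z1 => exact ⟨e, by simp, by rw [h3]; exact h1.1⟩
  have hoff : ∀ z, (∀ d ∈ Z, G.left d ≠ z) → ∀ d, G.right d = z →
      y (G.tail d) = y (G.head d) := by
    intro z hz d hd
    have h1 : G.along Z d = 0 := by
      refine G.along_eq_zero (fun h => ?_) (fun h => ?_)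
      · obtain ⟨e, he, he'⟩ := hright d h
        exact hz e he (he'.trans hd)
      · exact hz _ h (by rw [G.left_rev, hd])
    rw [hy] at h1; linarith
  have hface : ∀ z, (∀ d ∈ Z, G.left d ≠ z) → ∀ d e, G.right d = z → G.right e = z →
      y (G.tail d) = y (G.tail e) := by
    intro z hz d e hd he
    obtain ⟨j, -, rfl⟩ := ((G.right_eq_iff d e).1 (hd.trans he.symm)).exists_pow_eq'
    change y (G.tail d) = y (G.tail ((G.faceNext ^ j) d))
    have hpow : ∀ j : ℕ, G.right ((G.faceNext ^ j) d) = z := by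
      intro j
      induction j with
      | zero => exact hd
      | succ j ih => rw [pow_succ', Equiv.Perm.mul_apply, G.right_faceNext, ih]
    clear he
    induction j with
    | zero => rfl
    | succ j ih =>
      rw [ih, pow_succ', Equiv.Perm.mul_apply, G.tail_faceNext]
      exact hoff z hz _ (hpow j)
  have hmeet : ∀ (l : List D) (z z' : F), G.IsDualWalk z l z' →
      (∃ l1 l2 g, l = l1 ++ l2 ∧ G.IsDualWalk z l1 g ∧ G.IsDualWalk g l2 z' ∧
        ∃ d ∈ Z, G.left d = g) ∨
      ∀ d e, G.right d = z → G.right e = z' → y (G.tail d) = y (G.tail e) := by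
    intro l
    induction l with
    | nil =>
      intro z z' h
      cases h
      by_cases hz : ∃ d ∈ Z, G.left d = z
      · exact Or.inl ⟨[], [], z, rfl, rfl, rfl, hz⟩
      · push Not at hz
        exact Or.inr (hface z hz)
    | cons x l ih =>
      intro z z' h
      by_cases hz : ∃ d ∈ Z, G.left d = z
      · exact Or.inl ⟨[], x :: l, z, rfl, rfl, h, hz⟩
      · push Not at hz
        rcases ih _ _ h.2 with ⟨l1, l2, g, rfl, h1, h2, h3⟩ | h4
        · exact Or.inl ⟨x :: l1, l2, g, rfl, ⟨h.1, h1⟩, h2, h3⟩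
        · refine Or.inr fun d e hd he => ?_
          rw [hface z hz d (G.rev x) hd (by rw [G.right_rev]; exact h.1), ← h4 x e rfl he,
            hoff z hz (G.rev x) (by rw [G.right_rev]; exact h.1), G.head_rev]
  rcases hmeet l _ _ hl with ⟨l1, l2, g, rfl, h1, h2, d, hd, hdg⟩ | h
  · obtain ⟨z1, z2, rfl⟩ := List.append_of_mem hd
    -- The cycle, traversed from the common face.
    have hloop : G.IsDualWalk g (d :: z2 ++ z1) g := by
      rw [G.isDualWalk_append] at hx
      obtain ⟨z, h3, h4⟩ := hx
      have hz : z = g := h4.1.symm.trans hdg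
      rw [hz] at h3 h4
      exact G.isDualWalk_append.2 ⟨x, h4, h3⟩
    have hloops : ∀ m : ℕ, ∃ l, G.IsDualWalk g l g ∧ (∀ d ∈ l, f d = c d) ∧
        G.winding L l = m := by
      intro m
      induction m with
      | zero => exact ⟨[], rfl, by simp, by simp [winding]⟩
      | succ m ih =>
        obtain ⟨l, h3, h4, h5⟩ := ih
        refine ⟨l ++ (d :: z2 ++ z1), G.isDualWalk_append.2 ⟨g, h3, hloop⟩, ?_, ?_⟩
        · intro e he
          rcases List.mem_append.1 he with he | he
          · exact h4 e he
          · exact hZ e (by simp at he ⊢; tauto)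
        · rw [winding_append, h5, winding_append]
          rw [winding_append] at hZw
          push_cast; omega
    rw [winding_append] at hlw
    obtain ⟨m, h3, h4, h5⟩ := hloops (w - (G.winding L l1 + G.winding L l2)).toNat
    refine ⟨l1 ++ (m ++ l2), G.isDualWalk_append.2 ⟨g, h1, G.isDualWalk_append.2 ⟨g, h3, h2⟩⟩,
      ?_, ?_⟩
    · intro e he
      simp only [List.mem_append] at he
      rcases he with he | he | he
      · exact hl' e (by simp [he])
      · exact h4 e he
      · exact hl' e (by simp [he])
    · rw [winding_append, winding_append, h5, Int.toNat_of_nonneg (by omega)]; omega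
  · have := h b a rfl rfl
    linarith

end Setting

end PlaneGraph

end PlanarFlow

end

/-! ### The sides of the path at its vertices -/

noncomputable section

namespace PlanarFlow

open scoped Classical

namespace DartGraph

variable {V D : Type*} {G : DartGraph V D}

lemma IsSimplePath.head_inj {u v : V} {l : List D}
    (h : G.IsSimplePath u l v) {d e : D} (hd : d ∈ l) (he : e ∈ l) (hde : G.head d = G.head e) :
    d = e := by
  have hmem : ∀ d ∈ l, G.rev d ∈ (l.map G.rev).reverse := fun d hd => by
    simpa using ⟨d, hd, rfl⟩
  exact G.rev_injective (h.reverse.tail_inj (hmem d hd) (hmem e he) hde)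

end DartGraph

namespace PlaneGraph

variable {V D F : Type*} {G : PlaneGraph V D F}

lemma Between.tail_eq {x y d : D} (h : G.Between x y d) : G.tail d = G.tail x := by
  obtain ⟨m, rfl, -⟩ := h
  have : ∀ n : ℕ, G.tail ((G.rot ^ n) x) = G.tail x := by
    intro n
    induction n with
    | zero => rfl
    | succ n ih => rw [pow_succ', Equiv.Perm.mul_apply, G.tail_rot, ih]
  exact this _

lemma between_rot (x y z : D) :
    G.Between x y (G.rot z) ↔ (z = x ∨ G.Between x y z) ∧ G.rot z ≠ y := by
  constructor
  · rintro ⟨m, h, hm⟩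
    refine ⟨?_, fun h' => hm m le_rfl (h ▸ h')⟩
    rw [pow_succ', Equiv.Perm.mul_apply] at h
    have hz := G.rot.injective h
    cases m with
    | zero => exact Or.inl hz
    | succ m => exact Or.inr ⟨m, hz, fun j hj => hm j (by omega)⟩
  · rintro ⟨h | ⟨m, h, hm⟩, hy⟩
    · subst h
      refine ⟨0, by simp, fun j hj => ?_⟩
      obtain rfl : j = 0 := by omega
      simpa using hy
    · have h1 : G.rot z = (G.rot ^ (m + 1 + 1)) x := by
        rw [pow_succ', Equiv.Perm.mul_apply, ← h]
      refine ⟨m + 1, h1, fun j hj => ?_⟩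
      rcases Nat.lt_or_ge j (m + 1) with h2 | h2
      · exact hm j (by omega)
      · obtain rfl : j = m + 1 := by omega
        rw [← h1]; exact hy

lemma not_between_right (x y : D) : ¬ G.Between x y y := by
  rintro ⟨m, h, hm⟩
  exact hm m le_rfl h.symm

section Finite

variable [Finite D]

lemma exists_first_pow {x y : D} (h : G.tail x = G.tail y) :
    ∃ m : ℕ, (G.rot ^ (m + 1)) x = y ∧ ∀ j < m, (G.rot ^ (j + 1)) x ≠ y := by
  have hex : ∃ j : ℕ, (G.rot ^ (j + 1)) x = y := by
    obtain ⟨j, hj, -, h⟩ := ((G.tail_eq_iff x y).1 h).exists_pow_eq''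
    exact ⟨j - 1, by rw [Nat.sub_add_cancel (by omega)]; exact h⟩
  exact ⟨Nat.find hex, Nat.find_spec hex, fun j hj => Nat.find_min hex hj⟩

lemma not_between_left {x y : D} (h : G.tail x = G.tail y) : ¬ G.Between x y x := by
  rintro ⟨m, h1, hm⟩
  obtain ⟨n, hn, hmin⟩ := exists_first_pow h
  rcases Nat.lt_or_ge m n with h2 | h2
  · refine hmin (n - m - 1) (by omega) ?_
    rw [show n + 1 = (n - m - 1 + 1) + (m + 1) by omega, pow_add, Equiv.Perm.mul_apply, ← h1] at hn
    exact hn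
  · exact hm n h2 hn

lemma between_of_rot_eq {x y z : D} (h : G.tail x = G.tail y) (hz : G.rot z = y) :
    z = x ∨ G.Between x y z := by
  obtain ⟨n, hn, hmin⟩ := exists_first_pow h
  rw [pow_succ', Equiv.Perm.mul_apply] at hn
  have h1 : z = (G.rot ^ n) x := G.rot.injective (hz.trans hn.symm)
  cases n with
  | zero => exact Or.inl h1
  | succ n => exact Or.inr ⟨n, h1, fun j hj => hmin j (by omega)⟩

end Finite

/-- The number of lifts of `L` by which the tail of a dart is shifted in the cover: one if the dart
leaves `L` on its left, zero otherwise. -/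
def shift (G : PlaneGraph V D F) (a b : D) (L : List D) (d : D) : ℕ :=
  if G.Shifted a b L d then 1 else 0

/-- At a vertex of the path, the darts on the left are the ones between a dart `X` (the reverse of
the preceding dart of the path, or `a` at its start) and a dart `Y` (the following dart of the path,
or `rot b` at its end). -/
lemma exists_left_sector {a b : D} (hst : G.tail a ≠ G.tail b) {L : List D} [Finite D]
    (hL : G.IsSimplePath (G.tail a) L (G.tail b)) {v : V} (hv : G.OnPath a b L v) :
    ∃ X Y, G.tail X = v ∧ G.tail Y = v ∧
      (∀ z, G.tail z = v → (G.Shifted a b L z ↔ G.Between X Y z)) ∧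
      (∀ z, G.tail z = v → ((G.rev z ∈ L ∨ z = a) ↔ z = X) ∧
        ((G.rot z ∈ L ∨ z = b) ↔ G.rot z = Y)) := by
  have hne : L ≠ [] := by rintro rfl; exact hst hL.1
  obtain ⟨y0, L0, hL0⟩ := List.exists_cons_of_ne_nil hne
  have hy0 : G.tail y0 = G.tail a := by rw [hL0] at hL; exact hL.1.1
  have hy0L : y0 ∈ L := by simp [hL0]
  have hhead : ∀ z, G.rev z ∈ L → G.tail z ≠ G.tail a := fun z hz => by
    have := hL.head_ne_start hz; simpa using this
  have htail : ∀ z, z ∈ L → G.tail z ≠ G.tail b := fun z hz => hL.tail_ne_end hz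
  have hsh : ∀ z, G.OnPath a b L (G.tail z) →
      (G.Shifted a b L z ↔ ¬ G.OnPathDart L z ∧ G.LeavesLeft a b L z) := fun z hz =>
    ⟨fun h => ⟨h.1, h.2.2⟩, fun h => ⟨h.1, hz, h.2⟩⟩
  have hinf : ∀ x y, [x, y] <:+: L → x ∈ L ∧ y ∈ L ∧ G.head x = G.tail y := by
    rintro x y ⟨l1, l2, h⟩
    have hw := hL.1
    rw [← h, G.isWalk_append] at hw
    obtain ⟨_, hw, -⟩ := hw
    rw [G.isWalk_append] at hw
    obtain ⟨_, -, hw⟩ := hw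
    exact ⟨by simp [← h], by simp [← h], hw.2.1.symm⟩
  by_cases hs : v = G.tail a
  · subst hs
    refine ⟨a, y0, rfl, hy0, fun z hz => ?_, fun z hz => ⟨?_, ?_⟩⟩
    · rw [hsh z (Or.inl hz)]
      constructor
      · rintro ⟨h1, ⟨x, hx, h⟩ | ⟨x, y, hxy, h⟩ | ⟨x, hx, h⟩⟩
        · rw [hL0] at hx
          simp only [List.head?_cons, Option.mem_def, Option.some.injEq] at hx
          rwa [hx]
        · have h2 := h.tail_eq
          rw [hz, G.tail_rev] at h2
          exact absurd h2.symm (hL.head_ne_start (hinf x y hxy).1)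
        · have h2 := h.tail_eq
          rw [hz, G.tail_rev] at h2
          exact absurd h2.symm (hL.head_ne_start (List.mem_of_mem_getLast? hx))
      · intro h
        refine ⟨?_, Or.inl ⟨y0, by simp [hL0], h⟩⟩
        rintro (h1 | h1)
        · have := hL.tail_inj h1 hy0L (hz.trans hy0.symm)
          subst this
          exact not_between_right _ _ h
        · exact hhead z h1 hz
    · exact ⟨fun h => h.resolve_left fun h1 => hhead z h1 hz, Or.inr⟩
    · constructor
      · rintro (h | rfl)
        · exact hL.tail_inj h hy0L (by rw [G.tail_rot, hz, hy0])
        · exact absurd hz.symm hst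
      · intro h; rw [h]; exact Or.inl hy0L
  · by_cases ht : v = G.tail b
    · subst ht
      obtain ⟨L1, x0, hL1⟩ : ∃ l x, L = l ++ [x] := by
        rcases List.eq_nil_or_concat L with h | ⟨l, x, h⟩
        · exact absurd h hne
        · exact ⟨l, x, by rw [h, List.concat_eq_append]⟩
      have hx0 : G.head x0 = G.tail b := by
        have h := hL.1
        rw [hL1] at h
        exact ((G.isWalk_concat).1 h).2
      have hx0L : x0 ∈ L := by simp [hL1]
      refine ⟨G.rev x0, G.rot b, hx0, G.tail_rot b, fun z hz => ?_, fun z hz => ⟨?_, ?_⟩⟩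
      · rw [hsh z (Or.inr (Or.inl hz))]
        constructor
        · rintro ⟨h1, ⟨x, hx, h⟩ | ⟨x, y, hxy, h⟩ | ⟨x, hx, h⟩⟩
          · exact absurd (h.tail_eq.symm.trans hz) hst
          · have h2 := h.tail_eq
            rw [hz, G.tail_rev, (hinf x y hxy).2.2] at h2
            exact absurd h2.symm (htail y (hinf x y hxy).2.1)
          · have hx' : x0 = x := by
              rw [hL1] at hx; simpa using hx
            rwa [hx']
        · intro h
          refine ⟨?_, Or.inr (Or.inr ⟨x0, by simp [hL1], h⟩)⟩
          rintro (h1 | h1)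
          · exact htail z h1 hz
          · have h2 := hL.head_inj h1 hx0L (by rw [G.head_rev, hz, hx0])
            rw [← h2, G.rev_rev] at h
            exact not_between_left (by rw [G.tail_rot, hz]) h
      · constructor
        · rintro (h | rfl)
          · rw [← hL.head_inj h hx0L (by rw [G.head_rev, hz, hx0]), G.rev_rev]
          · exact absurd hz hst
        · intro h; rw [h, G.rev_rev]; exact Or.inl hx0L
      · constructor
        · rintro (h | rfl)
          · exact absurd (by rw [G.tail_rot, hz]) (htail _ h)
          · rfl
        · intro h; exact Or.inr (G.rot.injective h)
    · obtain ⟨x, y, hxy, hyv⟩ : ∃ x y, [x, y] <:+: L ∧ G.tail y = v := by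
        rcases hv with h | h | ⟨d, hd, h⟩
        · exact absurd h hs
        · exact absurd h ht
        · obtain ⟨l1, l2, hl⟩ := List.append_of_mem hd
          have hw := hL.1
          rw [hl, G.isWalk_append] at hw
          obtain ⟨u, hw1, hw2⟩ := hw
          rcases h with h | h
          · rcases List.eq_nil_or_concat l1 with h1 | ⟨l3, x, h1⟩
            · rw [h1] at hw1
              exact absurd (by rw [h, hw2.1, ← hw1]) hs
            · exact ⟨x, d, ⟨l3, l2, by rw [hl, h1, List.concat_eq_append]; simp⟩, h.symm⟩
          · cases l2 with
            | nil => exact absurd (h.trans hw2.2) ht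
            | cons y l2 => exact ⟨d, y, ⟨l1, l2, by rw [hl]; simp⟩, by rw [h]; exact hw2.2.1⟩
      obtain ⟨hxL, hyL, hxy'⟩ := hinf x y hxy
      have hxv : G.head x = v := hxy'.trans hyv
      refine ⟨G.rev x, y, hxv, hyv, fun z hz => ?_, fun z hz => ⟨?_, ?_⟩⟩
      · rw [hsh z (by rw [hz]; exact hv)]
        constructor
        · rintro ⟨h1, ⟨x', hx', h⟩ | ⟨x', y', hxy2, h⟩ | ⟨x', hx', h⟩⟩
          · exact absurd (hz.symm.trans h.tail_eq) hs
          · obtain ⟨hx'L, hy'L, h3⟩ := hinf x' y' hxy2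
            have h2 := h.tail_eq
            rw [hz, G.tail_rev] at h2
            rwa [hL.head_inj hxL hx'L (hxv.trans h2),
              hL.tail_inj hyL hy'L (hyv.trans (h2.trans h3))]
          · have h2 := h.tail_eq
            rw [hz, G.tail_rev] at h2
            obtain ⟨l1, hl1⟩ : ∃ l, L = l ++ [x'] := by
              obtain ⟨h4, h5⟩ := List.mem_getLast?_eq_getLast hx'
              exact ⟨L.dropLast, by rw [h5]; exact (List.dropLast_append_getLast h4).symm⟩
            have hw := hL.1
            rw [hl1] at hw
            exact absurd (h2.trans ((G.isWalk_concat).1 hw).2) ht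
        · intro h
          refine ⟨?_, Or.inr (Or.inl ⟨x, y, hxy, h⟩)⟩
          rintro (h1 | h1)
          · rw [hL.tail_inj h1 hyL (hz.trans hyv.symm)] at h
            exact not_between_right _ _ h
          · have h2 := hL.head_inj h1 hxL (by rw [G.head_rev, hz, hxv])
            rw [← h2, G.rev_rev] at h
            exact not_between_left (hz.trans hyv.symm) h
      · constructor
        · rintro (h | rfl)
          · rw [← hL.head_inj h hxL (by rw [G.head_rev, hz, hxv]), G.rev_rev]
          · exact absurd hz.symm hs
        · intro h; rw [h, G.rev_rev]; exact Or.inl hxL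
      · constructor
        · rintro (h | rfl)
          · exact hL.tail_inj h hyL (by rw [G.tail_rot, hz, hyv])
          · exact absurd hz.symm ht
        · intro h; rw [h]; exact Or.inl hyL

/-- The position of the right side of a dart relative to the lift of `L` at its tail. -/
def rightShift (G : PlaneGraph V D F) (a b : D) (L : List D) (d : D) : ℕ :=
  G.shift a b L d + if G.rev d ∈ L then 1 else 0

/-- The position of the left side of a dart relative to the lift of `L` at its tail. -/
def leftShift (G : PlaneGraph V D F) (a b : D) (L : List D) (d : D) : ℕ :=
  G.shift a b L d + if d ∈ L then 1 else 0

/-- Going around a vertex, the position relative to the lift of `L` changes at the darts of `L`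
only, apart from the chosen corners `a` and `b`. -/
lemma leftShift_rot {a b : D} (hst : G.tail a ≠ G.tail b) {L : List D} [Finite D]
    (hL : G.IsSimplePath (G.tail a) L (G.tail b)) (z : D) :
    G.leftShift a b L (G.rot z) + (if z = b then 1 else 0) =
      G.rightShift a b L z + (if z = a then 1 else 0) := by
  have hrot : G.tail (G.rot z) = G.tail z := G.tail_rot z
  by_cases hv : G.OnPath a b L (G.tail z)
  · obtain ⟨X, Y, hX, hY, hsh, hz⟩ := exists_left_sector hst hL hv
    have hXY : G.tail X = G.tail Y := hX.trans hY.symm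
    have h1 : (G.rev z ∈ L → z ≠ a) := fun h h' => by
      have := hL.head_ne_start h; rw [G.head_rev, h'] at this; exact this rfl
    have h2 : (G.rot z ∈ L → z ≠ b) := fun h h' => by
      have := hL.tail_ne_end h; rw [G.tail_rot, h'] at this; exact this rfl
    have hR : (if G.rev z ∈ L then 1 else 0) + (if z = a then 1 else 0) =
        if z = X then 1 else 0 := by
      have h3 := (hz z rfl).1
      by_cases h4 : G.rev z ∈ L
      · rw [if_pos h4, if_neg (h1 h4), if_pos (h3.1 (Or.inl h4))]
      · by_cases h5 : z = a
        · have h6 := h3.1 (Or.inr h5)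
          rw [if_neg h4, if_pos h5, if_pos h6]
        · rw [if_neg h4, if_neg h5, if_neg fun h => (h3.2 h).elim h4 h5]
    have hLf : (if G.rot z ∈ L then 1 else 0) + (if z = b then 1 else 0) =
        if G.rot z = Y then 1 else 0 := by
      have h3 := (hz z rfl).2
      by_cases h4 : G.rot z ∈ L
      · rw [if_pos h4, if_neg (h2 h4), if_pos (h3.1 (Or.inl h4))]
      · by_cases h5 : z = b
        · have h6 := h3.1 (Or.inr h5)
          rw [if_neg h4, if_pos h5, if_pos h6]
        · rw [if_neg h4, if_neg h5, if_neg fun h => (h3.2 h).elim h4 h5]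
    have hmain : G.shift a b L (G.rot z) + (if G.rot z = Y then 1 else 0) =
        G.shift a b L z + if z = X then 1 else 0 := by
      simp only [shift, hsh z rfl, hsh (G.rot z) hrot, between_rot]
      by_cases h4 : z = X
      · have h5 : ¬ G.Between X Y z := by rw [h4]; exact not_between_left hXY
        by_cases h6 : G.rot z = Y
        · rw [if_neg fun h => h.2 h6, if_pos h6, if_neg h5, if_pos h4]
        · rw [if_pos ⟨Or.inl h4, h6⟩, if_neg h6, if_neg h5, if_pos h4]
      · by_cases h5 : G.Between X Y z
        · by_cases h6 : G.rot z = Y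
          · rw [if_neg fun h => h.2 h6, if_pos h6, if_pos h5, if_neg h4]
          · rw [if_pos ⟨Or.inr h5, h6⟩, if_neg h6, if_pos h5, if_neg h4]
        · have h6 : G.rot z ≠ Y := fun h => (between_of_rot_eq hXY h).elim h4 h5
          rw [if_neg fun h => h.1.elim h4 h5, if_neg h6, if_neg h5, if_neg h4]
    rw [leftShift, rightShift]
    omega
  · have h1 : z ≠ a := fun h => hv (Or.inl (by rw [h]))
    have h2 : z ≠ b := fun h => hv (Or.inr (Or.inl (by rw [h])))
    have h3 : G.rev z ∉ L := fun h => hv (Or.inr (Or.inr ⟨_, h, Or.inr (by rw [G.head_rev])⟩))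
    have h4 : G.rot z ∉ L := fun h => hv (Or.inr (Or.inr ⟨_, h, Or.inl (by rw [G.tail_rot])⟩))
    have h5 : ¬ G.Shifted a b L z := fun h => hv h.2.1
    have h6 : ¬ G.Shifted a b L (G.rot z) := fun h => hv (by rw [← hrot]; exact h.2.1)
    simp [leftShift, rightShift, shift, h1, h2, h3, h4, h5, h6]

lemma shift_eq_zero {a b : D} {L : List D} {d : D} (h : G.OnPathDart L d) :
    G.shift a b L d = 0 := if_neg fun h' => h'.1 h

lemma shift_le_one (a b : D) (L : List D) (d : D) : G.shift a b L d ≤ 1 := by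
  rw [shift]; split_ifs <;> omega

lemma rightShift_le_one (a b : D) (L : List D) (d : D) : G.rightShift a b L d ≤ 1 := by
  rw [rightShift]
  split_ifs with h
  · rw [shift_eq_zero (Or.inr h)]
  · simpa using shift_le_one a b L d

lemma leftShift_le_one (a b : D) (L : List D) (d : D) : G.leftShift a b L d ≤ 1 := by
  rw [leftShift]
  split_ifs with h
  · rw [shift_eq_zero (Or.inl h)]
  · simpa using shift_le_one a b L d

section Corners

variable {a b : D} (hst : G.tail a ≠ G.tail b) {L : List D} [Finite D]
  (hL : G.IsSimplePath (G.tail a) L (G.tail b))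

include hst hL

lemma rightShift_source : G.rightShift a b L a = 0 ∧ G.leftShift a b L (G.rot a) = 1 := by
  have h1 := leftShift_rot hst hL a
  have h2 : a ≠ b := fun h => hst (by rw [h])
  have h3 := G.leftShift_le_one a b L (G.rot a)
  rw [if_neg h2, if_pos rfl] at h1
  omega

lemma rightShift_sink : G.rightShift a b L b = 1 ∧ G.leftShift a b L (G.rot b) = 0 := by
  have h1 := leftShift_rot hst hL b
  have h2 : b ≠ a := fun h => hst (by rw [h])
  have h3 := G.rightShift_le_one a b L b
  rw [if_neg h2, if_pos rfl] at h1
  omega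

lemma leftShift_rot_of_ne {z : D} (ha : z ≠ a) (hb : z ≠ b) :
    G.leftShift a b L (G.rot z) = G.rightShift a b L z := by
  have h1 := leftShift_rot hst hL z
  rwa [if_neg ha, if_neg hb, add_zero, add_zero] at h1

end Corners

end PlaneGraph

end PlanarFlow

end

/-! ### Net flow in the finite cover -/

noncomputable section

namespace PlanarFlow

open scoped Classical

namespace PlaneGraph

variable {V D F : Type*} {G : PlaneGraph V D F} {a b : D} {L : List D} {k : ℕ}

lemma rightShift_eq_leftShift {d : D} (h : ¬ G.OnPathDart L d) :
    G.rightShift a b L d = G.shift a b L d ∧ G.leftShift a b L d = G.shift a b L d := by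
  rw [OnPathDart, not_or] at h
  simp [rightShift, leftShift, h.1, h.2]

lemma cover_tail_val (x : G.CoverDart L k) :
    ((G.cover a b L k).tail x).1 = (G.tail x.1.1, x.1.2.val + G.shift a b L x.1.1) := by
  change (G.coverTail a b L k x).1 = _
  by_cases h : G.Shifted a b L x.1.1
  · exact (congrArg Subtype.val (dif_pos h : G.coverTail a b L k x = _)).trans
      (by rw [shift, if_pos h])
  · exact (congrArg Subtype.val (dif_neg h : G.coverTail a b L k x = _)).trans
      (by rw [shift, if_neg h]; rfl)

lemma coverVertex_ext_iff {u v : G.CoverVertex a b L k} :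
    u = v ↔ u.1.1 = v.1.1 ∧ u.1.2 = v.1.2 :=
  ⟨fun h => by rw [h]; exact ⟨rfl, rfl⟩, fun h => Subtype.ext (Prod.ext h.1 h.2)⟩

lemma coverDart_ext {x y : G.CoverDart L k} (h1 : x.1.1 = y.1.1) (h2 : x.1.2.val = y.1.2.val) :
    x = y := Subtype.ext (Prod.ext h1 (Fin.ext h2))

lemma coverSTSplit_left_dart (x : G.CoverDart L k) :
    (G.coverSTSplit a b L k).left (.dart x) =
      copyFace k (G.left x.1.1) (if x.1.1 ∈ L then x.1.2.val else x.1.2.val + 1) := by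
  have : G.rev (G.rev x.1.1) = x.1.1 := G.rev_rev _
  change copyFace k (G.right (G.rev x.1.1))
    (if G.rev (G.rev x.1.1) ∈ L then x.1.2.val else x.1.2.val + 1) = _
  rw [this]; rfl

/-- The lift of `d` whose tail lies on the lift `m` of `L`, or in copy `m`, exists in the finite
cover. -/
def Present (a b : D) (L : List D) (k m : ℕ) (d : D) : Prop :=
  ∃ x : G.CoverDart L k, x.1.1 = d ∧ x.1.2.val + G.shift a b L d = m

lemma not_present {m : ℕ} {d : D} (hm : m ≤ k) (h : ¬ G.Present a b L k m d) :
    ¬ G.OnPathDart L d ∧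
      ((m = 0 ∧ G.shift a b L d = 1) ∨ (m = k ∧ G.shift a b L d = 0)) := by
  have h1 := G.shift_le_one a b L d
  have h2 : ¬ G.OnPathDart L d := fun h2 => h
    ⟨⟨(d, ⟨m, by omega⟩), Or.inr h2⟩, rfl, by simp [shift_eq_zero h2]⟩
  refine ⟨h2, ?_⟩
  by_contra h3
  exact h ⟨⟨(d, ⟨m - G.shift a b L d, by omega⟩), Or.inl (by simp only; omega)⟩, rfl,
    by simp only; omega⟩

lemma copyFace_zero (g : F) : copyFace k g 0 = Sum.inr false := by simp [copyFace]

lemma copyFace_succ {j : ℕ} (g : F) (h : j < k) : copyFace k g (j + 1) = Sum.inl (g, ⟨j, h⟩) := by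
  simp [copyFace, h]

lemma copyFace_top (g : F) : copyFace k g (k + 1) = Sum.inr true := by simp [copyFace]

lemma coverSTSplit_right_dart {x : G.CoverDart L k} {d : D} {m : ℕ} (hd : x.1.1 = d)
    (hm : x.1.2.val + G.shift a b L d = m) :
    (G.coverSTSplit a b L k).right (.dart x) =
      copyFace k (G.right d) (m + 1 - G.rightShift a b L d) := by
  subst hd hm
  change copyFace k _ _ = _
  congr 1
  rw [rightShift]
  split_ifs <;> omega

lemma coverSTSplit_left_dart' {x : G.CoverDart L k} {d : D} {m : ℕ} (hd : x.1.1 = d)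
    (hm : x.1.2.val + G.shift a b L d = m) :
    (G.coverSTSplit a b L k).left (.dart x) =
      copyFace k (G.left d) (m + 1 - G.leftShift a b L d) := by
  subst hd hm
  rw [coverSTSplit_left_dart]
  congr 1
  rw [leftShift]
  split_ifs <;> omega

lemma copyFace_of_not_present {m : ℕ} {d : D} (hm : m ≤ k) (h : ¬ G.Present a b L k m d) :
    copyFace k (G.right d) (m + 1 - G.rightShift a b L d) =
      copyFace k (G.left d) (m + 1 - G.leftShift a b L d) := by
  obtain ⟨h1, h2⟩ := not_present hm h
  rw [(rightShift_eq_leftShift h1).1, (rightShift_eq_leftShift h1).2]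
  rcases h2 with ⟨rfl, h3⟩ | ⟨rfl, h3⟩ <;> rw [h3]
  · rw [copyFace_zero, copyFace_zero]
  · rw [Nat.sub_zero, copyFace_top, copyFace_top]

lemma coverVertex_le (v : G.CoverVertex a b L k) : v.1.2 ≤ k := by
  rcases v.2 with h | h <;> omega

lemma sum_source_eq (v : G.CoverVertex a b L k) (r : ℕ → ℝ) :
    (∑ i : Fin (k + 1), if G.coverSource a b L i = v then r i.val else 0) =
      if v.1.1 = G.tail a then r v.1.2 else 0 := by
  have hv := coverVertex_le v
  have key : ∀ i : Fin (k + 1), G.coverSource a b L i = v ↔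
      v.1.1 = G.tail a ∧ i = ⟨v.1.2, by omega⟩ := by
    intro i
    rw [coverVertex_ext_iff, Fin.ext_iff]
    exact ⟨fun h => ⟨h.1.symm, h.2⟩, fun h => ⟨h.1.symm, h.2⟩⟩
  simp only [key]
  split_ifs with h <;> simp [h]

lemma sum_sink_eq (v : G.CoverVertex a b L k) (r : ℕ → ℝ) :
    (∑ i : Fin (k + 1), if G.coverSink a b L i = v then r i.val else 0) =
      if v.1.1 = G.tail b then r v.1.2 else 0 := by
  have hv := coverVertex_le v
  have key : ∀ i : Fin (k + 1), G.coverSink a b L i = v ↔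
      v.1.1 = G.tail b ∧ i = ⟨v.1.2, by omega⟩ := by
    intro i
    rw [coverVertex_ext_iff, Fin.ext_iff]
    exact ⟨fun h => ⟨h.1.symm, h.2⟩, fun h => ⟨h.1.symm, h.2⟩⟩
  simp only [key]
  split_ifs with h <;> simp [h]

section Sums

variable [Fintype D]

lemma sum_stDart (w : G.STDart L k → ℝ) :
    ∑ x, w x = ∑ x, w (.dart x) + ((∑ i, w (.source i) + ∑ i, w (.sourceRev i)) +
      (∑ i, w (.sink i) + ∑ i, w (.sinkRev i))) := by
  let φ : G.CoverDart L k ⊕ (Fin (k + 1) ⊕ Fin (k + 1)) ⊕ (Fin (k + 1) ⊕ Fin (k + 1)) →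
      G.STDart L k := fun x => match x with
    | .inl x => .dart x
    | .inr (.inl (.inl i)) => .source i
    | .inr (.inl (.inr i)) => .sourceRev i
    | .inr (.inr (.inl i)) => .sink i
    | .inr (.inr (.inr i)) => .sinkRev i
  have hφ : Function.Bijective φ := by
    constructor
    · rintro (x | (i | i) | (i | i)) (y | (j | j) | (j | j)) h <;> cases h <;> rfl
    · rintro (x | i | i | i | i)
      · exact ⟨.inl x, rfl⟩
      · exact ⟨.inr (.inl (.inl i)), rfl⟩
      · exact ⟨.inr (.inl (.inr i)), rfl⟩
      · exact ⟨.inr (.inr (.inl i)), rfl⟩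
      · exact ⟨.inr (.inr (.inr i)), rfl⟩
  rw [← Function.Bijective.sum_comp hφ w]
  simp only [Fintype.sum_sum_type]
  rfl

/-- A sum over the darts of the cover at the lift `m` of a vertex `v` is a sum over the darts at
`v`, if the darts without a lift there are counted as zero. -/
lemma sum_cover_tail (v : G.CoverVertex a b L k) {w : G.CoverDart L k → ℝ} {W : D → ℝ}
    (hw : ∀ x : G.CoverDart L k, x.1.2.val + G.shift a b L x.1.1 = v.1.2 → w x = W x.1.1)
    (hW : ∀ d, G.tail d = v.1.1 → ¬ G.Present a b L k v.1.2 d → W d = 0) :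
    ∑ x with (G.cover a b L k).tail x = v, w x = ∑ d with G.tail d = v.1.1, W d := by
  have key : ∀ x : G.CoverDart L k, (G.cover a b L k).tail x = v ↔
      G.tail x.1.1 = v.1.1 ∧ x.1.2.val + G.shift a b L x.1.1 = v.1.2 := by
    intro x
    rw [coverVertex_ext_iff, cover_tail_val]
  refine Finset.sum_of_injOn (fun x => x.1.1) ?_ ?_ ?_ ?_
  · intro x hx y hy h
    simp only [Finset.coe_filter, Finset.mem_univ, true_and, Set.mem_ofPred_eq, key] at hx hy h
    refine coverDart_ext h ?_
    have h1 := hx.2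
    have h2 := hy.2
    rw [h] at h1
    omega
  · intro x hx
    simp only [Finset.coe_filter, Finset.mem_univ, true_and, Set.mem_ofPred_eq, key] at hx ⊢
    exact hx.1
  · intro d hd h
    simp only [Finset.mem_filter, Finset.mem_univ, true_and] at hd
    refine hW d hd ?_
    rintro ⟨x, rfl, hx⟩
    exact h ⟨x, by simpa [key] using ⟨hd, hx⟩, rfl⟩
  · intro x hx
    simp only [Finset.mem_filter, Finset.mem_univ, true_and, key] at hx
    exact hw x hx.2

lemma net_vertex {w : G.STDart L k → ℝ}
    (hw : ∀ x, w ((G.coverSTSplit a b L k).rev x) = - w x) (v : G.CoverVertex a b L k) :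
    (G.coverSTSplit a b L k).net w (.vertex v) = (G.cover a b L k).net (fun x => w (.dart x)) v
      + ((∑ i, if G.coverSource a b L i = v then w (.source i) else 0)
        - ∑ i, if G.coverSink a b L i = v then w (.sink i) else 0) := by
  rw [DartGraph.net_eq_neg_sum_tail _ hw, DartGraph.net_eq_neg_sum_tail _ (fun x => hw (.dart x)),
    Finset.sum_filter, sum_stDart, Finset.sum_filter]
  have h1 : ∀ i, w (.sourceRev i) = - w (.source i) := fun i => hw (.source i)
  have e1 : ∀ x, (G.coverSTSplit a b L k).tail (.dart x) = .vertex v ↔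
    (G.cover a b L k).tail x = v := fun x =>
      ⟨fun h => STVertex.vertex.inj h, fun h => by rw [← h]; rfl⟩
  have e2 : ∀ i, ¬ (G.coverSTSplit a b L k).tail (.source i) = .vertex v := fun i h => by cases h
  have e3 : ∀ i, (G.coverSTSplit a b L k).tail (.sourceRev i) = .vertex v ↔
    G.coverSource a b L i = v := fun x =>
      ⟨fun h => STVertex.vertex.inj h, fun h => by rw [← h]; rfl⟩
  have e4 : ∀ i, ¬ (G.coverSTSplit a b L k).tail (.sinkRev i) = .vertex v := fun i h => by cases h
  have e5 : ∀ i, (G.coverSTSplit a b L k).tail (.sink i) = .vertex v ↔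
    G.coverSink a b L i = v := fun x =>
      ⟨fun h => STVertex.vertex.inj h, fun h => by rw [← h]; rfl⟩
  simp only [e1, e2, e3, e4, e5, if_false, Finset.sum_const_zero, h1]
  have : ∀ i, (if G.coverSource a b L i = v then - w (.source i) else 0) =
      - (if G.coverSource a b L i = v then w (.source i) else 0) := fun i => by split_ifs <;> simp
  simp only [this, Finset.sum_neg_distrib]
  ring

lemma net_S {w : G.STDart L k → ℝ}
    (hw : ∀ x, w ((G.coverSTSplit a b L k).rev x) = - w x) :
    (G.coverSTSplit a b L k).net w .S = - ∑ i, w (.source i) := by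
  rw [DartGraph.net_eq_neg_sum_tail _ hw, Finset.sum_filter, sum_stDart]
  have e1 : ∀ x, ¬ (G.coverSTSplit a b L k).tail (.dart x) = .S := fun i h => by cases h
  have e2 : ∀ i, (G.coverSTSplit a b L k).tail (.source i) = .S := fun i => rfl
  have e3 : ∀ i, ¬ (G.coverSTSplit a b L k).tail (.sourceRev i) = .S := fun i h => by cases h
  have e4 : ∀ i, ¬ (G.coverSTSplit a b L k).tail (.sinkRev i) = .S := fun i h => by cases h
  have e5 : ∀ i, ¬ (G.coverSTSplit a b L k).tail (.sink i) = .S := fun i h => by cases h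
  simp [e1, e2, e3, e4, e5]

lemma net_T {w : G.STDart L k → ℝ}
    (hw : ∀ x, w ((G.coverSTSplit a b L k).rev x) = - w x) :
    (G.coverSTSplit a b L k).net w .T = ∑ i, w (.sink i) := by
  rw [DartGraph.net_eq_neg_sum_tail _ hw, Finset.sum_filter, sum_stDart]
  have e1 : ∀ x, ¬ (G.coverSTSplit a b L k).tail (.dart x) = .T := fun i h => by cases h
  have e2 : ∀ i, ¬ (G.coverSTSplit a b L k).tail (.source i) = .T := fun i h => by cases h
  have e3 : ∀ i, ¬ (G.coverSTSplit a b L k).tail (.sourceRev i) = .T := fun i h => by cases h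
  have e4 : ∀ i, (G.coverSTSplit a b L k).tail (.sinkRev i) = .T := fun i => rfl
  have e5 : ∀ i, ¬ (G.coverSTSplit a b L k).tail (.sink i) = .T := fun i h => by cases h
  have h1 : ∀ i, w (.sinkRev i) = - w (.sink i) := fun i => hw (.sink i)
  simp [e1, e2, e3, e4, e5, h1]

/-- The flow given by potentials of the faces is conserved at the vertices of the cover, even if the
outer face is split. -/
lemma net_potFlow_vertex (hst : G.tail a ≠ G.tail b) (hL : G.IsSimplePath (G.tail a) L (G.tail b))
    (p : F × Fin k ⊕ Bool → ℝ) (v : G.CoverVertex a b L k) :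
    (G.coverSTSplit a b L k).net ((G.coverSTSplit a b L k).potFlow p) (.vertex v) = 0 := by
  set P : F → ℕ → ℝ := fun g j => p (copyFace k g j) with hP
  set m := v.1.2 with hm
  have hmk : m ≤ k := coverVertex_le v
  rw [net_vertex ((G.coverSTSplit a b L k).potFlow_rev p),
    DartGraph.net_eq_neg_sum_tail _ (fun x => (G.coverSTSplit a b L k).potFlow_rev p (.dart x)),
    sum_cover_tail v (W := fun d => P (G.right d) (m + 1 - G.rightShift a b L d) -
      P (G.left d) (m + 1 - G.leftShift a b L d))]
  · have h1 : ∀ i : Fin (k + 1), (G.coverSTSplit a b L k).potFlow p (.source i) =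
        (fun j => P (G.right a) (j + 1) - P (G.right a) j) i.val := fun i => rfl
    have h2 : ∀ i : Fin (k + 1), (G.coverSTSplit a b L k).potFlow p (.sink i) =
        (fun j => P (G.right b) (j + 1) - P (G.right b) j) i.val := fun i => rfl
    simp only [h1, h2]
    rw [sum_source_eq v fun j => P (G.right a) (j + 1) - P (G.right a) j,
      sum_sink_eq v fun j => P (G.right b) (j + 1) - P (G.right b) j, Finset.sum_sub_distrib]
    have h3 : ∑ d with G.tail d = v.1.1, P (G.left d) (m + 1 - G.leftShift a b L d) =
        ∑ d with G.tail d = v.1.1, P (G.right d) (m + 1 - G.leftShift a b L (G.rot d)) := by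
      symm
      refine Finset.sum_bij (fun d _ => G.rot d) ?_ ?_ ?_ ?_
      · intro d hd; simpa [G.tail_rot] using hd
      · intro d _ e _ h; exact G.rot.injective h
      · intro d hd
        refine ⟨G.rot⁻¹ d, ?_, G.rot.apply_symm_apply d⟩
        have h1 := G.tail_rot (G.rot⁻¹ d)
        rw [show G.rot (G.rot⁻¹ d) = d from G.rot.apply_symm_apply d] at h1
        simpa only [Finset.mem_filter, Finset.mem_univ, true_and, ← h1] using hd
      · intro d _; rw [G.left_rot]
    rw [h3, ← Finset.sum_sub_distrib]
    have hab : a ≠ b := fun h => hst (by rw [h])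
    have h4 : ∀ d, P (G.right d) (m + 1 - G.rightShift a b L d) -
        P (G.right d) (m + 1 - G.leftShift a b L (G.rot d)) =
        (if d = a then P (G.right a) (m + 1) - P (G.right a) m else 0) -
        (if d = b then P (G.right b) (m + 1) - P (G.right b) m else 0) := by
      intro d
      by_cases ha : d = a
      · rw [if_pos ha, if_neg (by rw [ha]; exact hab), ha, (rightShift_source hst hL).1,
          (rightShift_source hst hL).2]
        simp
      · by_cases hb : d = b
        · rw [if_pos hb, if_neg ha, hb, (rightShift_sink hst hL).1, (rightShift_sink hst hL).2]
          simp
        · rw [if_neg ha, if_neg hb, leftShift_rot_of_ne hst hL ha hb]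
          ring
    rw [Finset.sum_congr rfl fun d _ => h4 d, Finset.sum_sub_distrib, Finset.sum_ite_eq',
      Finset.sum_ite_eq']
    simp only [Finset.mem_filter, Finset.mem_univ, true_and, eq_comm (a := v.1.1)]
    ring
  · intro x hx
    rw [FacedGraph.potFlow, coverSTSplit_right_dart rfl hx, coverSTSplit_left_dart' rfl hx]
  · intro d _ hd
    simp only [hP, copyFace_of_not_present hmk hd, sub_self]

lemma sum_potFlow_arcs (p : F × Fin k ⊕ Bool → ℝ) (g : F) :
    ∑ i : Fin (k + 1), (p (copyFace k g (i.val + 1)) - p (copyFace k g i.val)) =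
      p (Sum.inr true) - p (Sum.inr false) := by
  rw [Fin.sum_univ_eq_sum_range (fun i => p (copyFace k g (i + 1)) - p (copyFace k g i)) (k + 1),
    Finset.sum_range_sub fun i => p (copyFace k g i), copyFace_top, copyFace_zero]

lemma net_potFlow_S (p : F × Fin k ⊕ Bool → ℝ) :
    (G.coverSTSplit a b L k).net ((G.coverSTSplit a b L k).potFlow p) .S =
      - (p (Sum.inr true) - p (Sum.inr false)) := by
  rw [net_S ((G.coverSTSplit a b L k).potFlow_rev p), ← sum_potFlow_arcs p (G.right a)]
  rfl

lemma net_potFlow_T (p : F × Fin k ⊕ Bool → ℝ) :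
    (G.coverSTSplit a b L k).net ((G.coverSTSplit a b L k).potFlow p) .T =
      p (Sum.inr true) - p (Sum.inr false) := by
  rw [net_T ((G.coverSTSplit a b L k).potFlow_rev p), ← sum_potFlow_arcs p (G.right b)]
  rfl

end Sums

end PlaneGraph

end PlanarFlow

end

/-! ### Fans and walks in the finite cover -/

noncomputable section

namespace PlanarFlow

open scoped Classical

namespace PlaneGraph

variable {V D F : Type*} {G : PlaneGraph V D F} {a b : D} {L : List D} {k : ℕ}

/-- Around a vertex of the cover, consecutive darts share a face, and the arc to `S` or `T` (if
there is one) comes between the two darts at the chosen corner. -/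
lemma fan_vertex [Finite D] (hst : G.tail a ≠ G.tail b)
    (hL : G.IsSimplePath (G.tail a) L (G.tail b))
    (p : F × Fin k ⊕ Bool → ℝ) (v : G.CoverVertex a b L k) {x y : G.STDart L k} (hxy : x ≠ y)
    (hx : (G.coverSTSplit a b L k).tail x = .vertex v)
    (hy : (G.coverSTSplit a b L k).tail y = .vertex v)
    (hs : ∀ z, (G.coverSTSplit a b L k).tail z = .vertex v → z ≠ x → z ≠ y →
      p ((G.coverSTSplit a b L k).right z) = p ((G.coverSTSplit a b L k).left z)) :
    p ((G.coverSTSplit a b L k).right x) = p ((G.coverSTSplit a b L k).left y) := by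
  set m := v.1.2 with hm
  have hmk : m ≤ k := coverVertex_le v
  set R : D → ℝ := fun d => p (copyFace k (G.right d) (m + 1 - G.rightShift a b L d)) with hR
  set Q : D → ℝ := fun d => p (copyFace k (G.left d) (m + 1 - G.leftShift a b L d)) with hQ
  have hab : a ≠ b := fun h => hst (by rw [h])
  have hRs := rightShift_source hst hL
  have hRt := rightShift_sink hst hL
  have hdart : ∀ z : G.CoverDart L k, (G.coverSTSplit a b L k).tail (.dart z) = .vertex v →
      G.tail z.1.1 = v.1.1 ∧ p ((G.coverSTSplit a b L k).right (.dart z)) = R z.1.1 ∧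
        p ((G.coverSTSplit a b L k).left (.dart z)) = Q z.1.1 := by
    intro z hz
    have h1 := coverVertex_ext_iff.1 (STVertex.vertex.inj hz)
    rw [cover_tail_val] at h1
    exact ⟨h1.1, congrArg p (coverSTSplit_right_dart rfl h1.2),
      congrArg p (coverSTSplit_left_dart' rfl h1.2)⟩
  have htail : ∀ z : G.CoverDart L k, G.tail z.1.1 = v.1.1 →
      z.1.2.val + G.shift a b L z.1.1 = m →
      (G.coverSTSplit a b L k).tail (.dart z) = .vertex v := by
    intro z h1 h2
    refine congrArg STVertex.vertex (coverVertex_ext_iff.2 ?_)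
    rw [cover_tail_val]
    exact ⟨h1, h2⟩
  -- A dart without a lift at `v` has the same face, a part of the outer one, on both sides.
  have hside : ∀ z : D, G.tail z = v.1.1 →
      (∀ w : G.CoverDart L k, w.1.1 = z → .dart w ≠ x ∧ .dart w ≠ y) → R z = Q z := by
    intro z hz hw
    by_cases hp : G.Present a b L k m z
    · obtain ⟨w, rfl, hw2⟩ := hp
      have h1 := htail w hz hw2
      rw [← (hdart w h1).2.1, ← (hdart w h1).2.2]
      exact hs _ h1 (hw w rfl).1 (hw w rfl).2
    · simp only [hR, hQ, copyFace_of_not_present hmk hp]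
  have hrot : ∀ z, z ≠ a → z ≠ b → Q (G.rot z) = R z := by
    intro z ha hb
    simp only [hR, hQ, leftShift_rot_of_ne hst hL ha hb, G.left_rot]
  -- the arc at the corner `c`
  let arc : D → G.STDart L k := fun c => if c = a then .sourceRev ⟨m, by omega⟩ else
    .sink ⟨m, by omega⟩
  have harc : ∀ z, (G.coverSTSplit a b L k).tail z = .vertex v → (∃ w, z = .dart w) ∨
      ∃ c, (c = a ∨ c = b) ∧ G.tail c = v.1.1 ∧ z = arc c := by
    rintro (w | i | i | i | i) hz
    · exact Or.inl ⟨w, rfl⟩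
    · cases hz
    · have h1 := coverVertex_ext_iff.1 (STVertex.vertex.inj hz)
      refine Or.inr ⟨a, Or.inl rfl, h1.1, ?_⟩
      simp only [arc, if_true]
      exact congrArg _ (Fin.ext h1.2)
    · have h1 := coverVertex_ext_iff.1 (STVertex.vertex.inj hz)
      refine Or.inr ⟨b, Or.inr rfl, h1.1, ?_⟩
      simp only [arc, if_neg hab.symm]
      exact congrArg _ (Fin.ext h1.2)
    · cases hz
  have harc' : ∀ c, (c = a ∨ c = b) → G.tail c = v.1.1 →
      (G.coverSTSplit a b L k).tail (arc c) = .vertex v ∧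
      p ((G.coverSTSplit a b L k).right (arc c)) = Q (G.rot c) ∧
      p ((G.coverSTSplit a b L k).left (arc c)) = R c ∧ ∀ w, .dart w ≠ arc c := by
    rintro c (rfl | rfl) hc
    · simp only [arc, if_true, hR, hQ, hRs, G.left_rot, Nat.add_sub_cancel, Nat.sub_zero]
      exact ⟨congrArg STVertex.vertex (coverVertex_ext_iff.2 ⟨hc, rfl⟩), rfl, rfl,
        fun w h => by cases h⟩
    · simp only [arc, if_neg hab.symm, hR, hQ, hRt, G.left_rot, Nat.add_sub_cancel, Nat.sub_zero]
      exact ⟨congrArg STVertex.vertex (coverVertex_ext_iff.2 ⟨hc, rfl⟩), rfl, rfl,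
        fun w h => by cases h⟩
  have hcor : ∀ c, (c = a ∨ c = b) → G.tail c = v.1.1 → ∀ z, G.tail z = v.1.1 → z ≠ c →
      Q (G.rot z) = R z := by
    rintro c (rfl | rfl) hc z hz hzc
    · exact hrot z hzc fun h => hst (by rw [hc, ← hz, h])
    · exact hrot z (fun h => hst (by rw [hc, ← hz, h])) hzc
  have hcyc : ∀ d e, G.tail d = v.1.1 → G.tail e = v.1.1 → G.rot.SameCycle d e :=
    fun d e hd he => (G.tail_eq_iff d e).1 (hd.trans he.symm)
  have hcyc' : ∀ d e, G.tail d = v.1.1 → G.rot.SameCycle d e → G.tail e = v.1.1 :=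
    fun d e hd he => ((G.tail_eq_iff d e).2 he).symm.trans hd
  rcases harc x hx with ⟨d, rfl⟩ | ⟨c, hc, hcv, rfl⟩
  · obtain ⟨hd1, hd2, -⟩ := hdart d hx
    rw [hd2]
    rcases harc y hy with ⟨e, rfl⟩ | ⟨c, hc, hcv, rfl⟩
    · obtain ⟨he1, -, he2⟩ := hdart e hy
      rw [he2]
      refine FacedGraph.orbit_fan G.rot R Q (hcyc _ _ hd1 he1) ?_ ?_
      · intro z hz
        have hz' := hcyc' _ _ hd1 hz
        by_cases hzc : z = a ∨ z = b
        · obtain ⟨h1, h2, h3, h4⟩ := harc' z hzc hz'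
          rw [← h2, ← h3]
          exact hs _ h1 (h4 d).symm (h4 e).symm
        · rw [not_or] at hzc
          exact hrot z hzc.1 hzc.2
      · intro z hz hzd hze
        refine hside z (hcyc' _ _ hd1 hz) fun w hw => ⟨?_, ?_⟩
        · rintro h; exact hzd (by rw [← hw, STDart.dart.inj h])
        · rintro h; exact hze (by rw [← hw, STDart.dart.inj h])
    · -- The arc ends the fan at the corner `c`, so the value on the left of `rot c` is replaced.
      obtain ⟨h1, h2, h3, h4⟩ := harc' c hc hcv
      rw [h3]
      have := FacedGraph.orbit_fan G.rot R (Function.update Q (G.rot c) (R c)) (d := d.1.1)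
        (e := G.rot c) (hcyc _ _ hd1 (by rw [G.tail_rot, hcv])) ?_ ?_
      · rwa [Function.update_self] at this
      · intro z hz
        by_cases hzc : z = c
        · rw [hzc, Function.update_self]
        · rw [Function.update_of_ne fun h => hzc (G.rot.injective h)]
          exact hcor c hc hcv z (hcyc' _ _ hd1 hz) hzc
      · intro z hz hzd hze
        rw [Function.update_of_ne hze]
        refine hside z (hcyc' _ _ hd1 hz) fun w hw => ⟨?_, h4 w⟩
        rintro h; exact hzd (by rw [← hw, STDart.dart.inj h])
  · obtain ⟨h1, h2, h3, h4⟩ := harc' c hc hcv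
    rw [h2]
    rcases harc y hy with ⟨e, rfl⟩ | ⟨c', hc', hcv', rfl⟩
    · -- The fan starts at the arc, so the value on the right of `c` is replaced.
      obtain ⟨he1, -, he2⟩ := hdart e hy
      rw [he2]
      have := FacedGraph.orbit_fan G.rot (Function.update R c (Q (G.rot c))) Q (d := c)
        (e := e.1.1) (hcyc _ _ hcv he1) ?_ ?_
      · rwa [Function.update_self] at this
      · intro z hz
        by_cases hzc : z = c
        · rw [hzc, Function.update_self]
        · rw [Function.update_of_ne hzc]
          exact hcor c hc hcv z (hcyc' _ _ hcv hz) hzc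
      · intro z hz hzc hze
        rw [Function.update_of_ne hzc]
        refine hside z (hcyc' _ _ hcv hz) fun w hw => ⟨h4 w, ?_⟩
        rintro h; exact hze (by rw [← hw, STDart.dart.inj h])
    · have : c = c' := by
        rcases hc with rfl | rfl <;> rcases hc' with rfl | rfl
        · rfl
        · exact absurd (hcv.trans hcv'.symm) hst
        · exact absurd (hcv'.trans hcv.symm) hst
        · rfl
      exact absurd (by rw [this]) hxy

/-- Around `S` and `T`: a cyclic sequence that steps at the places `i` and `j` only. -/
lemma eq_of_cyclic_steps {u : ℕ → ℝ} {i j k : ℕ} (hi : i ≤ k) (hj : j ≤ k) (hij : i ≠ j)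
    (h0 : u 0 = u (k + 1)) (h : ∀ l ≤ k, l ≠ i → l ≠ j → u (l + 1) = u l) : u (i + 1) = u j := by
  have key : ∀ n m, n ≤ m → (∀ l, n ≤ l → l < m → u (l + 1) = u l) → u m = u n := by
    intro n m hnm
    induction m, hnm using Nat.le_induction with
    | base => intro _; rfl
    | succ m hnm ih =>
      intro hl
      rw [hl m hnm (by omega), ih fun l h1 h2 => hl l h1 (by omega)]
  rcases Nat.lt_or_gt_of_ne hij with h1 | h1
  · exact (key (i + 1) j h1 fun l h2 h3 => h l (by omega) (by omega) (by omega)).symm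
  · rw [key 0 j (by omega) fun l h2 h3 => h l (by omega) (by omega) (by omega), h0]
    exact (key (i + 1) (k + 1) (by omega) fun l h2 h3 => h l (by omega) (by omega) (by omega)).symm

lemma fan_coverST [Finite D] (hst : G.tail a ≠ G.tail b)
    (hL : G.IsSimplePath (G.tail a) L (G.tail b)) (x y : G.STDart L k) (hxy : x ≠ y)
    (ht : (G.coverST a b L k).tail x = (G.coverST a b L k).tail y)
    (q : Option (F × Fin k) → ℝ)
    (hs : ∀ z, (G.coverST a b L k).tail z = (G.coverST a b L k).tail x → z ≠ x → z ≠ y →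
      q ((G.coverST a b L k).right z) = q ((G.coverST a b L k).left z)) :
    q ((G.coverST a b L k).right x) = q ((G.coverST a b L k).left y) := by
  have houter : ∀ g, q (copyFace k g 0).getLeft? = q (copyFace k g (k + 1)).getLeft? := fun g => by
    rw [copyFace_zero, copyFace_top]; rfl
  match hx : (G.coverST a b L k).tail x with
  | .vertex v =>
    exact fan_vertex hst hL (fun f => q f.getLeft?) v hxy hx (ht ▸ hx)
      fun z hz h1 h2 => hs z (hz.trans hx.symm) h1 h2
  | .S =>
    rw [hx] at ht
    cases x <;> try cases hx
    cases y <;> try cases ht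
    rename_i i j
    refine eq_of_cyclic_steps (u := fun n => q (copyFace k (G.right a) n).getLeft?)
      (Nat.le_of_lt_succ i.isLt) (Nat.le_of_lt_succ j.isLt) (fun h => hxy (by rw [Fin.ext h]))
      (houter _) fun l hl h1 h2 => ?_
    exact hs (.source ⟨l, by omega⟩) rfl (fun h => h1 (by rw [← STDart.source.inj h]))
      (fun h => h2 (by rw [← STDart.source.inj h]))
  | .T =>
    rw [hx] at ht
    cases x <;> try cases hx
    cases y <;> try cases ht
    rename_i i j
    refine (eq_of_cyclic_steps (u := fun n => q (copyFace k (G.right b) n).getLeft?)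
      (Nat.le_of_lt_succ j.isLt) (Nat.le_of_lt_succ i.isLt) (fun h => hxy (by rw [Fin.ext h]))
      (houter _) fun l hl h1 h2 => ?_).symm
    exact (hs (.sinkRev ⟨l, by omega⟩) rfl (fun h => h2 (by rw [← STDart.sinkRev.inj h]))
      (fun h => h1 (by rw [← STDart.sinkRev.inj h]))).symm

lemma cover_head_val (x : G.CoverDart L k) :
    ((G.cover a b L k).head x).1 = (G.head x.1.1, x.1.2.val + G.shift a b L (G.rev x.1.1)) :=
  cover_tail_val _

lemma connected_coverST (hL : G.IsSimplePath (G.tail a) L (G.tail b))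
    (u v : G.STVertex a b L k) : ∃ l, (G.coverST a b L k).IsWalk u l v := by
  set H := G.coverST a b L k with hH
  have htrans : ∀ u v w, (∃ l, H.IsWalk u l v) → (∃ l, H.IsWalk v l w) → ∃ l, H.IsWalk u l w :=
    fun u v w ⟨l, hl⟩ ⟨l', hl'⟩ => ⟨l ++ l', hl.append hl'⟩
  have hsymm : ∀ u v, (∃ l, H.IsWalk u l v) → ∃ l, H.IsWalk v l u :=
    fun u v ⟨l, hl⟩ => ⟨_, hl.reverse⟩
  have hone : ∀ x : G.STDart L k, ∃ l, H.IsWalk (H.tail x) l (H.head x) :=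
    fun x => ⟨[x], rfl, rfl⟩
  -- the lift `m` of `L` leads to `s^m`
  have hpath : ∀ (l : List D) (w : V), (∀ d ∈ l, d ∈ L) → G.IsWalk (G.tail a) l w →
      ∀ x : G.CoverVertex a b L k, x.1.1 = w → ∃ l, H.IsWalk .S l (.vertex x) := by
    intro l
    induction l using List.reverseRecOn with
    | nil =>
      intro w _ hl x hx
      have hxk := coverVertex_le x
      have h1 := hone (.source ⟨x.1.2, by omega⟩)
      have h2 : H.head (.source ⟨x.1.2, by omega⟩) = .vertex x :=
        congrArg STVertex.vertex (coverVertex_ext_iff.2 ⟨hl.trans hx.symm, rfl⟩)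
      rwa [h2] at h1
    | append_singleton l d ih =>
      intro w hd hl x hx
      obtain ⟨h1, h2⟩ := G.isWalk_concat.1 hl
      have hdL : d ∈ L := hd d (by simp)
      have hxk := coverVertex_le x
      let y : G.CoverDart L k := ⟨(d, ⟨x.1.2, by omega⟩), Or.inr (Or.inl hdL)⟩
      have h3 := hone (.dart y)
      have h4 : H.head (.dart y) = .vertex x := by
        refine congrArg STVertex.vertex (coverVertex_ext_iff.2 ?_)
        change ((G.cover a b L k).head y).1.1 = _ ∧ ((G.cover a b L k).head y).1.2 = _
        rw [cover_head_val, shift_eq_zero (Or.inr (by rwa [G.rev_rev]))]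
        exact ⟨h2.trans hx.symm, rfl⟩
      rw [h4] at h3
      refine htrans _ _ _ (ih (G.tail d) (fun e he => hd e (by simp [he])) h1
        ((G.cover a b L k).tail y) ?_) h3
      rw [cover_tail_val]
  have hon : ∀ x : G.CoverVertex a b L k, G.OnPath a b L x.1.1 →
      ∃ l, H.IsWalk .S l (.vertex x) := by
    intro x hx
    have h1 : ∃ l, (∀ d ∈ l, d ∈ L) ∧ G.IsWalk (G.tail a) l x.1.1 := by
      rcases hx with h | h | ⟨d, hd, h⟩
      · exact ⟨[], by simp, h.symm⟩
      · exact ⟨L, fun _ h => h, by rw [h]; exact hL.1⟩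
      · obtain ⟨l1, l2, hl⟩ := List.append_of_mem hd
        have hw := hL.1
        rw [hl, G.isWalk_append] at hw
        obtain ⟨u, hw1, hw2⟩ := hw
        rcases h with h | h
        · exact ⟨l1, fun e he => by simp [hl, he], by rw [h, hw2.1]; exact hw1⟩
        · refine ⟨l1 ++ [d], fun e he => ?_, G.isWalk_concat.2 ⟨by rw [hw2.1]; exact hw1, h.symm⟩⟩
          rw [hl]; simp only [List.mem_append, List.mem_singleton] at he
          rcases he with he | he <;> simp [he]
    obtain ⟨l, hl, hw⟩ := h1
    exact hpath l _ hl hw x rfl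
  have hall : ∀ x : G.CoverVertex a b L k, ∃ l, H.IsWalk .S l (.vertex x) := by
    intro x
    obtain ⟨l, hl⟩ := G.connected x.1.1 (G.tail a)
    generalize hxu : x.1.1 = u at hl
    induction l generalizing x u with
    | nil => exact hon x (Or.inl (hxu.trans hl))
    | cons d l ih =>
      by_cases hx : G.OnPath a b L x.1.1
      · exact hon x hx
      · have hxk : x.1.2 < k := x.2.resolve_right fun h => hx h.2
        let y : G.CoverDart L k := ⟨(d, ⟨x.1.2, by omega⟩), Or.inl hxk⟩
        have h1 := hone (.dart y)
        have h2 : G.shift a b L d = 0 := if_neg fun h => hx (by rw [hxu, ← hl.1]; exact h.2.1)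
        have h3 : H.tail (.dart y) = .vertex x := by
          refine congrArg STVertex.vertex (coverVertex_ext_iff.2 ?_)
          rw [cover_tail_val]
          exact ⟨hl.1.trans hxu.symm, by simp only [y]; omega⟩
        rw [h3] at h1
        exact htrans _ _ _ (ih ((G.cover a b L k).head y) (G.head d) (by rw [cover_head_val]) hl.2)
          (hsymm _ _ h1)
  have hS : ∀ u : G.STVertex a b L k, ∃ l, H.IsWalk .S l u := by
    rintro (_ | _ | x)
    · exact ⟨[], rfl⟩
    · exact htrans _ _ _ (hall (G.coverSink a b L 0)) (hone (.sink 0))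
    · exact hall x
  exact htrans _ _ _ (hsymm _ _ (hS u)) (hS v)

end PlaneGraph

end PlanarFlow

end

/-! ### The finite cover between `S` and `T` is drawn on the sphere -/

noncomputable section

namespace PlanarFlow

open scoped Classical

namespace PlaneGraph

variable {V D F : Type*} {G : PlaneGraph V D F} {a b : D} {L : List D} {k : ℕ}

lemma card_onPath (hL : G.IsSimplePath (G.tail a) L (G.tail b)) :
    Nat.card {v // G.OnPath a b L v} = L.length + 1 := by
  rw [Nat.subtype_card (L.map G.tail ++ [G.tail b]).toFinset, List.toFinset_card_of_nodup hL.2]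
  · simp
  · intro v
    simp only [List.mem_toFinset, List.mem_append, List.mem_map, List.mem_singleton]
    constructor
    · rintro (⟨d, hd, rfl⟩ | rfl)
      · exact Or.inr (Or.inr ⟨d, hd, Or.inl rfl⟩)
      · exact Or.inr (Or.inl rfl)
    · have hpos : ∀ (l : List D) (u w : V), G.IsWalk u l w → u ≠ w → ∃ d ∈ l, G.tail d = u := by
        rintro (_ | ⟨d, l⟩) u w h huw
        · exact absurd h huw
        · exact ⟨d, by simp, h.1⟩
      rintro (rfl | rfl | ⟨d, hd, rfl | rfl⟩)
      · by_cases h : G.tail a = G.tail b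
        · exact Or.inr h
        · exact Or.inl (hpos _ _ _ hL.1 h)
      · exact Or.inr rfl
      · exact Or.inl ⟨d, hd, rfl⟩
      · obtain ⟨l1, l2, hl⟩ := List.append_of_mem hd
        have hw := hL.1
        rw [hl, G.isWalk_append] at hw
        obtain ⟨u, -, hw2⟩ := hw
        by_cases h : G.head d = G.tail b
        · exact Or.inr h
        · obtain ⟨e, he, h2⟩ := hpos _ _ _ hw2.2 h
          exact Or.inl ⟨e, by rw [hl]; simp [he], h2⟩

lemma card_onPathDart (hL : G.IsSimplePath (G.tail a) L (G.tail b)) :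
    Nat.card {d // G.OnPathDart L d} = 2 * L.length := by
  have hnd : (L ++ L.map G.rev).Nodup := by
    refine List.nodup_append'.2 ⟨hL.nodup, hL.nodup.map G.rev_injective, ?_⟩
    intro d hd hd2
    rw [List.mem_map] at hd2
    obtain ⟨e, he, rfl⟩ := hd2
    exact hL.rev_notMem he hd
  rw [Nat.subtype_card (L ++ L.map G.rev).toFinset, List.toFinset_card_of_nodup hnd]
  · simp; ring
  · intro d
    simp only [List.mem_toFinset, List.mem_append, List.mem_map, OnPathDart]
    refine or_congr Iff.rfl ⟨?_, fun h => ⟨_, h, G.rev_rev d⟩⟩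
    rintro ⟨e, he, rfl⟩
    rwa [G.rev_rev]

lemma card_coverVertex [Finite V] (hL : G.IsSimplePath (G.tail a) L (G.tail b)) :
    Nat.card (G.CoverVertex a b L k) = Nat.card V * k + (L.length + 1) := by
  let e : G.CoverVertex a b L k ≃ V × Fin k ⊕ {v // G.OnPath a b L v} :=
    { toFun := fun x => if h : x.1.2 < k then .inl (x.1.1, ⟨x.1.2, h⟩) else
        .inr ⟨x.1.1, (x.2.resolve_left h).2⟩
      invFun := fun y => match y with
        | .inl z => ⟨(z.1, z.2.val), Or.inl z.2.isLt⟩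
        | .inr z => ⟨(z.1, k), Or.inr ⟨rfl, z.2⟩⟩
      left_inv := fun x => by
        by_cases h : x.1.2 < k
        · simp only [h, dif_pos]; rfl
        · simp only [h, dif_neg, not_false_iff]
          exact coverVertex_ext_iff.2 ⟨rfl, (x.2.resolve_left h).1.symm⟩
      right_inv := fun y => by
        rcases y with ⟨v, i⟩ | z
        · exact dif_pos i.isLt
        · exact dif_neg (lt_irrefl k) }
  rw [Nat.card_congr e, Nat.card_sum, Nat.card_prod, Nat.card_fin, card_onPath hL]

lemma card_coverDart [Finite D] (hL : G.IsSimplePath (G.tail a) L (G.tail b)) :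
    Nat.card (G.CoverDart L k) = Nat.card D * k + 2 * L.length := by
  let e : G.CoverDart L k ≃ D × Fin k ⊕ {d // G.OnPathDart L d} :=
    { toFun := fun x => if h : x.1.2.val < k then .inl (x.1.1, ⟨x.1.2.val, h⟩) else
        .inr ⟨x.1.1, x.2.resolve_left h⟩
      invFun := fun y => match y with
        | .inl z => ⟨(z.1, z.2.castSucc), Or.inl z.2.isLt⟩
        | .inr z => ⟨(z.1, Fin.last k), Or.inr z.2⟩
      left_inv := fun x => by
        by_cases h : x.1.2.val < k
        · simp only [h, dif_pos]; rfl
        · simp only [h, dif_neg, not_false_iff]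
          exact coverDart_ext rfl (by have := x.1.2.isLt; simp only [Fin.val_last]; omega)
      right_inv := fun y => by
        rcases y with ⟨v, i⟩ | z
        · exact dif_pos i.isLt
        · exact dif_neg (lt_irrefl k) }
  rw [Nat.card_congr e, Nat.card_sum, Nat.card_prod, Nat.card_fin, card_onPathDart hL]

instance finite_coverVertex [Finite V] : Finite (G.CoverVertex a b L k) := by
  refine Finite.of_injective (β := V × Fin (k + 1))
    (fun x => (x.1.1, ⟨x.1.2, Nat.lt_succ_of_le (coverVertex_le x)⟩)) fun x y h => ?_
  rw [Prod.ext_iff, Fin.ext_iff] at h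
  exact coverVertex_ext_iff.2 h

/-- The vertices of the cover together with `S` and `T`. -/
def stVertexEquiv (G : PlaneGraph V D F) (a b : D) (L : List D) (k : ℕ) :
    G.STVertex a b L k ≃ G.CoverVertex a b L k ⊕ Bool where
  toFun
    | .S => .inr false
    | .T => .inr true
    | .vertex v => .inl v
  invFun
    | .inr false => .S
    | .inr true => .T
    | .inl v => .vertex v
  left_inv := by rintro (_ | _ | _) <;> rfl
  right_inv := by rintro (_ | _ | _) <;> rfl

/-- The darts of the cover together with the arcs at `S` and `T`. -/
def stDartEquiv (G : PlaneGraph V D F) (L : List D) (k : ℕ) :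
    G.STDart L k ≃ G.CoverDart L k ⊕ Fin 4 × Fin (k + 1) where
  toFun
    | .dart x => .inl x
    | .source i => .inr (0, i)
    | .sourceRev i => .inr (1, i)
    | .sink i => .inr (2, i)
    | .sinkRev i => .inr (3, i)
  invFun
    | .inl x => .dart x
    | .inr (0, i) => .source i
    | .inr (1, i) => .sourceRev i
    | .inr (2, i) => .sink i
    | .inr (3, i) => .sinkRev i
  left_inv := by rintro (_ | _ | _ | _ | _) <;> rfl
  right_inv := by
    rintro (_ | ⟨j, _⟩)
    · rfl
    · fin_cases j <;> rfl

instance finite_stVertex [Finite V] : Finite (G.STVertex a b L k) :=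
  Finite.of_equiv _ (G.stVertexEquiv a b L k).symm

theorem coverST_isSphere [Fintype D] (hst : G.tail a ≠ G.tail b)
    (hL : G.IsSimplePath (G.tail a) L (G.tail b)) :
    (G.coverST a b L k).IsSphere := by
  have hV := G.finite_vertex
  have hF := G.finite_face
  have hconn := connected_coverST (k := k) hL
  have hfan := fan_coverST (k := k) hst hL
  refine ⟨?_, hfan, FacedGraph.dual_connected_of_fan _ hfan hconn ?_, hconn, ?_⟩
  · intro p v
    let P : F × Fin k ⊕ Bool → ℝ := fun f => p f.getLeft?
    have h : (G.coverST a b L k).net ((G.coverST a b L k).potFlow p) v =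
        (G.coverSTSplit a b L k).net ((G.coverSTSplit a b L k).potFlow P) v := rfl
    rw [h]
    match v with
    | .vertex v => exact net_potFlow_vertex hst hL P v
    | .S => rw [net_potFlow_S]; simp [P]
    | .T => rw [net_potFlow_T]; simp [P]
  · rintro (_ | ⟨g, i⟩)
    · refine ⟨.sourceRev 0, ?_⟩
      change (copyFace k (G.right a) 0).getLeft? = none
      rw [copyFace_zero]; rfl
    · obtain ⟨d, rfl⟩ := G.right_surj g
      by_cases h : G.rev d ∈ L
      · refine ⟨.dart ⟨(d, ⟨i.val + 1, by omega⟩), Or.inr (Or.inr h)⟩, ?_⟩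
        change (copyFace k (G.right d) (if G.rev d ∈ L then i.val + 1 else _)).getLeft? = _
        rw [if_pos h, copyFace_succ _ i.isLt]; rfl
      · refine ⟨.dart ⟨(d, ⟨i.val, by omega⟩), Or.inl i.isLt⟩, ?_⟩
        change (copyFace k (G.right d) (if G.rev d ∈ L then _ else i.val + 1)).getLeft? = _
        rw [if_neg h, copyFace_succ _ i.isLt]; rfl
  · rw [Nat.card_congr (G.stVertexEquiv a b L k), Nat.card_congr (G.stDartEquiv L k), Nat.card_sum,
      Nat.card_sum, Nat.card_prod, card_coverVertex hL, card_coverDart hL,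
      Finite.card_option, Nat.card_prod]
    simp only [Nat.card_eq_fintype_card (α := Bool), Fintype.card_bool, Nat.card_fin]
    have h := congrArg (k * ·) G.euler
    simp only [mul_add] at h
    linarith

end PlaneGraph

end PlanarFlow

end

/-! ### Flows from `S` to `T` and dual distances in the finite cover -/

noncomputable section

namespace PlanarFlow

open scoped Classical

namespace PlaneGraph

variable {V D F : Type*} {G : PlaneGraph V D F} {a b : D} {L : List D} {k : ℕ}

/-- Splitting the outer face at `S` and `T` gives every flow from `S` to `T` a potential: the two
parts of the outer face differ by the value of the flow. -/
lemma exists_split_potential [Fintype D] (hst : G.tail a ≠ G.tail b)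
    (hL : G.IsSimplePath (G.tail a) L (G.tail b)) {w : G.STDart L k → ℝ} {r : ℝ}
    (hw : ∀ x, w ((G.coverST a b L k).rev x) = - w x)
    (hn : ∀ y, (G.coverST a b L k).net w y =
      r * ((if y = .T then 1 else 0) - (if y = .S then 1 else 0))) :
    ∃ p : F × Fin k ⊕ Bool → ℝ, p (.inr false) = 0 ∧ p (.inr true) = r ∧
      ∀ x, w x = (G.coverSTSplit a b L k).potFlow p x := by
  have hV := G.finite_vertex
  have hF := G.finite_face
  let e : F × Fin k ⊕ Bool → ℝ := fun y => if y = .inr true then r else 0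
  have hE : ∀ y, (G.coverST a b L k).net ((G.coverSTSplit a b L k).potFlow e) y =
      r * ((if y = .T then 1 else 0) - (if y = .S then 1 else 0)) := by
    intro y
    change (G.coverSTSplit a b L k).net ((G.coverSTSplit a b L k).potFlow e) y = _
    match y with
    | .vertex v => rw [net_potFlow_vertex hst hL]; simp
    | .S => rw [net_potFlow_S]; simp [e]
    | .T => rw [net_potFlow_T]; simp [e]
  obtain ⟨q, hq0, hq⟩ := (coverST_isSphere (k := k) hst hL).exists_potential_zero none
    (w := fun x => w x - (G.coverSTSplit a b L k).potFlow e x)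
    (fun x => by
      have h := (G.coverSTSplit a b L k).potFlow_rev e x
      change w _ - (G.coverSTSplit a b L k).potFlow e ((G.coverSTSplit a b L k).rev x) = _
      rw [hw, h]; ring)
    (fun y => by rw [DartGraph.net_sub, hE, hn, sub_self])
  refine ⟨fun y => q y.getLeft? + e y, ?_, ?_, fun x => ?_⟩
  · simp [hq0, e]
  · simp [hq0, e]
  · rw [FacedGraph.potFlow_add]
    have h1 : (G.coverSTSplit a b L k).potFlow (fun y => q y.getLeft?) x =
        (G.coverST a b L k).potFlow q x := rfl
    rw [h1, ← hq x]; ring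

lemma split_dual_connected [Fintype D] (hst : G.tail a ≠ G.tail b)
    (hL : G.IsSimplePath (G.tail a) L (G.tail b)) (q : F × Fin k ⊕ Bool → ℝ)
    (hq : ∀ x, q ((G.coverSTSplit a b L k).right x) = q ((G.coverSTSplit a b L k).left x))
    (y z : F × Fin k ⊕ Bool) : q y = q z := by
  have h1 : q (.inr true) = q (.inr false) := by
    rw [← sub_eq_zero, ← sum_potFlow_arcs q (G.right a)]
    exact Finset.sum_eq_zero fun i _ => sub_eq_zero.2 (hq (.source i))
  let q' : Option (F × Fin k) → ℝ := fun y => y.elim (q (.inr false)) fun z => q (.inl z)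
  have h2 : ∀ y, q' y.getLeft? = q y := by
    rintro (y | _ | _)
    · rfl
    · rfl
    · exact h1.symm
  have h3 := (coverST_isSphere (k := k) hst hL).dual_connected q' fun x => by
    change q' ((G.coverSTSplit a b L k).right x).getLeft? =
      q' ((G.coverSTSplit a b L k).left x).getLeft?
    rw [h2, h2, hq]
  rw [← h2 y, ← h2 z]
  exact h3 _ _

lemma exists_split_dualWalk [Fintype D] (hst : G.tail a ≠ G.tail b)
    (hL : G.IsSimplePath (G.tail a) L (G.tail b)) (y z : F × Fin k ⊕ Bool) :
    ∃ l, (G.coverSTSplit a b L k).IsDualWalk y l z :=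
  FacedGraph.exists_dualWalk _ (split_dual_connected hst hL) y z

/-- The distances from the left part of the outer face give a leftmost maximum flow, whose value is
the distance between the two parts. -/
lemma isLeftmostMaxFlow_dualFlow [Fintype D] (hst : G.tail a ≠ G.tail b)
    (hL : G.IsSimplePath (G.tail a) L (G.tail b)) {C : G.STDart L k → ℝ} (hC : ∀ x, 0 ≤ C x) :
    (G.coverST a b L k).IsLeftmostMaxFlow none C .S .T
      ((G.coverSTSplit a b L k).dualFlow C (.inr false)) := by
  have hV := G.finite_vertex
  have hr := exists_split_dualWalk (k := k) hst hL (.inr false)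
  have hST : (STVertex.S : G.STVertex a b L k) ≠ .T := by intro h; cases h
  set p := (G.coverSTSplit a b L k).dualDist C (.inr false) with hp
  have hp0 : p (.inr false) = 0 := FacedGraph.dualDist_self hC
  have hrev : ∀ x, (G.coverSTSplit a b L k).dualFlow C (.inr false) ((G.coverST a b L k).rev x) =
      - (G.coverSTSplit a b L k).dualFlow C (.inr false) x :=
    fun x => (G.coverSTSplit a b L k).potFlow_rev p x
  have hnet : ∀ y, (G.coverST a b L k).net ((G.coverSTSplit a b L k).dualFlow C (.inr false)) y =
      p (.inr true) * ((if y = .T then 1 else 0) - (if y = .S then 1 else 0)) := by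
    intro y
    change (G.coverSTSplit a b L k).net ((G.coverSTSplit a b L k).potFlow p) y = _
    match y with
    | .vertex v => rw [net_potFlow_vertex hst hL]; simp
    | .S => rw [net_potFlow_S]; simp [hp0]
    | .T => rw [net_potFlow_T]; simp [hp0]
  have hnn : 0 ≤ p (.inr true) :=
    FacedGraph.le_dualDist hr (p := fun _ => 0) rfl
      (fun d => by simpa [FacedGraph.potFlow] using hC d)
      (.inr true)
  refine ⟨⟨DartGraph.isFlow_of_net _ ⟨hrev, FacedGraph.dualFlow_le hC hr⟩ hnn hnet, ?_⟩, ?_⟩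
  · intro g hg
    obtain ⟨p', h0, h1, h2⟩ := exists_split_potential hst hL hg.1.1 (hg.net_eq hST)
    rw [DartGraph.value_of_net _ hST hnet, ← h1]
    exact FacedGraph.le_dualDist hr h0 (fun d => by rw [← h2]; exact hg.1.2 d) _
  · rintro l ⟨hl, q, hq0, hq, hql⟩
    exact FacedGraph.exists_not_residual hC hr
      (show (G.coverSTSplit a b L k).IsSimpleCycle l from hl) (q := fun y => q y.getLeft?) hq0
      (fun _ => hq _) hql

lemma stCap_nonneg {c : D → ℝ} (hc : ∀ d, 0 ≤ c d) {M : ℝ} (hM : 0 ≤ M) (x : G.STDart L k) :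
    0 ≤ G.stCap c M x := by
  cases x
  · exact hc _
  · exact hM
  · exact le_rfl
  · exact hM
  · exact le_rfl

/-- The lifted dual of a dart. A dart off `L` at the left end of the cover has no lift, but there
all faces are the same. -/
lemma potential_step {c : D → ℝ} (hc : ∀ d, 0 ≤ c d) {M : ℝ} {p : F × Fin k ⊕ Bool → ℝ}
    (hL : ∀ d ∈ L, G.rev d ∉ L) (hp : ∀ x, (G.coverSTSplit a b L k).potFlow p x ≤ G.stCap c M x)
    {d : D} {i j : ℕ} (hi : i ≤ k) (hj : j ≤ k)
    (hij : i + (if d ∈ L then 1 else 0) = j + (if G.rev d ∈ L then 1 else 0)) :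
    p (copyFace k (G.right d) j) ≤ p (copyFace k (G.left d) i) + c d := by
  have key : ∀ x : G.CoverDart L k,
      p (copyFace k (G.right x.1.1) (if G.rev x.1.1 ∈ L then x.1.2.val else x.1.2.val + 1)) ≤
      p (copyFace k (G.left x.1.1) (if x.1.1 ∈ L then x.1.2.val else x.1.2.val + 1)) + c x.1.1 := by
    intro x
    have h := hp (.dart x)
    rw [FacedGraph.potFlow, coverSTSplit_left_dart] at h
    have h' : p (copyFace k (G.right x.1.1)
      (if G.rev x.1.1 ∈ L then x.1.2.val else x.1.2.val + 1)) - _ ≤ c x.1.1 := h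
    linarith
  by_cases h1 : d ∈ L
  · have h2 := hL d h1
    have h := key ⟨(d, ⟨i, by omega⟩), Or.inr (Or.inl h1)⟩
    simp only [h1, h2, if_true, if_false] at h hij
    rwa [← show i + 1 = j by omega]
  · by_cases h2 : G.rev d ∈ L
    · have h := key ⟨(d, ⟨j, by omega⟩), Or.inr (Or.inr h2)⟩
      simp only [h1, h2, if_true, if_false] at h hij
      rwa [show i = j + 1 by omega]
    · simp only [h1, h2, if_false, add_zero] at hij
      subst hij
      cases i with
      | zero => rw [copyFace_zero, copyFace_zero]; linarith [hc d]
      | succ i =>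
        have h := key ⟨(d, ⟨i, by omega⟩), Or.inl (by simp only; omega)⟩
        simpa only [h1, h2, if_false] using h

/-- A dual walk lifts to the finite cover if the numbers of the copies that it passes through are in
range. -/
lemma potential_walk {c : D → ℝ} (hc : ∀ d, 0 ≤ c d) {M : ℝ} {p : F × Fin k ⊕ Bool → ℝ}
    (hL : ∀ d ∈ L, G.rev d ∉ L) (hp : ∀ x, (G.coverSTSplit a b L k).potFlow p x ≤ G.stCap c M x)
    {l : List D} {x y : F} (hl : G.IsDualWalk x l y) {i j : ℕ} (hi : i ≤ k)
    (hpre : ∀ m, m <+: l → 0 ≤ i + G.winding L m ∧ i + G.winding L m ≤ k)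
    (hj : (j : ℤ) = i + G.winding L l) :
    p (copyFace k y j) ≤ p (copyFace k x i) + (l.map c).sum := by
  induction l generalizing x i with
  | nil =>
    cases hl
    have : j = i := by simpa [winding] using hj
    simp [this]
  | cons d l ih =>
    obtain ⟨rfl, h2⟩ := hl
    have hw : ∀ m, G.winding L (d :: m) = G.cross L d + G.winding L m := fun m => by simp [winding]
    have h0 : G.winding L [] = 0 := rfl
    have h3 := hpre [d] (by simp)
    rw [hw, h0, add_zero] at h3
    obtain ⟨i', hi'⟩ := Int.eq_ofNat_of_zero_le h3.1
    have hi'k : i' ≤ k := by omega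
    have h4 := ih h2 hi'k (fun m hm => by
      have := hpre (d :: m) (by simpa using hm)
      rw [hw] at this
      omega) (by rw [hj, hw]; omega)
    have h5 := potential_step hc hL hp (d := d) hi hi'k (by
      rw [cross] at hi'
      split_ifs at hi' ⊢ <;> omega)
    rw [List.map_cons, List.sum_cons]
    linarith

namespace Setting

variable [Fintype D] {c : D → ℝ} {f : D → ℝ} {φ : F → ℝ}

lemma winding_le (S : Setting G a b c L f φ) {x y : F} {l : List D} (hl : G.IsDualWalk x l y)
    (hl' : ∀ d ∈ l, f d = c d) :
    - (2 * G.facesBetween (G.tail a) (G.tail b) : ℤ) ≤ G.winding L l := by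
  have h1 := S.sum_flow hl
  have h2 := S.sum_flow_nonneg hl'
  have h3 := S.potential_nonpos y
  have h4 := S.le_potential x
  have h5 := S.value_pos
  have h6 : - (2 * G.facesBetween (G.tail a) (G.tail b) : ℝ) ≤ G.winding L l := by
    by_contra h
    nlinarith
  exact_mod_cast h6

/-- The distances are at most the potential `φ` plus the value of the flow per copy, along lifts of
saturated walks. -/
lemma dist_le (S : Setting G a b c L f φ) {M : ℝ} {p : F × Fin k ⊕ Bool → ℝ}
    (hp : ∀ x, (G.coverSTSplit a b L k).potFlow p x ≤ G.stCap c M x) {g : F} {l : List D}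
    (hl : G.IsDualWalk (G.right b) l g) (hl' : ∀ d ∈ l, f d = c d) {i j : ℕ}
    (hj : (j : ℤ) = i + G.winding L l)
    (hjk : j + 2 * G.facesBetween (G.tail a) (G.tail b) ≤ k)
    (hi : p (copyFace k (G.right b) i) ≤ G.value f (G.tail a) * i) :
    p (copyFace k g j) ≤ φ g + G.value f (G.tail a) * j := by
  have hw := S.winding_nonneg hl hl'
  have h1 := potential_walk S.nonneg (fun d hd => S.simple.rev_notMem hd) hp hl (i := i) (j := j)
    (by omega) (fun m hm => ?_) hj
  · have h2 := S.sum_flow hl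
    rw [S.potential_zero, sub_zero] at h2
    have h3 : (l.map c).sum = (l.map f).sum :=
      congrArg List.sum (List.map_congr_left fun d hd => (hl' d hd).symm)
    have h4 : (j : ℝ) = i + G.winding L l := by exact_mod_cast hj
    rw [h4]
    linarith
  · -- The winding numbers of both parts of the walk are bounded below, which keeps it in the cover.
    obtain ⟨m', rfl⟩ := hm
    obtain ⟨z, hz1, hz2⟩ := (G.isDualWalk_append).1 hl
    have h2 := S.winding_nonneg hz1 fun d hd => hl' d (by simp [hd])
    have h3 := S.winding_le hz2 fun d hd => hl' d (by simp [hd])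
    rw [winding_append] at hj
    omega

/-- The distances are at least the potential `φ` plus the value of the flow per copy, cut off above
and below. -/
lemma le_dist (S : Setting G a b c L f φ) {M : ℝ} (hM : G.value f (G.tail a) ≤ M)
    (hk : 2 * G.facesBetween (G.tail a) (G.tail b) ≤ k) (g : F) {j : ℕ}
    (hjk : j + 2 * G.facesBetween (G.tail a) (G.tail b) ≤ k + 1) :
    φ g + G.value f (G.tail a) * j ≤
      (G.coverSTSplit a b L k).dualDist (G.stCap c M) (.inr false) (copyFace k g j) := by
  set r := G.value f (G.tail a) with hr
  set n := G.facesBetween (G.tail a) (G.tail b) with hn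
  have hr0 : 0 < r := S.value_pos
  set β : ℝ := r * (k + 1 - 2 * n) with hβ
  have hβ0 : 0 ≤ β := by
    have : (2 * n : ℝ) ≤ k := by exact_mod_cast hk
    refine mul_nonneg hr0.le (by linarith)
  let Q : F → ℕ → ℝ := fun g j => max 0 (min (φ g + r * j) β)
  let q : F × Fin k ⊕ Bool → ℝ := fun y => match y with
    | .inl z => Q z.1 (z.2 + 1)
    | .inr false => 0
    | .inr true => β
  have hq : ∀ g j, j ≤ k + 1 → q (copyFace k g j) = Q g j := by
    intro g j hj
    rcases Nat.eq_zero_or_pos j with rfl | h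
    · rw [copyFace_zero]
      have := S.potential_nonpos g
      refine (max_eq_left (min_le_of_left_le ?_)).symm
      simpa using this
    · obtain ⟨i, rfl⟩ := Nat.exists_eq_succ_of_ne_zero h.ne'
      rcases Nat.lt_or_ge i k with h1 | h1
      · rw [Nat.succ_eq_add_one, copyFace_succ g h1]
      · obtain rfl : i = k := by omega
        rw [Nat.succ_eq_add_one, copyFace_top]
        have h2 := S.le_potential g
        have h3 : β ≤ φ g + r * ((i + 1 : ℕ) : ℝ) := by
          rw [hβ]; push_cast; linarith
        change β = max 0 (min (φ g + r * ((i + 1 : ℕ) : ℝ)) β)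
        rw [min_eq_right h3, max_eq_right hβ0]
  -- Cutting off the potential is monotone and does not increase differences.
  have hlip : ∀ x y : ℝ, max 0 (min x β) - max 0 (min y β) ≤ max (x - y) 0 := by
    intro x y
    have h1 : max 0 (min x β) ≤ max 0 (min y β) + max (x - y) 0 := by
      refine max_le (add_nonneg (le_max_left _ _) (le_max_right _ _)) ?_
      rcases le_total y β with h | h
      · rw [min_eq_left h]
        have := le_max_left (x - y) 0
        have := le_max_right 0 y
        linarith [min_le_left x β]
      · rw [min_eq_right h]
        have := le_max_right (x - y) 0
        have := le_max_right 0 β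
        linarith [min_le_right x β]
    linarith
  have hfeas : ∀ x, (G.coverSTSplit a b L k).potFlow q x ≤ G.stCap c M x := by
    intro x
    have hstep : ∀ g (i : Fin (k + 1)), q (copyFace k g (i.val + 1)) - q (copyFace k g i.val) ≤ r ∧
        q (copyFace k g i.val) - q (copyFace k g (i.val + 1)) ≤ 0 := by
      intro g i
      rw [hq g _ (by omega), hq g _ (by omega)]
      constructor
      · refine (hlip _ _).trans (max_le ?_ hr0.le)
        push_cast; linarith
      · refine (hlip _ _).trans (max_le ?_ le_rfl)
        push_cast; linarith
    match x with
    | .source i => exact (hstep _ i).1.trans hM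
    | .sourceRev i => exact (hstep _ i).2
    | .sink i => exact (hstep _ i).1.trans hM
    | .sinkRev i => exact (hstep _ i).2
    | .dart x =>
      change q (copyFace k (G.right x.1.1) (if G.rev x.1.1 ∈ L then x.1.2.val else x.1.2.val + 1))
        - q ((G.coverSTSplit a b L k).left (.dart x)) ≤ c x.1.1
      rw [coverSTSplit_left_dart, hq _ _ (by split_ifs <;> omega), hq _ _ (by split_ifs <;> omega)]
      refine (hlip _ _).trans (max_le ?_ (S.nonneg _))
      refine le_trans (le_of_eq ?_) (S.le x.1.1)
      rw [S.flow_eq x.1.1, S.simple.along_eq, FacedGraph.potFlow]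
      split_ifs <;> push_cast <;> ring
  have h := FacedGraph.le_dualDist (exists_split_dualWalk S.ne S.simple (.inr false)) (p := q) rfl
    hfeas (copyFace k g j)
  rw [hq g j (by omega)] at h
  refine le_trans ?_ h
  refine le_max_of_le_right (le_min le_rfl ?_)
  have h1 := S.potential_nonpos g
  have h2 : (j : ℝ) + 2 * n ≤ k + 1 := by exact_mod_cast hjk
  have h3 : r * j ≤ β := mul_le_mul_of_nonneg_left (by linarith) hr0.le
  linarith

lemma dualDist_feasible (S : Setting G a b c L f φ) {M : ℝ} (hM : 0 ≤ M) (x : G.STDart L k) :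
    (G.coverSTSplit a b L k).potFlow
      ((G.coverSTSplit a b L k).dualDist (G.stCap c M) (.inr false)) x ≤ G.stCap c M x :=
  FacedGraph.dualFlow_le (stCap_nonneg S.nonneg hM)
    (exists_split_dualWalk S.ne S.simple (.inr false)) x

/-- In the middle of the cover, the distances for the capacities that are capped at the value of the
flow are given by the potential `φ`. -/
lemma dist_eq (S : Setting G a b c L f φ) (g : F) {j : ℕ}
    (hj : 2 * G.facesBetween (G.tail a) (G.tail b) ≤ j)
    (hjk : j + 2 * G.facesBetween (G.tail a) (G.tail b) ≤ k) :
    (G.coverSTSplit a b L k).dualDist (G.stCap c (G.value f (G.tail a))) (.inr false)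
      (copyFace k g j) = φ g + G.value f (G.tail a) * j := by
  have hr := S.value_pos
  have hfeas := S.dualDist_feasible (k := k) hr.le
  refine le_antisymm ?_ (S.le_dist le_rfl (by omega) g (by omega))
  obtain ⟨l, hl, hl', hw⟩ := S.exists_saturated_walk_winding_le g
  have hw0 := S.winding_nonneg hl hl'
  obtain ⟨i, hi⟩ := Int.eq_ofNat_of_zero_le (show 0 ≤ (j : ℤ) - G.winding L l by omega)
  -- The walk starts at a copy of the infinite face, which is reached across the sink arcs.
  refine S.dist_le hfeas hl hl' (i := i) (by omega) hjk ?_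
  have hik : i ≤ k + 1 := by omega
  clear hi
  induction i with
  | zero =>
    rw [copyFace_zero, FacedGraph.dualDist_self (stCap_nonneg S.nonneg hr.le)]
    simp
  | succ i ih =>
    have h1 := ih (by omega)
    have h2 := hfeas (.sink ⟨i, by omega⟩)
    have h3 : _ - _ ≤ G.value f (G.tail a) := h2
    change (G.coverSTSplit a b L k).dualDist (G.stCap c (G.value f (G.tail a))) (.inr false)
      (copyFace k (G.right b) (i + 1)) - (G.coverSTSplit a b L k).dualDist
      (G.stCap c (G.value f (G.tail a))) (.inr false) (copyFace k (G.right b) i) ≤ _ at h3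
    push_cast
    linarith

lemma dualFlow_dart (S : Setting G a b c L f φ) (x : G.CoverDart L k)
    (hx : 2 * G.facesBetween (G.tail a) (G.tail b) ≤ x.1.2.val)
    (hxk : x.1.2.val + 2 * G.facesBetween (G.tail a) (G.tail b) < k) :
    (G.coverSTSplit a b L k).dualFlow (G.stCap c (G.value f (G.tail a))) (.inr false) (.dart x) =
      f x.1.1 := by
  rw [FacedGraph.dualFlow, coverSTSplit_left_dart]
  change (G.coverSTSplit a b L k).dualDist _ _ (copyFace k (G.right x.1.1)
    (if G.rev x.1.1 ∈ L then x.1.2.val else x.1.2.val + 1)) - _ = _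
  rw [S.dist_eq _ (by split_ifs <;> omega) (by split_ifs <;> omega),
    S.dist_eq _ (by split_ifs <;> omega) (by split_ifs <;> omega), S.flow_eq x.1.1,
    S.simple.along_eq, FacedGraph.potFlow]
  split_ifs <;> push_cast <;> ring

/-- The flow on a middle source arc does not depend on the capacities of these arcs, if they are
large enough. -/
lemma dualFlow_source (S : Setting G a b c L f φ) {M : ℝ} (hM : G.value f (G.tail a) ≤ M)
    (hk : 4 * G.facesBetween (G.tail a) (G.tail b) + 1 ≤ k) {i : Fin (k + 1)}
    (hi : i.val = 2 * G.facesBetween (G.tail a) (G.tail b)) :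
    (G.coverSTSplit a b L k).dualFlow (G.stCap c M) (.inr false) (.source i) =
      G.value f (G.tail a) := by
  have hM0 := S.value_pos.le.trans hM
  have key : ∀ j : ℕ, 2 * G.facesBetween (G.tail a) (G.tail b) ≤ j →
      j + 2 * G.facesBetween (G.tail a) (G.tail b) ≤ k →
      (G.coverSTSplit a b L k).dualDist (G.stCap c M) (.inr false) (copyFace k (G.right a) j) =
        φ (G.right a) + G.value f (G.tail a) * j := by
    intro j hj hjk
    refine le_antisymm ?_ (S.le_dist hM (by omega) _ (by omega))
    obtain ⟨l, hl, hl', hw⟩ := S.exists_saturated_walk_winding_eq (w := j) (by exact_mod_cast hj)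
    -- Only the left part of the outer face is known to have a small distance for large capacities.
    refine S.dist_le (S.dualDist_feasible hM0) hl hl' (i := 0) (by simp [hw]) hjk ?_
    rw [copyFace_zero, FacedGraph.dualDist_self (stCap_nonneg S.nonneg hM0)]
    simp
  change (G.coverSTSplit a b L k).dualDist _ _ (copyFace k (G.right a) (i.val + 1)) -
    (G.coverSTSplit a b L k).dualDist _ _ (copyFace k (G.right a) i.val) = _
  rw [key _ (by omega) (by omega), key _ (by omega) (by omega)]
  push_cast
  ring

end Setting

end PlaneGraph

end PlanarFlow

end

/-! ### Flow cancelling -/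

noncomputable section

namespace PlanarFlow

open scoped Classical

namespace DartGraph

variable {V D : Type*} {G : DartGraph V D}

/-- Every closed walk along darts with positive flow is trivial. -/
def FlowAcyclic (G : DartGraph V D) (f : D → ℝ) : Prop :=
  ∀ u l, G.IsWalk u l u → (∀ d ∈ l, 0 < f d) → l = []

/-- The flow `f₁` has the direction of `f₀` or vanishes on every dart, and it is not larger. -/
def Conformal (G : DartGraph V D) (f₀ f₁ : D → ℝ) : Prop :=
  (∀ d, f₁ (G.rev d) = - f₁ d) ∧ ∀ d, 0 ≤ f₀ d → 0 ≤ f₁ d ∧ f₁ d ≤ f₀ d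

lemma Conformal.trans {f₀ f₁ f₂ : D → ℝ} (h : G.Conformal f₀ f₁) (h' : G.Conformal f₁ f₂) :
    G.Conformal f₀ f₂ :=
  ⟨h'.1, fun d hd => ⟨(h'.2 d (h.2 d hd).1).1, (h'.2 d (h.2 d hd).1).2.trans (h.2 d hd).2⟩⟩

lemma Conformal.nonpos {f₀ f₁ : D → ℝ} (hf : ∀ d, f₀ (G.rev d) = - f₀ d) (h : G.Conformal f₀ f₁)
    {d : D} (hd : f₀ d ≤ 0) : f₀ d ≤ f₁ d ∧ f₁ d ≤ 0 := by
  have h1 := h.2 (G.rev d) (by rw [hf]; linarith)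
  rw [hf, h.1] at h1
  constructor <;> linarith [h1.1, h1.2]

lemma Conformal.pos {f₀ f₁ : D → ℝ} (hf : ∀ d, f₀ (G.rev d) = - f₀ d) (h : G.Conformal f₀ f₁)
    {d : D} (hd : 0 < f₁ d) : 0 < f₀ d := by
  by_contra h1
  linarith [(h.nonpos hf (not_lt.1 h1)).2]

lemma conformal_of_path {f : D → ℝ} (hf : ∀ d, f (G.rev d) = - f d) {u v : V} {l : List D}
    (hl : G.IsSimplePath u l v) {δ : ℝ} (hδ : 0 < δ) (hle : ∀ d ∈ l, δ ≤ f d) :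
    G.Conformal f fun d => f d - δ * G.along l d := by
  refine ⟨fun d => by simp only [hf, G.along_rev]; ring, fun d hd => ?_⟩
  simp only [hl.along_eq]
  by_cases h1 : d ∈ l
  · have := hle d h1
    rw [if_pos h1, if_neg (hl.rev_notMem h1)]
    constructor <;> linarith
  · by_cases h2 : G.rev d ∈ l
    · have := hle _ h2
      rw [hf] at this
      linarith
    · rw [if_neg h1, if_neg h2]
      constructor <;> linarith

lemma FlowAcyclic.isSimplePath {f : D → ℝ} (hac : G.FlowAcyclic f) {u v : V} {l : List D}
    (hl : G.IsWalk u l v) (hpos : ∀ d ∈ l, 0 < f d) : G.IsSimplePath u l v := by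
  refine ⟨hl, ?_⟩
  induction l generalizing u with
  | nil => simp
  | cons d l ih =>
    have h1 := ih hl.2 fun e he => hpos e (List.mem_cons_of_mem _ he)
    rw [List.map_cons, List.cons_append, List.nodup_cons]
    refine ⟨fun h => ?_, h1⟩
    obtain ⟨l1, l2, rfl, h2, -⟩ := G.isWalk_suffix_of_mem hl.2 h
    exact absurd (hac (G.tail d) (d :: l1) ⟨rfl, h2⟩ fun e he => hpos e (by
      rcases List.mem_cons.1 he with rfl | he <;> simp [*])) (by simp)

lemma flowAcyclic_of_simpleCycle {f : D → ℝ} (hf : ∀ d, f (G.rev d) = - f d)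
    (h : ∀ C, G.IsSimpleCycle C → ¬ ∀ d ∈ C, 0 < f d) : G.FlowAcyclic f := by
  intro u l hl hpos
  by_contra hne
  obtain ⟨m, hm, hml⟩ := hl.exists_simpleCycle hne fun d hd hd' => by
    have h1 := hpos d hd
    have h2 := hpos _ hd'
    rw [hf] at h2
    linarith
  exact h m hm fun d hd => hpos d (hml hd)

section Fintype

variable [Fintype D]

lemma net_sub_along {f : D → ℝ} {u v : V} {l : List D} (hl : G.IsWalk u l v) (δ : ℝ) (y : V) :
    G.net (fun d => f d - δ * G.along l d) y =
      G.net f y - δ * ((if y = v then 1 else 0) - (if y = u then 1 else 0)) := by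
  rw [G.net_sub f fun d => δ * G.along l d, G.net_smul, G.net_along hl]

lemma CancelStep.conformal {S T : Set V} {f f' : D → ℝ} (hf : ∀ d, f (G.rev d) = - f d)
    (h : G.CancelStep S T f f') : G.Conformal f f' := by
  obtain ⟨u, v, l, δ, hl, hδ, hle, -, -, -, rfl⟩ := h
  exact conformal_of_path hf hl hδ hle

/-- Away from the terminals, flow cancelling only reduces deficits and excesses. -/
lemma CancelStep.net_imp {S T : Set V} {f f' : D → ℝ} (h : G.CancelStep S T f f') {y : V}
    (hS : y ∉ S) (hT : y ∉ T) :
    (0 < G.net f' y → 0 < G.net f y) ∧ (G.net f' y < 0 → G.net f y < 0) := by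
  obtain ⟨u, v, l, δ, hl, hδ, hle, hu, hv, huv, rfl⟩ := h
  rw [net_sub_along hl.1]
  by_cases h1 : y = v
  · have h2 : δ ≤ G.net f y := by
      rw [h1] at hT ⊢; exact (hv.resolve_left hT).2
    by_cases h3 : y = u
    · have h4 : G.net f y ≤ -δ := by
        rw [h3] at hS ⊢; exact (hu.resolve_left hS).2
      linarith
    · rw [if_pos h1, if_neg h3]
      constructor <;> intro <;> linarith
  · by_cases h3 : y = u
    · have h4 : G.net f y ≤ -δ := by
        rw [h3] at hS ⊢; exact (hu.resolve_left hS).2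
      rw [if_neg h1, if_pos h3]
      constructor <;> intro <;> linarith
    · rw [if_neg h1, if_neg h3]
      constructor <;> intro <;> linarith

lemma exists_walk_from_deficit [Finite V] {f : D → ℝ} (hf : ∀ d, f (G.rev d) = - f d) {v : V}
    (hv : 0 < G.net f v) :
    ∃ u l, G.net f u < 0 ∧ G.IsSimplePath u l v ∧ ∀ d ∈ l, 0 < f d := by
  have := Fintype.ofFinite V
  let Y : Set V := {x | ∃ l, G.IsWalk x l v ∧ ∀ d ∈ l, 0 < f d}
  by_contra hcon
  push Not at hcon
  have h1 : ∀ x ∈ Y, 0 ≤ G.net f x := by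
    rintro x ⟨l, hl, hpos⟩
    by_contra h
    obtain ⟨m, hm, hml⟩ := hl.exists_simplePath
    obtain ⟨d, hd, h2⟩ := hcon x m (not_le.1 h) hm
    linarith [hpos d (hml hd)]
  have h2 : 0 < ∑ x with x ∈ Y, G.net f x :=
    Finset.sum_pos' (fun x hx => h1 x (by simpa using hx))
      ⟨v, by simpa using ⟨[], rfl, by simp⟩, hv⟩
  rw [G.sum_net hf] at h2
  refine absurd h2 (not_lt.2 (Finset.sum_nonpos fun d hd => ?_))
  simp only [Finset.mem_filter, Finset.mem_univ, true_and] at hd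
  by_contra h3
  obtain ⟨⟨l, hl, hpos⟩, h4⟩ := hd
  refine h4 ⟨d :: l, ⟨rfl, hl⟩, fun e he => ?_⟩
  rcases List.mem_cons.1 he with rfl | he
  · exact not_le.1 h3
  · exact hpos e he

lemma exists_walk_to_excess [Finite V] {f : D → ℝ} (hf : ∀ d, f (G.rev d) = - f d) {u : V}
    (hu : G.net f u < 0) :
    ∃ v l, 0 < G.net f v ∧ G.IsSimplePath u l v ∧ ∀ d ∈ l, 0 < f d := by
  have hneg : ∀ y, G.net (fun d => - f d) y = - G.net f y := fun y => by
    simp [net]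
  obtain ⟨v, l, hv, hl, hpos⟩ := exists_walk_from_deficit (G := G) (f := fun d => - f d)
    (fun d => by rw [hf]) (v := u) (by rw [hneg]; linarith)
  refine ⟨v, _, by rw [hneg] at hv; linarith, hl.reverse, fun d hd => ?_⟩
  rw [List.mem_reverse, List.mem_map] at hd
  obtain ⟨e, he, rfl⟩ := hd
  have := hpos e he
  rwa [hf]

/-- Cancelling flow on a path as far as possible removes a dart of the flow or makes a vertex
balanced, so that flow cancelling terminates. -/
lemma exists_cancelled [Finite V] {f : D → ℝ} (hf : ∀ d, f (G.rev d) = - f d) {S T : Set V}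
    (hS : ∀ v ∈ S, G.net f v ≤ 0) (hT : ∀ v ∈ T, 0 ≤ G.net f v) :
    ∃ f', Relation.ReflTransGen (G.CancelStep S T) f f' ∧
      (∀ v, G.net f' v < 0 → v ∈ S) ∧ ∀ v, 0 < G.net f' v → v ∈ T := by
  have := Fintype.ofFinite V
  induction hn : (Finset.univ.filter fun d => 0 < f d).card +
      (Finset.univ.filter fun v => G.net f v ≠ 0).card using Nat.strong_induction_on
    generalizing f with
  | _ n ih =>
    by_cases hdone : (∀ v, G.net f v < 0 → v ∈ S) ∧ ∀ v, 0 < G.net f v → v ∈ T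
    · exact ⟨f, .refl, hdone⟩
    · obtain ⟨u, v, l, hu, hv, hl, hpos, huv⟩ : ∃ u v l, G.net f u < 0 ∧ 0 < G.net f v ∧
          G.IsSimplePath u l v ∧ (∀ d ∈ l, 0 < f d) ∧ ¬ (u ∈ S ∧ v ∈ T) := by
        rw [not_and_or] at hdone
        push Not at hdone
        rcases hdone with ⟨u, hu, huS⟩ | ⟨v, hv, hvT⟩
        · obtain ⟨v, l, hv, hl, hpos⟩ := exists_walk_to_excess hf hu
          exact ⟨u, v, l, hu, hv, hl, hpos, fun h => huS h.1⟩
        · obtain ⟨u, l, hu, hl, hpos⟩ := exists_walk_from_deficit hf hv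
          exact ⟨u, v, l, hu, hv, hl, hpos, fun h => hvT h.2⟩
      have huv' : u ≠ v := fun h => by rw [h] at hu; linarith
      obtain ⟨δ, hδ, hδl, hδv, hδu, hδe⟩ : ∃ δ, 0 < δ ∧ (∀ d ∈ l, δ ≤ f d) ∧ δ ≤ G.net f v ∧
          δ ≤ - G.net f u ∧ ((∃ d ∈ l, δ = f d) ∨ δ = G.net f v ∨ δ = - G.net f u) := by
        let A : Finset ℝ := insert (G.net f v) (insert (- G.net f u) (l.toFinset.image f))
        have hA : A.Nonempty := ⟨_, Finset.mem_insert_self _ _⟩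
        have hmem := A.min'_mem hA
        simp only [A, Finset.mem_insert, Finset.mem_image, List.mem_toFinset] at hmem
        refine ⟨A.min' hA, ?_, ?_, ?_, ?_, ?_⟩
        · rw [Finset.lt_min'_iff]
          intro y hy
          simp only [A, Finset.mem_insert, Finset.mem_image, List.mem_toFinset] at hy
          rcases hy with rfl | rfl | ⟨d, hd, rfl⟩
          · exact hv
          · linarith
          · exact hpos d hd
        · exact fun d hd => A.min'_le _ (by simp [A]; exact Or.inr (Or.inr ⟨d, hd, rfl⟩))
        · exact A.min'_le _ (by simp [A])
        · exact A.min'_le _ (by simp [A])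
        · rcases hmem with h | h | ⟨d, hd, h⟩
          · exact Or.inr (Or.inl h)
          · exact Or.inr (Or.inr h)
          · exact Or.inl ⟨d, hd, h.symm⟩
      set f' : D → ℝ := fun d => f d - δ * G.along l d with hf'
      have hstep : G.CancelStep S T f f' := by
        refine ⟨u, v, l, δ, hl, hδ, hδl, Or.inr ⟨fun h => ?_, by linarith⟩,
          Or.inr ⟨fun h => ?_, hδv⟩, huv, rfl⟩
        · linarith [hT u h]
        · linarith [hS v h]
      have hcon := hstep.conformal hf
      have hnet : ∀ y, G.net f' y =
          G.net f y - δ * ((if y = v then 1 else 0) - (if y = u then 1 else 0)) :=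
        net_sub_along hl.1 δ
      have hshrink : ∀ y, (G.net f y ≤ 0 → G.net f' y ≤ 0) ∧ (0 ≤ G.net f y → 0 ≤ G.net f' y) := by
        intro y
        rw [hnet]
        by_cases h1 : y = v
        · rw [if_pos h1, if_neg (fun h => huv' (h.symm.trans h1)), h1]
          constructor <;> intro <;> linarith
        · by_cases h2 : y = u
          · rw [if_neg h1, if_pos h2, h2]
            constructor <;> intro <;> linarith
          · rw [if_neg h1, if_neg h2]
            constructor <;> intro <;> linarith
      have hsub1 : (Finset.univ.filter fun d => 0 < f' d) ⊆
          Finset.univ.filter fun d => 0 < f d := by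
        intro d hd
        simp only [Finset.mem_filter, Finset.mem_univ, true_and] at hd ⊢
        exact hcon.pos hf hd
      have hsub2 : (Finset.univ.filter fun y => G.net f' y ≠ 0) ⊆
          Finset.univ.filter fun y => G.net f y ≠ 0 := by
        intro y hy
        simp only [Finset.mem_filter, Finset.mem_univ, true_and] at hy ⊢
        intro h
        exact hy (le_antisymm ((hshrink y).1 h.le) ((hshrink y).2 h.ge))
      have hlt : (Finset.univ.filter fun d => 0 < f' d).card +
          (Finset.univ.filter fun v => G.net f' v ≠ 0).card < n := by
        rw [← hn]
        rcases hδe with ⟨d, hd, h⟩ | h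
        · refine add_lt_add_of_lt_of_le (Finset.card_lt_card
            (Finset.ssubset_iff_of_subset hsub1 |>.2
            ⟨d, by simpa using hpos d hd, ?_⟩)) (Finset.card_le_card hsub2)
          simp [hf', hl.along_eq_one hd, h]
        · refine add_lt_add_of_le_of_lt (Finset.card_le_card hsub1)
            (Finset.card_lt_card (Finset.ssubset_iff_of_subset hsub2 |>.2 ?_))
          rcases h with h | h
          · refine ⟨v, by simpa using hv.ne', ?_⟩
            simp [hnet, huv'.symm, h]
          · refine ⟨u, by simpa using hu.ne, ?_⟩
            simp [hnet, huv', h]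
      obtain ⟨f'', h1, h2⟩ := ih _ hlt hcon.1 (fun y hy => (hshrink y).1 (hS y hy))
        (fun y hy => (hshrink y).2 (hT y hy)) rfl
      exact ⟨f'', h1.head hstep, h2⟩

/-- Along an acyclic flow, every flow path can be continued up to the only vertex with an excess. -/
lemma FlowAcyclic.exists_walk_to {f : D → ℝ} (hac : G.FlowAcyclic f)
    (hf : ∀ d, f (G.rev d) = - f d) {t : V} (hn : ∀ y, y ≠ t → G.net f y ≤ 0) {d : D}
    (hd : 0 < f d) : ∃ l, G.IsWalk (G.head d) l t ∧ ∀ e ∈ l, 0 < f e := by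
  by_contra hcon
  let P : Set D := {e | 0 < f e ∧ ∃ l, G.IsWalk (G.head d) l (G.head e) ∧ ∀ x ∈ l, 0 < f x}
  have hnext : ∀ e ∈ P, ∃ e' ∈ P, G.tail e' = G.head e := by
    rintro e ⟨he, l, hl, hpos⟩
    have h1 : G.head e ≠ t := fun h => hcon ⟨l, h ▸ hl, hpos⟩
    obtain ⟨e', he', h2⟩ := G.exists_pos_out hf he (hn _ h1)
    refine ⟨e', ⟨he', l ++ [e'], G.isWalk_concat.2 ⟨h2 ▸ hl, rfl⟩, fun x hx => ?_⟩, h2⟩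
    rcases List.mem_append.1 hx with hx | hx
    · exact hpos x hx
    · rw [List.mem_singleton.1 hx]; exact he'
  obtain ⟨m, ⟨hne, ⟨u, hu⟩, -⟩, hmP⟩ := G.exists_simpleCycle (P := P) ⟨d, hd, [], rfl, by simp⟩
    (fun e he he' => by
      have h1 := he.1
      have h2 := he'.1
      rw [hf] at h2
      linarith) hnext
  exact hne (hac u m hu fun e he => (hmP e he).1)

lemma FlowAcyclic.exists_walk_from {f : D → ℝ} (hac : G.FlowAcyclic f)
    (hf : ∀ d, f (G.rev d) = - f d) {s : V} (hn : ∀ y, y ≠ s → 0 ≤ G.net f y) {d : D}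
    (hd : 0 < f d) : ∃ l, G.IsWalk s l (G.tail d) ∧ ∀ e ∈ l, 0 < f e := by
  have hrev : ∀ l : List D, (∀ e ∈ l, 0 < - f e) → ∀ e ∈ (l.map G.rev).reverse, 0 < f e := by
    intro l hl e he
    rw [List.mem_reverse, List.mem_map] at he
    obtain ⟨x, hx, rfl⟩ := he
    rw [hf]; exact hl x hx
  obtain ⟨l, hl, hpos⟩ := FlowAcyclic.exists_walk_to (G := G) (f := fun d => - f d) (t := s)
    (d := G.rev d)
    (fun u l hl hpos => by simpa using hac u _ hl.reverse (hrev l hpos))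
    (fun d => by rw [hf]) (fun y hy => by have := hn y hy; simpa [net] using this)
    (by rw [hf]; linarith)
  exact ⟨_, (by simpa [G.head_rev] using hl.reverse), hrev l hpos⟩

end Fintype

end DartGraph

end PlanarFlow

end

/-! ### Flow cancelling in the finite cover -/

noncomputable section

namespace PlanarFlow

open scoped Classical

namespace PlaneGraph

variable {V D F : Type*} {G : PlaneGraph V D F} {a b : D} {L : List D} {k : ℕ}

lemma mem_range_coverSource {v : G.CoverVertex a b L k} :
    v ∈ Set.range (G.coverSource a b L (k := k)) ↔ v.1.1 = G.tail a :=
  ⟨by rintro ⟨i, rfl⟩; rfl, fun h => ⟨⟨v.1.2, Nat.lt_succ_of_le (coverVertex_le v)⟩,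
    coverVertex_ext_iff.2 ⟨h.symm, rfl⟩⟩⟩

lemma mem_range_coverSink {v : G.CoverVertex a b L k} :
    v ∈ Set.range (G.coverSink a b L (k := k)) ↔ v.1.1 = G.tail b :=
  ⟨by rintro ⟨i, rfl⟩; rfl, fun h => ⟨⟨v.1.2, Nat.lt_succ_of_le (coverVertex_le v)⟩,
    coverVertex_ext_iff.2 ⟨h.symm, rfl⟩⟩⟩

lemma cover_isWalk_map {u v : G.CoverVertex a b L k} {l : List (G.CoverDart L k)}
    (h : (G.cover a b L k).IsWalk u l v) : G.IsWalk u.1.1 (l.map fun x => x.1.1) v.1.1 := by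
  induction l generalizing u with
  | nil => exact congrArg (fun y => y.1.1) h
  | cons x l ih =>
    obtain ⟨h1, h2⟩ := h
    refine ⟨?_, ?_⟩
    · rw [← h1, cover_tail_val]
    · have := ih h2
      rwa [cover_head_val] at this

/-- The net flow of the lift of a flow differs from that of the flow by the flow on the darts that
have no lift. -/
lemma net_lift [Fintype D] {f : D → ℝ} (hf : ∀ d, f (G.rev d) = - f d)
    (v : G.CoverVertex a b L k) :
    (G.cover a b L k).net (fun x => f x.1.1) v = G.net f v.1.1 +
      ∑ d with (G.tail d = v.1.1 ∧ ¬ G.Present a b L k v.1.2 d), f d := by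
  rw [DartGraph.net_eq_neg_sum_tail _ (fun x => hf x.1.1), G.net_eq_neg_sum_tail hf,
    sum_cover_tail v (W := fun d => if G.Present a b L k v.1.2 d then f d else 0),
    ← Finset.filter_filter, ← Finset.sum_filter, ← Finset.sum_filter_add_sum_filter_not
      (Finset.univ.filter fun d => G.tail d = v.1.1) (fun d => G.Present a b L k v.1.2 d) f]
  · ring
  · intro x hx
    exact (if_pos ⟨x, rfl, hx⟩).symm
  · intro d _ h
    exact if_neg h

/-- The number of the copy of the face on the right of a dart of the cover. -/
def rightIndex (G : PlaneGraph V D F) {L : List D} {k : ℕ} (x : G.CoverDart L k) : ℝ :=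
  x.1.2.val + 1 - if G.rev x.1.1 ∈ L then 1 else 0

lemma rightIndex_tail {x : G.CoverDart L k} {u : G.CoverVertex a b L k}
    (h : (G.cover a b L k).tail x = u) :
    G.rightIndex x = u.1.2 + 1 - G.rightShift a b L x.1.1 := by
  rw [← h, cover_tail_val, rightIndex, rightShift]
  push_cast
  ring

lemma rightIndex_head {x : G.CoverDart L k} {u : G.CoverVertex a b L k}
    (h : (G.cover a b L k).head x = u) :
    G.rightIndex x = u.1.2 + 1 - G.leftShift a b L (G.rev x.1.1) := by
  rw [← h, cover_head_val, rightIndex, leftShift]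
  push_cast
  ring

section Sides

variable [Finite D] {P : List D} {ψ : F → ℝ}

/-- Between consecutive darts of a path, on its right side, the potential of the path relative to
`L` changes in the same way as the number of the copy in the cover. -/
lemma side_eq (hst : G.tail a ≠ G.tail b) (hL : G.IsSimplePath (G.tail a) L (G.tail b))
    (hP : G.IsSimplePath (G.tail a) P (G.tail b))
    (hψ : ∀ d, G.along P d - G.along L d = G.potFlow ψ d) {d e : D} (hd : d ∈ P) (he : e ∈ P)
    (hde : G.head d = G.tail e) :
    ψ (G.right e) - G.rightShift a b L e = ψ (G.right d) - G.leftShift a b L (G.rev d) := by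
  have h := FacedGraph.orbit_fan G.rot (fun z => ψ (G.right z) - (G.rightShift a b L z : ℝ))
    (fun z => ψ (G.left z) - (G.leftShift a b L z : ℝ)) (d := e) (e := G.rev d)
    ((G.tail_eq_iff _ _).1 (by rw [G.tail_rev, hde])) ?_ ?_
  · rw [h, G.left_rev]
  · intro z hz
    have hz' := (G.tail_eq_iff _ _).2 hz
    have h1 : z ≠ a := fun h => hP.head_ne_start hd (by rw [hde, hz', h])
    have h2 : z ≠ b := fun h => hP.tail_ne_end he (by rw [hz', h])
    simp only [G.left_rot, leftShift_rot_of_ne hst hL h1 h2]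
  · intro z hz hze hzd
    have hz' := (G.tail_eq_iff _ _).2 hz
    have h1 : z ∉ P := fun h => hze (hP.tail_inj h he hz'.symm)
    have h2 : G.rev z ∉ P := fun h => hzd (by
      rw [← hP.head_inj h hd (by rw [G.head_rev, ← hz', hde]), G.rev_rev])
    have h3 := hψ z
    rw [G.along_eq_zero h1 h2, hL.along_eq, FacedGraph.potFlow] at h3
    simp only [rightShift, leftShift]
    push_cast
    linarith

lemma rightIndex_eq_of_end (hst : G.tail a ≠ G.tail b)
    (hL : G.IsSimplePath (G.tail a) L (G.tail b)) (hP : G.IsSimplePath (G.tail a) P (G.tail b))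
    (hψ : ∀ d, G.along P d - G.along L d = G.potFlow ψ d) {l : List (G.CoverDart L k)}
    {u v : G.CoverVertex a b L k} (hl : (G.cover a b L k).IsWalk u l v)
    (hlP : ∀ x ∈ l, x.1.1 ∈ P) {e : D} (he : e ∈ P) (hev : G.tail e = v.1.1) :
    ∀ x ∈ l, ψ (G.right x.1.1) + G.rightIndex x =
      ψ (G.right e) + (v.1.2 + 1 - G.rightShift a b L e) := by
  induction l generalizing u with
  | nil => simp
  | cons y l ih =>
    have h1 := ih hl.2 fun x hx => hlP x (List.mem_cons_of_mem _ hx)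
    intro x hx
    rcases List.mem_cons.1 hx with rfl | hx
    · have hxP := hlP x List.mem_cons_self
      cases l with
      | nil =>
        have h2 : (G.cover a b L k).head x = v := hl.2
        have h3 := side_eq hst hL hP hψ hxP he (by rw [hev, ← h2, cover_head_val])
        rw [rightIndex_head h2]
        linarith
      | cons z l =>
        have h2 : (G.cover a b L k).tail z = (G.cover a b L k).head x := hl.2.1
        have hzx : G.tail z.1.1 = G.head x.1.1 := by
          have := congrArg (fun y => y.1.1) h2
          simpa only [cover_tail_val, cover_head_val] using this
        have h3 := side_eq hst hL hP hψ hxP (hlP z (by simp)) hzx.symm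
        rw [← h1 z List.mem_cons_self, rightIndex_head (u := (G.cover a b L k).head x) rfl,
          rightIndex_tail h2]
        linarith
    · exact h1 x hx

lemma rightIndex_eq_of_start (hst : G.tail a ≠ G.tail b)
    (hL : G.IsSimplePath (G.tail a) L (G.tail b)) (hP : G.IsSimplePath (G.tail a) P (G.tail b))
    (hψ : ∀ d, G.along P d - G.along L d = G.potFlow ψ d) {l : List (G.CoverDart L k)}
    {u v : G.CoverVertex a b L k} (hl : (G.cover a b L k).IsWalk u l v)
    (hlP : ∀ x ∈ l, x.1.1 ∈ P) {d : D} (hd : d ∈ P) (hdu : G.head d = u.1.1) :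
    ∀ x ∈ l, ψ (G.right x.1.1) + G.rightIndex x =
      ψ (G.right d) + (u.1.2 + 1 - G.leftShift a b L (G.rev d)) := by
  induction l generalizing u d with
  | nil => simp
  | cons y l ih =>
    have hyP := hlP y List.mem_cons_self
    have h0 := side_eq hst hL hP hψ hd hyP (by rw [hdu, ← hl.1, cover_tail_val])
    have hy : ψ (G.right y.1.1) + G.rightIndex y =
        ψ (G.right d) + (u.1.2 + 1 - G.leftShift a b L (G.rev d)) := by
      rw [rightIndex_tail hl.1]
      linarith
    intro x hx
    rcases List.mem_cons.1 hx with rfl | hx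
    · exact hy
    · rw [ih hl.2 (fun x hx => hlP x (List.mem_cons_of_mem _ hx)) hyP (by rw [cover_head_val]) x hx,
        ← hy, rightIndex_head (u := (G.cover a b L k).head y) rfl]

end Sides

namespace Setting

variable [Fintype D] {c : D → ℝ} {f : D → ℝ} {φ : F → ℝ}

lemma flowAcyclic (S : Setting G a b c L f φ) : G.FlowAcyclic f :=
  DartGraph.flowAcyclic_of_simpleCycle S.antisymm S.acyclic

lemma net_nonneg (S : Setting G a b c L f φ) {y : V} (hy : y ≠ G.tail a) : 0 ≤ G.net f y := by
  rw [S.net_eq, if_neg hy, sub_zero]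
  refine mul_nonneg S.value_pos.le ?_
  split_ifs <;> norm_num

lemma net_nonpos (S : Setting G a b c L f φ) {y : V} (hy : y ≠ G.tail b) : G.net f y ≤ 0 := by
  rw [S.net_eq, if_neg hy, zero_sub]
  refine mul_nonpos_of_nonneg_of_nonpos S.value_pos.le ?_
  split_ifs <;> norm_num

lemma exists_walk_from (S : Setting G a b c L f φ) {d : D} (hd : 0 < f d) :
    ∃ l, G.IsWalk (G.tail a) l (G.tail d) ∧ ∀ e ∈ l, 0 < f e :=
  S.flowAcyclic.exists_walk_from S.antisymm (fun _ => S.net_nonneg) hd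

lemma exists_walk_to (S : Setting G a b c L f φ) {d : D} (hd : 0 < f d) :
    ∃ l, G.IsWalk (G.head d) l (G.tail b) ∧ ∀ e ∈ l, 0 < f e :=
  S.flowAcyclic.exists_walk_to S.antisymm (fun _ => S.net_nonpos) hd

lemma source_nonneg (S : Setting G a b c L f φ) {d : D} (hd : G.tail d = G.tail a) : 0 ≤ f d := by
  by_contra h
  have h1 : 0 < f (G.rev d) := by rw [S.antisymm]; linarith
  obtain ⟨l, hl, hpos⟩ := S.exists_walk_from h1
  have := S.flowAcyclic _ (l ++ [G.rev d]) (G.isWalk_concat.2 ⟨hl, by rw [G.head_rev, hd]⟩)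
    fun e he => by
      rcases List.mem_append.1 he with he | he
      · exact hpos e he
      · rw [List.mem_singleton.1 he]; exact h1
  simp at this

lemma sink_nonpos (S : Setting G a b c L f φ) {d : D} (hd : G.tail d = G.tail b) : f d ≤ 0 := by
  by_contra h
  have h1 : 0 < f d := not_le.1 h
  obtain ⟨l, hl, hpos⟩ := S.exists_walk_to h1
  have := S.flowAcyclic (G.tail b) (d :: l) ⟨hd, hl⟩ fun e he => by
    rcases List.mem_cons.1 he with rfl | he
    · exact h1
    · exact hpos e he
  simp at this

/-- At the sources the flow has no inflow, and less outflow than in the graph. -/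
lemma net_source (S : Setting G a b c L f φ) {g : G.CoverDart L k → ℝ}
    (hg : (G.cover a b L k).Conformal (fun x => f x.1.1) g) {v : G.CoverVertex a b L k}
    (hv : v.1.1 = G.tail a) :
    - G.value f (G.tail a) ≤ (G.cover a b L k).net g v ∧ (G.cover a b L k).net g v ≤ 0 := by
  have htail : ∀ x, (G.cover a b L k).tail x = v → 0 ≤ f x.1.1 := fun x hx =>
    S.source_nonneg (by rw [← hv, ← hx, cover_tail_val])
  rw [DartGraph.net_eq_neg_sum_tail _ hg.1]
  constructor
  · have h1 := net_lift S.antisymm v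
    have h2 : 0 ≤ ∑ d with (G.tail d = v.1.1 ∧ ¬ G.Present a b L k v.1.2 d), f d :=
      Finset.sum_nonneg fun d hd => S.source_nonneg (by
        simp only [Finset.mem_filter, Finset.mem_univ, true_and] at hd
        rw [hd.1, hv])
    rw [DartGraph.net_eq_neg_sum_tail _ (fun x => S.antisymm x.1.1)] at h1
    have h3 : ∑ x with (G.cover a b L k).tail x = v, g x ≤
        ∑ x with (G.cover a b L k).tail x = v, f x.1.1 :=
      Finset.sum_le_sum fun x hx => (hg.2 x (htail x (by simpa using hx))).2
    rw [DartGraph.value, ← hv]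
    linarith
  · rw [neg_nonpos]
    exact Finset.sum_nonneg fun x hx => (hg.2 x (htail x (by simpa using hx))).1

/-- At the sinks the flow has no outflow, and less inflow than in the graph. -/
lemma net_sink (S : Setting G a b c L f φ) {g : G.CoverDart L k → ℝ}
    (hg : (G.cover a b L k).Conformal (fun x => f x.1.1) g) {v : G.CoverVertex a b L k}
    (hv : v.1.1 = G.tail b) :
    0 ≤ (G.cover a b L k).net g v ∧ (G.cover a b L k).net g v ≤ G.value f (G.tail a) := by
  have htail : ∀ x, (G.cover a b L k).tail x = v → f x.1.1 ≤ 0 := fun x hx =>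
    S.sink_nonpos (by rw [← hv, ← hx, cover_tail_val])
  have hcon : ∀ x, (G.cover a b L k).tail x = v → f x.1.1 ≤ g x ∧ g x ≤ 0 := fun x hx =>
    hg.nonpos (fun x => S.antisymm x.1.1) (htail x hx)
  rw [DartGraph.net_eq_neg_sum_tail _ hg.1]
  constructor
  · rw [neg_nonneg]
    exact Finset.sum_nonpos fun x hx => (hcon x (by simpa using hx)).2
  · have h1 := net_lift S.antisymm v
    have h2 : ∑ d with (G.tail d = v.1.1 ∧ ¬ G.Present a b L k v.1.2 d), f d ≤ 0 :=
      Finset.sum_nonpos fun d hd => S.sink_nonpos (by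
        simp only [Finset.mem_filter, Finset.mem_univ, true_and] at hd
        rw [hd.1, hv])
    rw [DartGraph.net_eq_neg_sum_tail _ (fun x => S.antisymm x.1.1)] at h1
    have h3 : ∑ x with (G.cover a b L k).tail x = v, f x.1.1 ≤
        ∑ x with (G.cover a b L k).tail x = v, g x :=
      Finset.sum_le_sum fun x hx => (hcon x (by simpa using hx)).1
    have h4 : G.net f v.1.1 = G.value f (G.tail a) := by
      rw [S.net_eq, hv, if_pos rfl, if_neg (Ne.symm S.ne)]; ring
    linarith

lemma conformal_le (S : Setting G a b c L f φ) {g : G.CoverDart L k → ℝ}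
    (hg : (G.cover a b L k).Conformal (fun x => f x.1.1) g) (x : G.CoverDart L k) :
    g x ≤ c x.1.1 := by
  rcases le_total 0 (f x.1.1) with h | h
  · exact (hg.2 x h).2.trans (S.le _)
  · exact (hg.nonpos (fun x => S.antisymm x.1.1) h).2.trans (S.nonneg _)

lemma conformal_of_cancelled (S : Setting G a b c L f φ) {A B : Set (G.CoverVertex a b L k)}
    {g : G.CoverDart L k → ℝ}
    (h : Relation.ReflTransGen ((G.cover a b L k).CancelStep A B) (fun x => f x.1.1) g) :
    (G.cover a b L k).Conformal (fun x => f x.1.1) g := by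
  induction h with
  | refl => exact ⟨fun x => S.antisymm x.1.1, fun x hx => ⟨hx, le_rfl⟩⟩
  | tail _ hstep ih => exact ih.trans (hstep.conformal ih.1)

lemma exists_coverFlow (S : Setting G a b c L f φ) : ∃ f₁, G.IsCoverFlow a b L k c f f₁ := by
  have hV := G.finite_vertex
  have h0 : (G.cover a b L k).Conformal (fun x => f x.1.1) (fun x => f x.1.1) :=
    S.conformal_of_cancelled (A := ∅) (B := ∅) .refl
  obtain ⟨g, hg, hS, hT⟩ := DartGraph.exists_cancelled (G := G.cover a b L k)
    (f := fun x => f x.1.1) (fun x => S.antisymm x.1.1)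
    (S := Set.range (G.coverSource a b L)) (T := Set.range (G.coverSink a b L))
    (fun v hv => (S.net_source h0 (mem_range_coverSource.1 hv)).2)
    (fun v hv => (S.net_sink h0 (mem_range_coverSink.1 hv)).1)
  have hcon := S.conformal_of_cancelled hg
  exact ⟨g, hg, ⟨hcon.1, S.conformal_le hcon⟩, hS, hT⟩

lemma isFlow_extendST (S : Setting G a b c L f φ) {f₁ : G.CoverDart L k → ℝ}
    (h : G.IsCoverFlow a b L k c f f₁) :
    (G.coverST a b L k).IsFlow (G.stCap c (G.value f (G.tail a))) {.S} {.T}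
      (G.extendST a b L k f₁) := by
  have hcon := S.conformal_of_cancelled h.1
  have hanti : ∀ x, G.extendST a b L k f₁ ((G.coverSTSplit a b L k).rev x) =
      - G.extendST a b L k f₁ x := by
    rintro (x | i | i | i | i)
    · exact hcon.1 x
    · exact (neg_neg _).symm
    · rfl
    · rfl
    · exact (neg_neg _).symm
  have hsrc := fun i : Fin (k + 1) => S.net_source hcon (v := G.coverSource a b L i) rfl
  have hsnk := fun i : Fin (k + 1) => S.net_sink hcon (v := G.coverSink a b L i) rfl
  have hle : ∀ x, G.extendST a b L k f₁ x ≤ G.stCap c (G.value f (G.tail a)) x := by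
    rintro (x | i | i | i | i)
    · exact S.conformal_le hcon x
    · exact neg_le.1 (hsrc i).1
    · exact (hsrc i).2
    · exact (hsnk i).2
    · exact neg_nonpos.2 (hsnk i).1
  have hvert : ∀ v, (G.coverSTSplit a b L k).net (G.extendST a b L k f₁) (.vertex v) = 0 := by
    intro v
    rw [net_vertex hanti]
    have h1 : (∑ i, if G.coverSource a b L i = v then G.extendST a b L k f₁ (.source i) else 0) =
        if v.1.1 = G.tail a then - (G.cover a b L k).net f₁ v else 0 := by
      rw [← sum_source_eq v fun _ => - (G.cover a b L k).net f₁ v]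
      refine Finset.sum_congr rfl fun i _ => ?_
      split_ifs with h
      · rw [← h]; rfl
      · rfl
    have h2 : (∑ i, if G.coverSink a b L i = v then G.extendST a b L k f₁ (.sink i) else 0) =
        if v.1.1 = G.tail b then (G.cover a b L k).net f₁ v else 0 := by
      rw [← sum_sink_eq v fun _ => (G.cover a b L k).net f₁ v]
      refine Finset.sum_congr rfl fun i _ => ?_
      split_ifs with h
      · rw [← h]; rfl
      · rfl
    rw [h1, h2]
    change (G.cover a b L k).net f₁ v + _ = 0
    by_cases hs : v.1.1 = G.tail a
    · rw [if_pos hs, if_neg fun ht => S.ne (hs.symm.trans ht)]; ring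
    · rw [if_neg hs]
      by_cases ht : v.1.1 = G.tail b
      · rw [if_pos ht]; ring
      · rw [if_neg ht]
        have h3 : ¬ (G.cover a b L k).net f₁ v < 0 := fun h' =>
          hs (mem_range_coverSource.1 (h.2.2.1 v h'))
        have h4 : ¬ 0 < (G.cover a b L k).net f₁ v := fun h' =>
          ht (mem_range_coverSink.1 (h.2.2.2 v h'))
        linarith
  have hS : (G.coverSTSplit a b L k).net (G.extendST a b L k f₁) .S ≤ 0 := by
    rw [net_S hanti, neg_nonpos]
    exact Finset.sum_nonneg fun i _ => neg_nonneg.2 (hsrc i).2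
  have hT : 0 ≤ (G.coverSTSplit a b L k).net (G.extendST a b L k f₁) .T := by
    rw [net_T hanti]
    exact Finset.sum_nonneg fun i _ => (hsnk i).1
  refine ⟨⟨hanti, hle⟩, fun v hv => ?_, fun v hv => ?_⟩
  · match v with
    | .S => rfl
    | .T => exact absurd hv (not_lt.2 hT)
    | .vertex v => exact absurd hv (hvert v).not_lt
  · match v with
    | .S => exact absurd hv (not_lt.2 hS)
    | .T => rfl
    | .vertex v => exact absurd hv (hvert v).not_gt

/-- A path of cancelled flow that does not lead from a source to a sink ends (or starts) where the
cover is cut off from the universal cover. Its projection continues to a path from `s` to `t` along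
the flow, whose potential relative to `L` is small, so that the path stays near that end of the
cover. -/
lemma cancelled_path (S : Setting G a b c L f φ) {l : List (G.CoverDart L k)}
    {u v : G.CoverVertex a b L k} (hl : (G.cover a b L k).IsWalk u l v)
    (hpos : ∀ x ∈ l, 0 < f x.1.1)
    (huv : (v.1.1 ≠ G.tail a ∧ v.1.1 ≠ G.tail b ∧
        0 < (G.cover a b L k).net (fun x => f x.1.1) v) ∨
      (u.1.1 ≠ G.tail a ∧ u.1.1 ≠ G.tail b ∧
        (G.cover a b L k).net (fun x => f x.1.1) u < 0))
    {x : G.CoverDart L k} (hx : x ∈ l)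
    (hi : 2 * G.facesBetween (G.tail a) (G.tail b) ≤ x.1.2.val) :
    k ≤ x.1.2.val + 2 * G.facesBetween (G.tail a) (G.tail b) := by
  have hV := G.finite_vertex
  have hF := G.finite_face
  have hne : l ≠ [] := by rintro rfl; simp at hx
  have hproj := cover_isWalk_map hl
  have hproj' : ∀ d ∈ l.map fun x => x.1.1, 0 < f d := by
    intro d hd
    obtain ⟨y, hy, rfl⟩ := List.mem_map.1 hd
    exact hpos y hy
  -- the face next to the missing dart at the end of the path lies outside the cover
  obtain ⟨P, g, j, hP, hPpos, hlP, hj, hE⟩ : ∃ (P : List D) (g : F) (j : ℝ),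
      G.IsWalk (G.tail a) P (G.tail b) ∧ (∀ d ∈ P, 0 < f d) ∧ (∀ y ∈ l, y.1.1 ∈ P) ∧
      (j = 0 ∨ j = k + 1) ∧
      (G.IsSimplePath (G.tail a) P (G.tail b) → ∀ ψ : F → ℝ,
        (∀ d, G.along P d - G.along L d = G.potFlow ψ d) →
        ψ (G.right x.1.1) + G.rightIndex x = ψ g + j) := by
    have hghost : ∀ w : G.CoverVertex a b L k, ∀ d, ¬ G.Present a b L k w.1.2 d →
        ((w.1.2 : ℝ) + 1 - G.shift a b L d = 0 ∨ (w.1.2 : ℝ) + 1 - G.shift a b L d = k + 1) ∧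
        G.rightShift a b L d = G.shift a b L d ∧ G.leftShift a b L d = G.shift a b L d := by
      intro w d hd
      obtain ⟨h1, h2⟩ := not_present (coverVertex_le w) hd
      refine ⟨?_, rightShift_eq_leftShift h1⟩
      rcases h2 with ⟨h2, h3⟩ | ⟨h2, h3⟩
      · left; rw [h2, h3]; norm_num
      · right; rw [h2, h3]; norm_num
    rcases huv with ⟨h1, h2, h3⟩ | ⟨h1, h2, h3⟩
    · obtain ⟨d, hd, hd0⟩ : ∃ d, (G.tail d = v.1.1 ∧ ¬ G.Present a b L k v.1.2 d) ∧ 0 < f d := by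
        rw [net_lift S.antisymm, le_antisymm (S.net_nonpos h2) (S.net_nonneg h1), zero_add] at h3
        by_contra hcon
        push Not at hcon
        exact absurd h3 (not_lt.2 (Finset.sum_nonpos fun d hd => hcon d (by simpa using hd)))
      obtain ⟨y, l', rfl⟩ := List.exists_cons_of_ne_nil hne
      obtain ⟨A, hA, hA'⟩ := S.exists_walk_from (hpos y List.mem_cons_self)
      obtain ⟨B, hB, hB'⟩ := S.exists_walk_to hd0
      have hyu : G.tail y.1.1 = u.1.1 := hproj.1
      obtain ⟨hj, hR, -⟩ := hghost v d hd.2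
      refine ⟨A ++ ((y :: l').map (fun x => x.1.1) ++ d :: B), G.right d, _,
        hA.append ((hyu ▸ hproj).append ⟨hd.1, hB⟩), ?_, ?_, hj, ?_⟩
      · intro e he
        rcases List.mem_append.1 he with he | he
        · exact hA' e he
        · rcases List.mem_append.1 he with he | he
          · exact hproj' e he
          · rcases List.mem_cons.1 he with rfl | he
            · exact hd0
            · exact hB' e he
      · intro z hz
        exact List.mem_append_right _ (List.mem_append_left _ (List.mem_map.2 ⟨z, hz, rfl⟩))
      · intro hP ψ hψ
        rw [rightIndex_eq_of_end S.ne S.simple hP hψ hl (fun z hz => List.mem_append_right _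
          (List.mem_append_left _ (List.mem_map.2 ⟨z, hz, rfl⟩))) (e := d)
          (List.mem_append_right _ (List.mem_append_right _ List.mem_cons_self)) hd.1 x hx, hR]
    · obtain ⟨d, hd, hd0⟩ : ∃ d, (G.tail d = u.1.1 ∧ ¬ G.Present a b L k u.1.2 d) ∧ f d < 0 := by
        rw [net_lift S.antisymm, le_antisymm (S.net_nonpos h2) (S.net_nonneg h1), zero_add] at h3
        by_contra hcon
        push Not at hcon
        exact absurd h3 (not_lt.2 (Finset.sum_nonneg fun d hd => hcon d (by simpa using hd)))
      have hd1 : 0 < f (G.rev d) := by rw [S.antisymm]; linarith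
      obtain ⟨l', y, hl'⟩ : ∃ l' y, l = l' ++ [y] := by
        rcases List.eq_nil_or_concat l with h | ⟨l', y, h⟩
        · exact absurd h hne
        · exact ⟨l', y, by rw [h, List.concat_eq_append]⟩
      obtain ⟨A, hA, hA'⟩ := S.exists_walk_from hd1
      obtain ⟨B, hB, hB'⟩ := S.exists_walk_to (hpos y (by simp [hl']))
      have hyv : G.head y.1.1 = v.1.1 := by
        have h := hproj
        rw [hl', List.map_append] at h
        exact (G.isWalk_concat.1 h).2
      obtain ⟨hj, -, hR⟩ := hghost u d hd.2
      have hmem : ∀ z ∈ l, z.1.1 ∈ A ++ (G.rev d :: (l.map (fun x => x.1.1) ++ B)) := fun z hz =>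
        List.mem_append_right _ (List.mem_cons_of_mem _
          (List.mem_append_left _ (List.mem_map.2 ⟨z, hz, rfl⟩)))
      refine ⟨A ++ (G.rev d :: (l.map (fun x => x.1.1) ++ B)), G.left d, _,
        hA.append ⟨rfl, ?_⟩, ?_, hmem, hj, ?_⟩
      · rw [G.head_rev, hd.1]
        exact hproj.append (hyv ▸ hB)
      · intro e he
        rcases List.mem_append.1 he with he | he
        · exact hA' e he
        · rcases List.mem_cons.1 he with rfl | he
          · exact hd1
          · rcases List.mem_append.1 he with he | he
            · exact hproj' e he
            · exact hB' e he
      · intro hP ψ hψ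
        rw [rightIndex_eq_of_start S.ne S.simple hP hψ hl hmem (d := G.rev d)
          (List.mem_append_right _ List.mem_cons_self) (by rw [G.head_rev, hd.1]) x hx, G.rev_rev,
          hR, G.right_rev]
  -- An acyclic flow has simple paths only.
  have hsimple := S.flowAcyclic.isSimplePath hP hPpos
  obtain ⟨ψ, hψ0, hψ⟩ := G.isSphere.exists_potential_zero (G.right b)
    (w := fun d => G.along P d - G.along L d)
    (fun d => by rw [G.along_rev, G.along_rev]; ring)
    (fun y => by rw [G.net_sub, G.net_along hP, G.net_along S.simple.1, sub_self])
  have hE' := hE hsimple ψ hψ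
  have hb := S.path_potential hsimple hPpos hψ0 hψ
  have h1 := hb g
  have h2 := hb (G.right x.1.1)
  have h3 := hb (G.left x.1.1)
  have h4 := hψ x.1.1
  rw [hsimple.along_eq_one (hlP x hx), S.simple.along_eq, FacedGraph.potFlow] at h4
  have h5 : (2 * G.facesBetween (G.tail a) (G.tail b) : ℝ) ≤ x.1.2.val := by exact_mod_cast hi
  have h6 : (k : ℝ) ≤ x.1.2.val + 2 * G.facesBetween (G.tail a) (G.tail b) := by
    rw [rightIndex] at hE'
    by_cases h : G.rev x.1.1 ∈ L
    · rw [if_pos h] at hE' h4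
      rw [if_neg fun h' => S.simple.rev_notMem h' h] at h4
      rcases hj with rfl | rfl <;> linarith
    · rw [if_neg h] at hE'
      rcases hj with rfl | rfl <;> linarith
  exact_mod_cast h6

/-- Flow cancelling does not change the flow in the middle of the cover. -/
lemma cancelled_eq (S : Setting G a b c L f φ) {f₁ : G.CoverDart L k → ℝ}
    (h : Relation.ReflTransGen ((G.cover a b L k).CancelStep
      (Set.range (G.coverSource a b L)) (Set.range (G.coverSink a b L))) (fun x => f x.1.1) f₁)
    {x : G.CoverDart L k}
    (hx : 2 * G.facesBetween (G.tail a) (G.tail b) ≤ x.1.2.val)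
    (hxk : x.1.2.val + 2 * G.facesBetween (G.tail a) (G.tail b) < k) : f₁ x = f x.1.1 := by
  have hnet : ∀ g, Relation.ReflTransGen ((G.cover a b L k).CancelStep
      (Set.range (G.coverSource a b L)) (Set.range (G.coverSink a b L))) (fun x => f x.1.1) g →
      ∀ y : G.CoverVertex a b L k, y ∉ Set.range (G.coverSource a b L (k := k)) →
        y ∉ Set.range (G.coverSink a b L (k := k)) →
      (0 < (G.cover a b L k).net g y → 0 < (G.cover a b L k).net (fun x => f x.1.1) y) ∧
      ((G.cover a b L k).net g y < 0 → (G.cover a b L k).net (fun x => f x.1.1) y < 0) := by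
    intro g hg
    induction hg with
    | refl => exact fun _ _ _ => ⟨id, id⟩
    | tail _ hstep ih =>
      intro y hs ht
      exact ⟨fun h => (ih y hs ht).1 ((hstep.net_imp hs ht).1 h),
        fun h => (ih y hs ht).2 ((hstep.net_imp hs ht).2 h)⟩
  induction h with
  | refl => rfl
  | @tail g g' hg hstep ih =>
    have hcon := S.conformal_of_cancelled hg
    obtain ⟨u, v, l, δ, hl, hδ, hle, hu, hv, huv, rfl⟩ := hstep
    have hpos : ∀ y ∈ l, 0 < f y.1.1 := fun y hy =>
      hcon.pos (fun x => S.antisymm x.1.1) (hδ.trans_le (hle y hy))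
    have hend : (v.1.1 ≠ G.tail a ∧ v.1.1 ≠ G.tail b ∧
        0 < (G.cover a b L k).net (fun x => f x.1.1) v) ∨
      (u.1.1 ≠ G.tail a ∧ u.1.1 ≠ G.tail b ∧
        (G.cover a b L k).net (fun x => f x.1.1) u < 0) := by
      by_cases hvT : v ∈ Set.range (G.coverSink a b L (k := k))
      · have huS := fun h => huv ⟨h, hvT⟩
        obtain ⟨huT, h1⟩ := hu.resolve_left huS
        exact Or.inr ⟨fun h => huS (mem_range_coverSource.2 h),
          fun h => huT (mem_range_coverSink.2 h), (hnet g hg u huS huT).2 (by linarith)⟩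
      · obtain ⟨hvS, h1⟩ := hv.resolve_left hvT
        exact Or.inl ⟨fun h => hvS (mem_range_coverSource.2 h),
          fun h => hvT (mem_range_coverSink.2 h), (hnet g hg v hvS hvT).1 (by linarith)⟩
    have hnot : ∀ y ∈ l, y.1.2.val ≠ x.1.2.val := by
      intro y hy hyx
      have := S.cancelled_path hl.1 hpos hend hy (by omega)
      omega
    have h0 : (G.cover a b L k).along l x = 0 :=
      DartGraph.along_eq_zero _ (fun h => hnot x h rfl) (fun h => hnot _ h rfl)
    change g x - δ * (G.cover a b L k).along l x = _
    rw [h0, ih]; ring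

end Setting

end PlaneGraph

end PlanarFlow

end

/-! ### Leftmost paths and leftmost maximum flows -/

noncomputable section

namespace PlanarFlow

open scoped Classical

namespace PlaneGraph

variable {V D F : Type*} {G : PlaneGraph V D F}

section Flows

variable [Fintype D]

lemma net_potFlow (p : F → ℝ) (y : V) : G.net (G.potFlow p) y = 0 :=
  G.isSphere.net_potFlow p y

lemma exists_dualWalk (x y : F) : ∃ l, G.IsDualWalk x l y :=
  FacedGraph.exists_dualWalk _ G.isSphere.dual_connected x y

lemma net_potFlow_add (p : F → ℝ) (f : D → ℝ) (y : V) :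
    G.net (fun d => G.potFlow p d + f d) y = G.net f y := by
  rw [G.net_add, net_potFlow, zero_add]

/-- Flows for the capacities reduced by a circulation are flows without this circulation. -/
lemma isFlow_potFlow_add {c f : D → ℝ} {A B : Set V} (p : F → ℝ) :
    G.IsFlow c A B (fun d => G.potFlow p d + f d) ↔
      G.IsFlow (fun d => c d - G.potFlow p d) A B f := by
  simp only [DartGraph.IsFlow, DartGraph.IsPseudoflow, net_potFlow_add, G.potFlow_rev]
  refine and_congr (and_congr (forall_congr' fun d => ?_) (forall_congr' fun d => ?_)) Iff.rfl
  · constructor <;> intro h <;> linarith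
  · constructor <;> intro h <;> linarith

lemma isLeftmostMaxFlow_potFlow_add {c f : D → ℝ} {s t : V} {o : F} (p : F → ℝ)
    (h : G.IsLeftmostMaxFlow o (fun d => c d - G.potFlow p d) s t f) :
    G.IsLeftmostMaxFlow o c s t fun d => G.potFlow p d + f d := by
  refine ⟨⟨(isFlow_potFlow_add p).2 h.1.1, fun g hg => ?_⟩, ?_⟩
  · have h1 : g = fun d => G.potFlow p d + (g d - G.potFlow p d) := funext fun d => by ring
    rw [h1] at hg ⊢
    have h2 := h.1.2 _ ((isFlow_potFlow_add p).1 hg)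
    simp only [DartGraph.value, net_potFlow_add] at h2 ⊢
    exact h2
  · have h1 : (fun d => c d - (G.potFlow p d + f d)) = fun d => c d - G.potFlow p d - f d :=
      funext fun d => by ring
    rw [h1]
    exact h.2

lemma exists_leftmostMaxFlow {c : D → ℝ} (hc : ∀ d, 0 ≤ c d) (s t : V) (o : F) :
    ∃ f, G.IsLeftmostMaxFlow o c s t f := by
  have hV := G.finite_vertex
  obtain ⟨f, hf⟩ := G.exists_maxFlow hc s t
  have hr : ∀ d, 0 ≤ c d - f d := fun d => sub_nonneg.2 (hf.1.1.2 d)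
  have hle := FacedGraph.dualFlow_le hr (G.exists_dualWalk o)
  have hcw := FacedGraph.cwAcyclic_sub_dualFlow hr (G.exists_dualWalk o)
  refine ⟨fun d => G.dualFlow (fun d => c d - f d) o d + f d, ⟨?_, fun g hg => ?_⟩, ?_⟩
  · refine (isFlow_potFlow_add _).2 ⟨⟨hf.1.1.1, fun d => ?_⟩, hf.1.2⟩
    have : G.potFlow (G.dualDist (fun d => c d - f d) o) d ≤ c d - f d := hle d
    linarith
  · have h := hf.2 g hg
    have h1 : G.net (fun d => G.dualFlow (fun d => c d - f d) o d + f d) s = G.net f s :=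
      net_potFlow_add _ f s
    rw [DartGraph.value, DartGraph.value, h1]
    exact h
  · have h1 : (fun d => c d - (G.dualFlow (fun d => c d - f d) o d + f d)) =
        fun d => c d - f d - G.dualFlow (fun d => c d - f d) o d := funext fun d => by ring
    rw [h1]
    exact hcw

/-- Among the residual paths, one with the largest sum of the potentials of the faces is leftmost.
-/
lemma exists_leftmostPath {c : D → ℝ} {s t : V} {o : F} (h : ∃ l, G.IsResidualPath c s t l) :
    ∃ L, G.IsLeftmostPath o c s t L := by
  have hV := G.finite_vertex
  have hF := G.finite_face
  have := Fintype.ofFinite F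
  obtain ⟨L₀, hL₀⟩ := h
  have hp : ∀ A, ∃ p : F → ℝ, G.IsResidualPath c s t A → p o = 0 ∧
      ∀ d, G.along A d - G.along L₀ d = G.potFlow p d := by
    intro A
    by_cases hA : G.IsResidualPath c s t A
    · obtain ⟨p, h⟩ := G.isSphere.exists_potential_zero o
        (w := fun d => G.along A d - G.along L₀ d)
        (fun d => by rw [G.along_rev, G.along_rev]; ring)
        (fun y => by rw [G.net_sub, G.net_along hA.1.1, G.net_along hL₀.1.1, sub_self])
      exact ⟨p, fun _ => h⟩
    · exact ⟨0, fun h => absurd h hA⟩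
  choose p hp using hp
  have hfin : {A | G.IsResidualPath c s t A}.Finite :=
    (List.finite_length_le D (Fintype.card D)).subset fun A hA => hA.1.nodup.length_le_card
  obtain ⟨L, hL, hmax⟩ := Set.exists_max_image _ (fun A => ∑ x, p A x) hfin ⟨L₀, hL₀⟩
  refine ⟨L, hL, ?_⟩
  rintro A hA ⟨q, hq0, hq, hqd⟩
  have h1 : ∀ x, p A x - p L x - q x = 0 :=
    G.isSphere.eq_zero_of_potFlow (o := o) (by rw [(hp A hA).1, (hp L hL).1, hq0]; ring) fun d => by
      have h2 := (hp A hA).2 d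
      have h3 := (hp L hL).2 d
      have h4 := hqd d
      simp only [FacedGraph.potFlow] at *
      linarith
  have h2 : ∑ x, q x ≤ 0 := by
    have h3 := hmax A hA
    have h4 : ∑ x, q x = ∑ x, p A x - ∑ x, p L x := by
      rw [← Finset.sum_sub_distrib]
      exact Finset.sum_congr rfl fun x _ => by linarith [h1 x]
    linarith
  have h3 : ∀ x, q x = 0 := fun x =>
    (Finset.sum_eq_zero_iff_of_nonneg fun x _ => hq x).1
      (le_antisymm h2 (Finset.sum_nonneg fun x _ => hq x)) x (Finset.mem_univ x)
  refine hA.1.eq_of_along hL.1 fun d => ?_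
  have := hqd d
  rw [h3, h3] at this
  linarith

/-- Without a residual path no flow has a positive value. -/
lemma isLeftmostMaxFlow_zero {c : D → ℝ} (hc : ∀ d, 0 ≤ c d) {s t : V} (hst : s ≠ t) {o : F}
    (hcw : G.CwAcyclic o c) (h : ¬ ∃ l, G.IsResidualPath c s t l) :
    G.IsLeftmostMaxFlow o c s t fun _ => 0 := by
  have hV := G.finite_vertex
  refine ⟨⟨⟨⟨fun d => by simp, hc⟩, ?_, ?_⟩, fun g hg => ?_⟩, by simpa using hcw⟩
  · intro v hv; rw [G.net_zero] at hv; exact absurd hv (lt_irrefl _)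
  · intro v hv; rw [G.net_zero] at hv; exact absurd hv (lt_irrefl _)
  · rw [DartGraph.value, DartGraph.value, G.net_zero]
    by_contra h1
    obtain ⟨l, hl, hpos⟩ := G.exists_path_of_value_pos hst hg.1.1
      (r := G.value g s) (by rw [DartGraph.value]; linarith) (hg.net_eq hst)
    exact h ⟨l, hl, fun d hd => (hpos d hd).trans_le (hg.1.2 d)⟩

end Flows

section Cover

variable [Fintype D] {a b : D} {L : List D} {c f : D → ℝ} {φ : F → ℝ} {k : ℕ}

namespace Setting

lemma isLeftmostCoverFlow_iff (S : Setting G a b c L f φ) {M : ℝ} (hM : 0 ≤ M)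
    {g : G.STDart L k → ℝ} : G.IsLeftmostCoverFlow a b L k c M g ↔
      g = (G.coverSTSplit a b L k).dualFlow (G.stCap c M) (.inr false) := by
  have hV := G.finite_vertex
  have hF := G.finite_face
  have h := isLeftmostMaxFlow_dualFlow (k := k) S.ne S.simple (stCap_nonneg S.nonneg hM)
  constructor
  · intro hg
    exact (coverST_isSphere S.ne S.simple).leftmostMaxFlow_unique (by intro h; cases h) hg h
  · rintro rfl
    exact h

end Setting

end Cover

end PlaneGraph

end PlanarFlow

end

theorem mainTheorem1 {V D F : Type*} [Fintype D] (G : PlanarFlow.PlaneGraph V D F)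
    (a b : D) (hst : G.tail a ≠ G.tail b) :
    (∀ c : D → ℝ, (∀ d, 0 ≤ c d) → G.CwAcyclic (G.right b) c →
      ∀ L : List D, G.IsLeftmostPath (G.right b) c (G.tail a) (G.tail b) L →
      ∀ f : D → ℝ, G.IsLeftmostMaxFlow (G.right b) c (G.tail a) (G.tail b) f →
      ∀ k : ℕ, 4 * G.facesBetween (G.tail a) (G.tail b) + 1 ≤ k →
        (∃ f₁, G.IsCoverFlow a b L k c f f₁) ∧
        (∃! g, G.IsLeftmostCoverFlow a b L k c (G.value f (G.tail a)) g) ∧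
        ∀ g, G.IsLeftmostCoverFlow a b L k c (G.value f (G.tail a)) g →
          (∀ f₁, G.IsCoverFlow a b L k c f f₁ →
            (G.coverST a b L k).IsFlow (G.stCap c (G.value f (G.tail a)))
              {PlanarFlow.PlaneGraph.STVertex.S} {PlanarFlow.PlaneGraph.STVertex.T}
              (G.extendST a b L k f₁) ∧
            ∀ x : G.CoverDart L k,
              2 * G.facesBetween (G.tail a) (G.tail b) ≤ x.1.2.val →
              x.1.2.val + 2 * G.facesBetween (G.tail a) (G.tail b) < k →
              g (.dart x) = G.extendST a b L k f₁ (.dart x)) ∧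
          (∀ x : G.CoverDart L k,
            2 * G.facesBetween (G.tail a) (G.tail b) ≤ x.1.2.val →
            x.1.2.val + 2 * G.facesBetween (G.tail a) (G.tail b) < k →
            g (.dart x) = f x.1.1)) ∧
    (∀ c₀ h c : D → ℝ, (∀ d, 0 ≤ c₀ d) → h = G.dualFlow c₀ (G.right b) →
      c = (fun d => c₀ d - h d) →
      (∀ d, 0 ≤ c d) ∧ G.CwAcyclic (G.right b) c ∧
      ((∃ L, G.IsLeftmostPath (G.right b) c (G.tail a) (G.tail b) L) ∨
        G.IsLeftmostMaxFlow (G.right b) c₀ (G.tail a) (G.tail b) h) ∧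
      ∀ L : List D, G.IsLeftmostPath (G.right b) c (G.tail a) (G.tail b) L →
      ∀ k : ℕ, 4 * G.facesBetween (G.tail a) (G.tail b) + 1 ≤ k →
      ∀ i : Fin (k + 1), i.val = 2 * G.facesBetween (G.tail a) (G.tail b) →
      ∀ M : ℝ, ∑ d, c d ≤ M →
      ∀ v : ℝ, v = (G.coverSTSplit a b L k).dualFlow (G.stCap c M) (Sum.inr false) (.source i) →
      ∀ g : G.STDart L k → ℝ,
        g = (G.coverSTSplit a b L k).dualFlow (G.stCap c v) (Sum.inr false) →
        ∃ f : D → ℝ,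
          G.IsLeftmostMaxFlow (G.right b) c (G.tail a) (G.tail b) f ∧
          v = G.value f (G.tail a) ∧
          G.IsLeftmostCoverFlow a b L k c v g ∧
          (∀ x : G.CoverDart L k, x.1.2 = i → g (.dart x) = f x.1.1) ∧
          G.IsLeftmostMaxFlow (G.right b) c₀ (G.tail a) (G.tail b) (fun d => h d + f d)) := by
  classical
  constructor
  · intro c hc hcw L hL f hf k hk
    obtain ⟨φ, S⟩ := PlanarFlow.PlaneGraph.exists_setting hst hc hcw hL hf
    have hiff := fun g => S.isLeftmostCoverFlow_iff (k := k) (g := g) S.value_pos.le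
    refine ⟨S.exists_coverFlow, ⟨_, (hiff _).2 rfl, fun g hg => (hiff g).1 hg⟩, fun g hg => ?_⟩
    obtain rfl := (hiff g).1 hg
    refine ⟨fun f₁ hf₁ => ⟨S.isFlow_extendST hf₁, fun x hx hxk => ?_⟩, S.dualFlow_dart⟩
    rw [S.dualFlow_dart x hx hxk]
    exact (S.cancelled_eq hf₁.1 hx hxk).symm
  · rintro c₀ h c hc₀ rfl rfl
    have hc : ∀ d, 0 ≤ c₀ d - G.dualFlow c₀ (G.right b) d := fun d =>
      sub_nonneg.2 (PlanarFlow.FacedGraph.dualFlow_le hc₀ (G.exists_dualWalk _) d)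
    have hcw := PlanarFlow.FacedGraph.cwAcyclic_sub_dualFlow hc₀ (G.exists_dualWalk (G.right b))
    refine ⟨hc, hcw, ?_, ?_⟩
    · by_cases hres : ∃ l, G.IsResidualPath (fun d => c₀ d - G.dualFlow c₀ (G.right b) d)
          (G.tail a) (G.tail b) l
      · exact Or.inl (PlanarFlow.PlaneGraph.exists_leftmostPath hres)
      · have h0 := PlanarFlow.PlaneGraph.isLeftmostMaxFlow_zero hc hst hcw hres
        have h1 := PlanarFlow.PlaneGraph.isLeftmostMaxFlow_potFlow_add _ h0
        simp only [add_zero] at h1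
        exact Or.inr h1
    · rintro L hL k hk i hi M hM v hv g rfl
      obtain ⟨f, hf⟩ := PlanarFlow.PlaneGraph.exists_leftmostMaxFlow (G := G) hc (G.tail a)
        (G.tail b) (G.right b)
      obtain ⟨φ, S⟩ := PlanarFlow.PlaneGraph.exists_setting hst hc hcw hL hf
      rw [S.dualFlow_source (S.value_le_sum.trans hM) hk hi] at hv
      subst hv
      refine ⟨f, hf, rfl, (S.isLeftmostCoverFlow_iff S.value_pos.le).2 rfl, fun x hx => ?_,
        PlanarFlow.PlaneGraph.isLeftmostMaxFlow_potFlow_add _ hf⟩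
      have hxi : x.1.2.val = i.val := congrArg Fin.val hx
      exact S.dualFlow_dart x (by omega) (by omega)
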